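/- Let $\kappa$ be an algebraically closed field of characteristic $p>0$, let $K$ be a finite extension of $W(\kappa)[1/p]$, let $\mathcal{O}$ be the integral closure of $W(\kappa)$ in $K$, and let $\varpi\in\mathcal{O}$ be a uniformizer. For a perfect $\kappa$-algebra $R$ put $W_{\mathcal{O}}(R)=W(R)\otimes_{W(\kappa)}\mathcal{O}$. Let $\Omega,\Xi$ be finite free $\mathcal{O}$-modules of the same rank $n$, viewed as affine spaces over $\operatorname{Spec}\mathcal{O}$, and let $L^+(\Omega)$, $L^+(\Xi)$ be the perfect affine $\kappa$-schemes representing $R\mapsto \Omega(W_{\mathcal{O}}(R))$ and $R\mapsto\Xi(W_{\mathcal{O}}(R))$ on perfect $\kappa$-algebras. Let $f:\Omega\to\Xi$ be a morphism of schemes over $\operatorname{Spec}\mathcal{O}$ (not necessarily linear), and $L^+(f):L^+(\Omega)\to L^+(\Xi)$ the induced morphism. For $x\in\Omega(\mathcal{O})=L^+(\Omega)(\kappa)$ let $d(f;x)\in\mathbb{N}\cup\{\infty\}$ be the $\varpi$-adic valuation of the determinant of the Jacobian matrix of $f$ at $x$ with respect to linear coordinates on $\Omega$ and $\Xi$. Definitions.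 A morphism of perfect schemes is perfectly finitely presented (pfp) if it is the perfection of a finitely presented morphism; a pfp-locally closed subscheme is one whose inclusion is a pfp locally closed immersion. A morphism $X\to Y$ is perfectly smooth if étale locally on $X$ it factors as an étale morphism to $(\mathbb{A}^m_Y)_{\mathrm{perf}}$ followed by the projection; it is strongly pro perfectly smooth if $X$ is a cofiltered limit of pfp perfectly smooth $Y$-schemes with pfp, perfectly smooth, affine transition maps. A morphism $X\to Y$ of perfect affine schemes over $\kappa$ has relative dimension $d$ if it is the base change, along a strongly pro perfectly smooth $\kappa$-morphism $Y\to Y_0$, of a morphism $f_0:X_0\to Y_0$ of perfect schemes pfp over $\kappa$ with $\dim_x X_0-\dim_{f_0(x)}Y_0=d$ for all $x\in X_0$. In general, a morphism $X\to Y$ has relative dimension $d$ if there are a covering $\{V_a\to Y\}$ (admitting sections étale locally on $Y$) by affine schemes strongly pro perfectly smooth over $Y$, and étale coverings $\{Z_{ab}\to X\times_Y V_a\}_b$ by affine schemes, such that every $Z_{ab}\to V_a$ has relative dimension $d$. A pfp-locally closed subscheme has pure codimension $c$ if its inclusion has relative dimension $-c$. Theorem. Let $X\subset L^+(\Omega)$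 and $Y\subset L^+(\Xi)$ be pfp-locally closed subschemes of pure codimensions $c_X$ and $c_Y$, with $X$ non-empty and $X=L^+(f)^{-1}(Y)$. Suppose that $L^+(f)|_X:X\to Y$ is finite étale, and that there is $e\in\mathbb{N}$ such that $d(f;x)=e$ for every $x\in X(\kappa)$. Then $c_Y=c_X+e$. -/

import Mathlib

open CategoryTheory CategoryTheory.Limits AlgebraicGeometry TensorProduct

universe u v w w'

noncomputable section

/-! ## The ring of integers is finite free over the Witt vectors -/

theorem wittVector_charZero (p : ℕ) [Fact p.Prime] (κ : Type u) [Field κ] [CharP κ p] :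
    CharZero (WittVector p κ) := by
  obtain ⟨q, hq⟩ := CharP.exists (WittVector p κ)
  rcases CharP.char_is_prime_or_zero (WittVector p κ) q with h | h
  · exfalso
    have h0 : (q : κ) = 0 := by
      rw [← map_natCast (WittVector.constantCoeff (p := p) (R := κ)) q, CharP.cast_eq_zero, map_zero]
    have h1 : p = q := (Nat.prime_dvd_prime_iff_eq Fact.out h).1 ((CharP.cast_eq_zero_iff κ p q).1 h0)
    subst h1
    exact WittVector.p_nonzero p κ (CharP.cast_eq_zero _ _)
  · subst h
    exact CharP.charP_to_charZero _

section RingOfIntegers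

variable (p : ℕ) [Fact p.Prime] (κ : Type u) [Field κ] [IsAlgClosed κ] [CharP κ p]
  (K : Type v) [Field K] [Algebra (FractionRing (WittVector p κ)) K]
  [FiniteDimensional (FractionRing (WittVector p κ)) K]
  [Algebra (WittVector p κ) K] [IsScalarTower (WittVector p κ) (FractionRing (WittVector p κ)) K]

instance wittFractionRing_charZero : CharZero (FractionRing (WittVector p κ)) :=
  haveI := wittVector_charZero p κ
  charZero_of_injective_algebraMap
    (IsFractionRing.injective (WittVector p κ) (FractionRing (WittVector p κ)))

instance ringOfIntegers_finite :
    Module.Finite (WittVector p κ) (integralClosure (WittVector p κ) K) :=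
  IsIntegralClosure.finite (WittVector p κ) (FractionRing (WittVector p κ)) K _

instance ringOfIntegers_free :
    Module.Free (WittVector p κ) (integralClosure (WittVector p κ) K) :=
  haveI : Module.IsTorsionFree (WittVector p κ) K :=
    Module.IsTorsionFree.trans_faithfulSMul (WittVector p κ) (FractionRing (WittVector p κ)) K
  IsIntegralClosure.module_free (WittVector p κ) (FractionRing (WittVector p κ)) K _

end RingOfIntegers

/-! ## Arc spaces of finite free modules -/

section ArcSpace

/-- The ring of Witt vectors `W(R)`, regarded as an algebra over `W(κ)` by functoriality. -/
def WittAlg (p : ℕ) [Fact p.Prime] (κ : Type u) [CommRing κ] (R : Type w) [CommRing R]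
    [Algebra κ R] : Type w :=
  WittVector p R

variable (p : ℕ) [Fact p.Prime] (κ : Type u) [Field κ] [CharP κ p]

instance (R : Type w) [CommRing R] [Algebra κ R] : CommRing (WittAlg p κ R) :=
  inferInstanceAs (CommRing (WittVector p R))

instance (R : Type w) [CommRing R] [Algebra κ R] : Algebra (WittVector p κ) (WittAlg p κ R) :=
  (show WittVector p κ →+* WittAlg p κ R from WittVector.map (algebraMap κ R)).toAlgebra

/-- The Witt vector with given components. -/
def WittAlg.mk {R : Type w} [CommRing R] [Algebra κ R] (a : ℕ → R) : WittAlg p κ R :=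
  WittVector.mk p a

/-- The components of a Witt vector. -/
def WittAlg.coeff {R : Type w} [CommRing R] [Algebra κ R] (x : WittAlg p κ R) : ℕ → R :=
  WittVector.coeff x

/-- The homomorphism `W(R) → W(S)` induced by `R → S`. -/
def WittAlg.map {R S : Type*} [CommRing R] [CommRing S] [Algebra κ R] [Algebra κ S]
    (φ : R →ₐ[κ] S) : WittAlg p κ R →ₐ[WittVector p κ] WittAlg p κ S :=
  { (show WittAlg p κ R →+* WittAlg p κ S from WittVector.map φ.toRingHom) with
    commutes' := fun x => WittVector.ext fun n => by
      change (WittVector.map φ.toRingHom (WittVector.map (algebraMap κ R) x)).coeff n =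
        (WittVector.map (algebraMap κ S) x).coeff n
      simp [WittVector.map_coeff] }

variable (O : Type v) [CommRing O] [Algebra (WittVector p κ) O]

/-- `W_O(R) = O ⊗_{W(κ)} W(R)`. -/
abbrev RamWitt (R : Type w) [CommRing R] [Algebra κ R] : Type (max v w) :=
  O ⊗[WittVector p κ] WittAlg p κ R

/-- Functoriality of `W_O`. -/
def RamWitt.map {R S : Type*} [CommRing R] [CommRing S] [Algebra κ R] [Algebra κ S]
    (φ : R →ₐ[κ] S) : RamWitt p κ O R →ₐ[O] RamWitt p κ O S :=
  Algebra.TensorProduct.map (AlgHom.id O O) (WittAlg.map p κ φ)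

/-- The coordinate ring `Sym(Ω^∨)` of the affine space over `O` attached to a finite free
`O`-module `Ω`. -/
abbrev CoordRing (O : Type v) [CommRing O] (Ω : Type w) [AddCommGroup Ω] [Module O Ω] : Type _ :=
  SymmetricAlgebra O (Module.Dual O Ω)

/-- The `O`-point of the affine space of `Ω` given by an element of `Ω`. -/
def evalAt {O : Type v} [CommRing O] {Ω : Type w} [AddCommGroup Ω] [Module O Ω] (x : Ω) :
    CoordRing O Ω →ₐ[O] O :=
  SymmetricAlgebra.lift (Module.Dual.eval O Ω x)

variable (Ω : Type w) [AddCommGroup Ω] [Module O Ω]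

/-- Indices for the Witt coordinates of an `O`-arc in `Ω`: a coordinate of `Ω` over `O`,
a coordinate of `O` over `W(κ)`, and the index of a component of a Witt vector. -/
abbrev ArcIndex : Type :=
  Fin (Module.finrank O Ω) × Fin (Module.finrank (WittVector p κ) O) × ℕ

/-- The coordinate ring of the arc space `L⁺(Ω)`: the perfection of the polynomial ring over `κ`
in the Witt coordinates. It represents `R ↦ Ω(W_O(R))` on perfect `κ`-algebras, see
`arcHom_bijective`. -/
def ArcRing : Type u :=
  PerfectClosure (MvPolynomial (ArcIndex p κ O Ω) κ) p

instance : CommRing (ArcRing p κ O Ω) :=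
  inferInstanceAs (CommRing (PerfectClosure (MvPolynomial (ArcIndex p κ O Ω) κ) p))

instance : CharP (ArcRing p κ O Ω) p :=
  inferInstanceAs (CharP (PerfectClosure (MvPolynomial (ArcIndex p κ O Ω) κ) p) p)

instance : PerfectRing (ArcRing p κ O Ω) p :=
  inferInstanceAs (PerfectRing (PerfectClosure (MvPolynomial (ArcIndex p κ O Ω) κ) p) p)

/-- The map from the polynomial ring in the Witt coordinates to its perfection. -/
def ArcRing.of : MvPolynomial (ArcIndex p κ O Ω) κ →+* ArcRing p κ O Ω :=
  PerfectClosure.of (MvPolynomial (ArcIndex p κ O Ω) κ) p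

instance : Algebra κ (ArcRing p κ O Ω) :=
  ((ArcRing.of p κ O Ω).comp MvPolynomial.C).toAlgebra

variable [Nontrivial O] [Module.Free (WittVector p κ) O] [Module.Finite (WittVector p κ) O]
  [Module.Free O Ω] [Module.Finite O Ω]

/-- The universal arc, a `W_O(ArcRing)`-point of `Ω`. -/
def univArc : CoordRing O Ω →ₐ[O] RamWitt p κ O (ArcRing p κ O Ω) :=
  SymmetricAlgebra.lift ((Module.finBasis O Ω).dualBasis.constr O fun i =>
    ∑ j, Module.finBasis (WittVector p κ) O j ⊗ₜ[WittVector p κ]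
      WittAlg.mk p κ (fun k => ArcRing.of p κ O Ω (MvPolynomial.X (i, j, k))))

variable {Ω} in
/-- The `W_O(R)`-point of `Ω` attached to an `R`-point of `L⁺(Ω)`. -/
def arcHom {R : Type*} [CommRing R] [Algebra κ R] (φ : ArcRing p κ O Ω →ₐ[κ] R) :
    CoordRing O Ω →ₐ[O] RamWitt p κ O R :=
  (RamWitt.map p κ O φ).comp (univArc p κ O Ω)

variable {Ω} in
/-- The Witt coordinates of a `W_O(R)`-point of `Ω`. -/
def arcCoord {R : Type*} [CommRing R] [Algebra κ R] (a : CoordRing O Ω →ₐ[O] RamWitt p κ O R)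
    (t : ArcIndex p κ O Ω) : R :=
  WittAlg.coeff p κ (TensorProduct.equivFinsuppOfBasisLeft (N := WittAlg p κ R)
    (Module.finBasis (WittVector p κ) O)
    (a (SymmetricAlgebra.ι O _ ((Module.finBasis O Ω).dualBasis t.1))) t.2.1) t.2.2

variable {Ω} in
theorem arcCoord_arcHom {R : Type*} [CommRing R] [Algebra κ R] (φ : ArcRing p κ O Ω →ₐ[κ] R)
    (t : ArcIndex p κ O Ω) :
    arcCoord p κ O (arcHom p κ O φ) t = φ (ArcRing.of p κ O Ω (MvPolynomial.X t)) := by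
  obtain ⟨i, j, k⟩ := t
  rw [arcCoord, arcHom, AlgHom.comp_apply, univArc, SymmetricAlgebra.lift_ι_apply, Module.Basis.constr_basis,
    map_sum, map_sum, Finsupp.finsetSum_apply, Finset.sum_eq_single j]
  · rw [RamWitt.map, Algebra.TensorProduct.map_tmul, AlgHom.id_apply,
      TensorProduct.equivFinsuppOfBasisLeft_apply_tmul_apply, Module.Basis.repr_self,
      Finsupp.single_eq_same, one_smul]
    rfl
  · intro l _ hl
    rw [RamWitt.map, Algebra.TensorProduct.map_tmul, AlgHom.id_apply,
      TensorProduct.equivFinsuppOfBasisLeft_apply_tmul_apply, Module.Basis.repr_self,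
      Finsupp.single_eq_of_ne hl.symm, zero_smul]
  · exact fun h => absurd (Finset.mem_univ j) h

variable {Ω} in
/-- The ring `ArcRing` represents the functor `R ↦ Ω(W_O(R))` on perfect `κ`-algebras. -/
theorem arcHom_bijective (R : Type*) [CommRing R] [Algebra κ R] [CharP R p] [PerfectRing R p] :
    Function.Bijective
      (arcHom p κ O : (ArcRing p κ O Ω →ₐ[κ] R) → (CoordRing O Ω →ₐ[O] RamWitt p κ O R)) := by
  constructor
  · intro φ ψ h
    have key : (φ : ArcRing p κ O Ω →+* R).comp (ArcRing.of p κ O Ω) =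
        (ψ : ArcRing p κ O Ω →+* R).comp (ArcRing.of p κ O Ω) := by
      refine MvPolynomial.ringHom_ext (fun r => ?_) (fun t => ?_)
      · exact (φ.commutes r).trans (ψ.commutes r).symm
      · change φ (ArcRing.of p κ O Ω _) = ψ (ArcRing.of p κ O Ω _)
        rw [← arcCoord_arcHom, ← arcCoord_arcHom, h]
    have := (PerfectClosure.lift (MvPolynomial (ArcIndex p κ O Ω) κ) p R).symm.injective key
    exact AlgHom.ext fun a => congrArg (fun f : ArcRing p κ O Ω →+* R => f a) this
  · intro a
    let c : ArcIndex p κ O Ω → R := arcCoord p κ O a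
    let g : ArcRing p κ O Ω →+* R :=
      PerfectClosure.lift (MvPolynomial (ArcIndex p κ O Ω) κ) p R
        (MvPolynomial.eval₂Hom (algebraMap κ R) c)
    have hg : ∀ q, g (ArcRing.of p κ O Ω q) = MvPolynomial.eval₂Hom (algebraMap κ R) c q :=
      fun q => congrArg (fun f : MvPolynomial (ArcIndex p κ O Ω) κ →+* R => f q)
        ((PerfectClosure.lift (MvPolynomial (ArcIndex p κ O Ω) κ) p R).symm_apply_apply
          (MvPolynomial.eval₂Hom (algebraMap κ R) c))
    let φ : ArcRing p κ O Ω →ₐ[κ] R :=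
      { g with
        commutes' := fun r => (hg (MvPolynomial.C r)).trans (MvPolynomial.eval₂Hom_C _ _ _) }
    have hφ : ∀ t, φ (ArcRing.of p κ O Ω (MvPolynomial.X t)) = c t := fun t =>
      (hg _).trans (MvPolynomial.eval₂Hom_X' _ _ _)
    refine ⟨φ, SymmetricAlgebra.algHom_ext ((Module.finBasis O Ω).dualBasis.ext fun i => ?_)⟩
    refine (TensorProduct.equivFinsuppOfBasisLeft (N := WittAlg p κ R)
          (Module.finBasis (WittVector p κ) O)).injective (Finsupp.ext fun j => ?_)
    exact WittVector.ext fun k => (arcCoord_arcHom p κ O φ (i, j, k)).trans (hφ _)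

variable {Ω} in
/-- The `R`-point of `L⁺(Ω)` corresponding to a `W_O(R)`-point of `Ω`. -/
def arcLift {R : Type*} [CommRing R] [Algebra κ R] [CharP R p] [PerfectRing R p]
    (a : CoordRing O Ω →ₐ[O] RamWitt p κ O R) : ArcRing p κ O Ω →ₐ[κ] R :=
  (Equiv.ofBijective _ (arcHom_bijective p κ O R)).symm a

/-- The arc space `L⁺(Ω)`, a perfect affine scheme over `κ`. -/
def ArcSpace : Scheme.{u} :=
  Spec (CommRingCat.of (ArcRing p κ O Ω))

/-- The structure morphism `L⁺(Ω) → Spec κ`. -/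
def arcStructure : ArcSpace p κ O Ω ⟶ Spec (CommRingCat.of κ) :=
  Spec.map (CommRingCat.ofHom (algebraMap κ (ArcRing p κ O Ω)))

variable {Ω} {Ξ : Type*} [AddCommGroup Ξ] [Module O Ξ] [Module.Free O Ξ] [Module.Finite O Ξ]

/-- The morphism `L⁺(f) : L⁺(Ω) → L⁺(Ξ)` induced by a morphism of affine spaces `f : Ω → Ξ` over
`O`, where `f` is given by the corresponding homomorphism of coordinate rings. On `R`-points it is
composition of `W_O(R)`-points of `Ω` with `f`. -/
def arcMap (f : CoordRing O Ξ →ₐ[O] CoordRing O Ω) : ArcSpace p κ O Ω ⟶ ArcSpace p κ O Ξ :=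
  Spec.map (CommRingCat.ofHom (arcLift p κ O ((univArc p κ O Ω).comp f)).toRingHom)

/-- The `κ`-point of `L⁺(Ω)` attached to an element of `Ω`, that is, to an `O`-point of the affine
space of `Ω` (recall that `W_O(κ) = O`). -/
def arcPoint [IsAlgClosed κ] (x : Ω) : Spec (CommRingCat.of κ) ⟶ ArcSpace p κ O Ω :=
  Spec.map (CommRingCat.ofHom
    (arcLift p κ O ((Algebra.ofId O (RamWitt p κ O κ)).comp (evalAt x))).toRingHom)

end ArcSpace

/-! ## The Jacobian -/

section Jacobian

variable {O : Type v} [CommRing O] {Ω Ξ : Type*} [AddCommGroup Ω] [Module O Ω]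
  [AddCommGroup Ξ] [Module O Ξ] {n : ℕ}

/-- The components of a morphism `f : Ω → Ξ` of affine spaces over `O`, as polynomials, in the
coordinates given by bases of `Ω` and `Ξ`. -/
def component (bΩ : Module.Basis (Fin n) O Ω) (bΞ : Module.Basis (Fin n) O Ξ)
    (f : CoordRing O Ξ →ₐ[O] CoordRing O Ω) (i : Fin n) : MvPolynomial (Fin n) O :=
  SymmetricAlgebra.equivMvPolynomial bΩ.dualBasis
    (f (SymmetricAlgebra.ι O (Module.Dual O Ξ) (bΞ.coord i)))

/-- The Jacobian matrix of `f` at the point `x ∈ Ω = Ω(O)`. -/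
def jacobian (bΩ : Module.Basis (Fin n) O Ω) (bΞ : Module.Basis (Fin n) O Ξ)
    (f : CoordRing O Ξ →ₐ[O] CoordRing O Ω) (x : Ω) : Matrix (Fin n) (Fin n) O :=
  Matrix.of fun i j =>
    MvPolynomial.eval (bΩ.repr x) (MvPolynomial.pderiv j (component bΩ bΞ f i))

end Jacobian

/-! ## Perfect schemes -/

section PerfectSchemes

/-- A scheme is perfect (in characteristic `p`) if its absolute Frobenius is an isomorphism. -/
structure IsPerfectScheme (p : ℕ) (X : Scheme.{u}) : Prop where
  char_p : (p : Γ(X, ⊤)) = 0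
  bijective : ∀ U : X.Opens, Function.Bijective fun s : Γ(X, U) => s ^ p

/-- `π : X ⟶ X₀` exhibits `X` as the perfection of `X₀`, the limit of `X₀` along its Frobenius: `X`
is perfect, `π` is affine, and over each affine open of `X₀` the sections of `X` are the perfect
closure of those of `X₀`. -/
structure IsPerfection (p : ℕ) {X X₀ : Scheme.{u}} (π : X ⟶ X₀) : Prop where
  perfect : IsPerfectScheme p X
  affine : IsAffineHom π
  perfectClosure : ∀ U : X₀.Opens, IsAffineOpen U → IsPRadical (π.app U).hom p

/-- A morphism is perfectly finitely presented if it is the perfection of a finitely presented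
morphism. -/
def IsPfp (p : ℕ) {X Y : Scheme.{u}} (f : X ⟶ Y) : Prop :=
  ∃ (X₀ : Scheme.{u}) (π : X ⟶ X₀) (f₀ : X₀ ⟶ Y), IsPerfection p π ∧
    LocallyOfFinitePresentation f₀ ∧ QuasiCompact f₀ ∧ QuasiSeparated f₀ ∧ π ≫ f₀ = f

/-- A pfp-locally closed embedding. -/
structure IsPfpLocallyClosed (p : ℕ) {X Y : Scheme.{u}} (f : X ⟶ Y) : Prop where
  pfp : IsPfp p f
  immersion : IsImmersion f

/-- A morphism `f : X ⟶ Y` is perfectly smooth if, étale locally on `X`, it factors as an étale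
morphism to a perfected affine space `(𝔸ⁿ_Y)_perf` followed by the projection. -/
def IsPerfectlySmooth (p : ℕ) {X Y : Scheme.{u}} (f : X ⟶ Y) : Prop :=
  ∀ x : X, ∃ (U : Scheme.{u}) (j : U ⟶ X) (n : ℕ) (T : Scheme.{u})
    (π : T ⟶ 𝔸(ULift.{u} (Fin n); Y)) (g : U ⟶ T),
    Etale j ∧ x ∈ Set.range j ∧ IsPerfection p π ∧ Etale g ∧
      g ≫ π ≫ (𝔸(ULift.{u} (Fin n); Y) ↘ Y) = j ≫ f

/-- A morphism `f : X ⟶ Y` is strongly pro perfectly smooth if `X` is a cofiltered limit over `Y` of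
perfectly finitely presented, perfectly smooth `Y`-schemes with perfectly finitely presented,
perfectly smooth, affine transition maps. -/
def IsStronglyProPerfectlySmooth (p : ℕ) {X Y : Scheme.{u}} (f : X ⟶ Y) : Prop :=
  ∃ (J : Type u) (_ : SmallCategory J) (_ : IsCofiltered J) (D : J ⥤ Over Y) (c : Cone D)
    (_ : IsLimit c), Nonempty (c.pt ≅ Over.mk f) ∧
    (∀ j, IsPfp p (D.obj j).hom ∧ IsPerfectlySmooth p (D.obj j).hom) ∧
    ∀ (i j : J) (a : i ⟶ j),
      IsPfp p (D.map a).left ∧ IsPerfectlySmooth p (D.map a).left ∧ IsAffineHom (D.map a).left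

end PerfectSchemes

/-! ## Relative dimension and codimension -/

section Dimension

/-- The dimension of `X` at the point `x`. -/
def dimAt (X : Scheme.{u}) (x : X) : WithBot ℕ∞ :=
  ⨅ U : {U : X.Opens // x ∈ U}, topologicalKrullDim U.1

/-- The dimension function `x ↦ dim_x X - dim_{f x} Y` is constant equal to `d`. -/
def HasConstantDim {X Y : Scheme.{u}} (f : X ⟶ Y) (d : ℤ) : Prop :=
  ∀ x : X, ∃ a b : ℕ, dimAt X x = a ∧ dimAt Y (f x) = b ∧ (a : ℤ) - b = d

/-- Let `f : X ⟶ Y` be a morphism of perfect affine schemes over `κ` (with `s : Y ⟶ Spec κ`).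
It is weakly equidimensional of relative dimension `d` if it is the base change, along a strongly
pro perfectly smooth morphism `Y ⟶ Y₀`, of a morphism `f₀ : X₀ ⟶ Y₀` between perfect schemes
perfectly finitely presented over `κ`, whose dimension function is constant equal to `d`. -/
def HasRelDimAffine (p : ℕ) {κ : Type u} [Field κ] {X Y : Scheme.{u}}
    (s : Y ⟶ Spec (CommRingCat.of κ)) (f : X ⟶ Y) (d : ℤ) : Prop :=
  ∃ (X₀ Y₀ : Scheme.{u}) (f₀ : X₀ ⟶ Y₀) (s₀ : Y₀ ⟶ Spec (CommRingCat.of κ))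
    (q : X ⟶ X₀) (r : Y ⟶ Y₀),
    IsPullback q f f₀ r ∧ r ≫ s₀ = s ∧ IsStronglyProPerfectlySmooth p r ∧
      IsPfp p s₀ ∧ IsPfp p (f₀ ≫ s₀) ∧ HasConstantDim f₀ d

/-- A family of morphisms to `Y` is a covering (an effective epimorphism of étale sheaves) if it
admits sections étale locally on `Y`. -/
def IsEtaleLocallySplit {A : Type*} {V : A → Scheme.{u}} {Y : Scheme.{u}} (v : ∀ a, V a ⟶ Y) :
    Prop :=
  ∀ y : Y, ∃ (U : Scheme.{u}) (j : U ⟶ Y) (a : A) (t : U ⟶ V a),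
    Etale j ∧ y ∈ Set.range j ∧ t ≫ v a = j

/-- A morphism `f : X ⟶ Y` of perfect schemes over `κ` (with `s : Y ⟶ Spec κ`) is weakly
equidimensional of relative dimension `d` if there are a covering of `Y` by affine schemes `V a`
strongly pro perfectly smooth over `Y`, and étale coverings of `X ×_Y V a` by affine schemes
`Z b`, such that all the composites `Z b ⟶ X ×_Y V a ⟶ V a` are weakly equidimensional of
relative dimension `d`. -/
def HasRelDim (p : ℕ) {κ : Type u} [Field κ] {X Y : Scheme.{u}}
    (s : Y ⟶ Spec (CommRingCat.of κ)) (f : X ⟶ Y) (d : ℤ) : Prop :=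
  ∃ (A : Type u) (V : A → Scheme.{u}) (v : ∀ a, V a ⟶ Y),
    (∀ a, IsAffine (V a) ∧ IsStronglyProPerfectlySmooth p (v a)) ∧ IsEtaleLocallySplit v ∧
    ∀ a, ∃ (B : Type u) (Z : B → Scheme.{u}) (z : ∀ b, Z b ⟶ pullback f (v a)),
      (∀ b, IsAffine (Z b) ∧ Etale (z b)) ∧ (∀ x, ∃ b, x ∈ Set.range (z b)) ∧
      ∀ b, HasRelDimAffine p (v a ≫ s) (z b ≫ pullback.snd f (v a)) d

/-- A pfp-locally closed embedding of pure codimension `c`. -/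
structure IsPfpLocallyClosedOfCodim (p : ℕ) {κ : Type u} [Field κ] {X Y : Scheme.{u}}
    (s : Y ⟶ Spec (CommRingCat.of κ)) (f : X ⟶ Y) (c : ℤ) : Prop
    extends IsPfpLocallyClosed p f where
  relDim : HasRelDim p s f (-c)

end Dimension

end

/-! Both codimensions are heights of prime ideals. Arc spaces are of infinite type, so dimensions
are replaced by lengths of chains of generizations (`HasGenChain`). Such chains lift along flat
morphisms, and at the generic points of its fibres a strongly pro perfectly smooth morphism does not
change them. The definition of relative dimension leads to schemes pfp over `κ`, where the local
dimension is height plus transcendence degree. It follows that the codimension of `X` is the height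
of the prime of `ArcRing` at a generic point of `X` (`IsPfpLocallyClosedOfCodim.height_eq`).

Fix a generic point of `X`, let `ξ` be its arc and let `η` be the image of `ξ` under `f`. Since
étale maps are generalizing, `η` is the arc of a generic point of `Y`. The image of `X` is
constructible, so it is described by finitely many Witt components, and the prime of `ξ` is extended
from a polynomial ring in finitely many variables, up to perfection. The dimension formula in that
ring says that the codimension of `X` plus the transcendence degree of the first `M` components of
`ξ` is `n r M` for all large `M`, where `r` is the rank of `O` over `W(κ)`
(`exists_height_add_algRk_arcRing`). The same holds for `Y` and `η`. It remains to show that the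
components of `η` have transcendence degree smaller by exactly `e`
(`HasWittJacobian.algRk_wittDigits`).

In coordinates over the Witt vectors, `f(z + p^m h)` is `f(z) + p^m J(z) h` modulo `p^(2m)`. At
rational points `det J` is the norm of the Jacobian determinant over `O`, and it has `p`-adic
valuation `e` because the norm of `ϖ` is `p` times a unit. This valuation passes to the generic
point, since non-empty constructible subsets of arc spaces have rational points. As `g` is étale,
the first `e + 1` components of `ξ` are algebraic over finitely many components of `η`. Successive
approximation improves this: the first `M - e` components of `ξ` are algebraic over the first `M`
components of `η`. Over those `M - e` components, the remaining `e` layers of `ξ` are algebraically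
independent, and `f` acts on them through the linear map `J(z)`. Its elementary divisors `p^(α i)`
satisfy `∑ α i = e`, so exactly `e` components are lost (`algRk_union_wittDigits_mulVec`). -/

noncomputable section

/-! ## Flatness of filtered colimits -/

/-- A module that is, in the sense of elements and relations, a filtered colimit of flat modules
is flat. -/
theorem Module.Flat.of_approximation {R M : Type*} [CommRing R] [AddCommGroup M] [Module R M]
    {J : Type*} (N : J → Type*) [∀ j, AddCommGroup (N j)] [∀ j, Module R (N j)]
    [∀ j, Module.Flat R (N j)] (ρ : ∀ j, N j →ₗ[R] M)
    (hsurj : ∀ (l : ℕ) (x : Fin l → M), ∃ (j : J) (y : Fin l → N j), ∀ i, ρ j (y i) = x i)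
    (hinj : ∀ (j : J) (y : N j), ρ j y = 0 →
      ∃ (k : J) (τ : N j →ₗ[R] N k), ρ k ∘ₗ τ = ρ j ∧ τ y = 0) :
    Module.Flat R M := by
  -- Equational criterion: the elements lift to one stage, the relation holds after a further
  -- transition, and its trivialization there is pushed forward to `M`.
  refine Module.Flat.of_forall_isTrivialRelation fun {l f x} h => ?_
  obtain ⟨j, y, hy⟩ := hsurj l x
  obtain ⟨k, τ, hτ, h0⟩ := hinj j (∑ i, f i • y i) (by
    rw [map_sum]; simpa only [map_smul, hy] using h)
  have h1 : ∑ i, f i • τ (y i) = 0 := by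
    rw [map_sum] at h0; simpa only [map_smul] using h0
  obtain ⟨m, a, z, hz, ha⟩ := Module.Flat.isTrivialRelation_of_sum_smul_eq_zero h1
  refine ⟨m, a, fun i => ρ k (z i), fun i => ?_, ha⟩
  have := congrArg (ρ k) (hz i)
  rw [map_sum] at this
  simp only [map_smul] at this
  rw [← this, ← hy i, ← hτ]; rfl

/-- A ring homomorphism that is, in the sense of elements and relations, a filtered colimit of flat
ring homomorphisms is flat. -/
theorem RingHom.Flat.of_approximation {R B : Type*} [CommRing R] [CommRing B] (f : R →+* B)
    {J : Type*} (A : J → Type*) [∀ j, CommRing (A j)] (φ : ∀ j, R →+* A j)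
    (hφ : ∀ j, (φ j).Flat) (ρ : ∀ j, A j →+* B) (hρ : ∀ j, (ρ j).comp (φ j) = f)
    (hsurj : ∀ (l : ℕ) (x : Fin l → B), ∃ (j : J) (y : Fin l → A j), ∀ i, ρ j (y i) = x i)
    (hinj : ∀ (j : J) (y : A j), ρ j y = 0 →
      ∃ (k : J) (τ : A j →+* A k), (ρ k).comp τ = ρ j ∧ τ.comp (φ j) = φ k ∧ τ y = 0) :
    f.Flat := by
  let _ := f.toAlgebra
  let _ (j : J) : Algebra R (A j) := (φ j).toAlgebra
  have hflat (j : J) : Module.Flat R (A j) := hφ j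
  let ρ' (j : J) : A j →ₐ[R] B := { ρ j with commutes' := RingHom.congr_fun (hρ j) }
  refine Module.Flat.of_approximation A (fun j => (ρ' j).toLinearMap) hsurj fun j y hy => ?_
  obtain ⟨k, τ, hτ, hτ', h0⟩ := hinj j y hy
  let τ' : A j →ₐ[R] A k := { τ with commutes' := RingHom.congr_fun hτ' }
  exact ⟨k, τ'.toLinearMap, LinearMap.ext (RingHom.congr_fun hτ), h0⟩

instance flat_isZariskiLocalAtSource :
    IsZariskiLocalAtSource (@Flat : MorphismProperty Scheme.{u}) :=
  HasRingHomProperty.instIsZariskiLocalAtSource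

section Limits

variable {J : Type u} [SmallCategory J] [IsCofiltered J] (D : J ⥤ Scheme.{u}) (c : Cone D)

/-- Global sections of the limit are the filtered colimit of the global sections, so
`RingHom.Flat.of_approximation` applies. -/
theorem flat_of_isLimit_of_isAffine (hc : IsLimit c) [∀ i, IsAffine (D.obj i)] {S : Scheme.{u}} [IsAffine S]
    (g : ∀ i, D.obj i ⟶ S) (hg : ∀ {i j} (a : i ⟶ j), D.map a ≫ g j = g i)
    [∀ i, Flat (g i)] (f : c.pt ⟶ S) (hf : ∀ i, c.π.app i ≫ g i = f) : Flat f := by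
  have : IsAffine c.pt := Scheme.isAffine_of_isLimit _ hc
  rw [HasRingHomProperty.iff_of_isAffine (P := @Flat)]
  refine RingHom.Flat.of_approximation _ (fun i : J => Γ(D.obj i, ⊤)) (fun i => (g i).appTop.hom)
    (fun i => (HasRingHomProperty.iff_of_isAffine (P := @Flat)).1 inferInstance)
    (fun i => (c.π.app i).appTop.hom) (fun i => ?_) (fun l x => ?_) fun j y hy => ?_
  · rw [← CommRingCat.hom_comp, ← Scheme.Hom.comp_appTop, hf]
  · classical
    choose i t ht using fun k => exists_appTop_π_eq_of_isAffine_of_isLimit D c hc (x k)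
    obtain ⟨j, hj⟩ := IsCofiltered.inf_objs_exists (Finset.univ.image i)
    have hj' (k : Fin l) : Nonempty (j ⟶ i k) :=
      hj (Finset.mem_image_of_mem _ (Finset.mem_univ _))
    refine ⟨j, fun k => (D.map (hj' k).some).appTop (t k), fun k => ?_⟩
    change (c.π.app j).appTop ((D.map (hj' k).some).appTop (t k)) = x k
    rw [← ConcreteCategory.comp_apply, ← Scheme.Hom.comp_appTop, c.w, ht]
  · obtain ⟨k, a, ha⟩ := exists_appTop_map_eq_zero_of_isAffine_of_isLimit D c hc j y hy
    refine ⟨k, (D.map a).appTop.hom, ?_, ?_, ha⟩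
    · rw [← CommRingCat.hom_comp, ← Scheme.Hom.comp_appTop, c.w]
    · rw [← CommRingCat.hom_comp, ← Scheme.Hom.comp_appTop, hg]

/-- Flatness is local on the source. The limit is covered by preimages of affine opens `U` of `D.obj
i`, and such a preimage is the limit over `Over i` of the affine preimages of `U`. -/
theorem flat_of_isLimit (hc : IsLimit c) [∀ {i j} (a : i ⟶ j), IsAffineHom (D.map a)] {S : Scheme.{u}} (i : J)
    (g : D.obj i ⟶ S) (hg : ∀ (k : J) (a : k ⟶ i), Flat (D.map a ≫ g)) :
    Flat (c.π.app i ≫ g) := by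
  have : ∀ x : c.pt, ∃ (W : S.Opens) (V : c.pt.Opens) (_ : x ∈ V.1)
      (e : V ≤ (c.π.app i ≫ g) ⁻¹ᵁ W), Flat ((c.π.app i ≫ g).resLE W V e) := fun x => by
    obtain ⟨_, ⟨W, hW : IsAffineOpen W, rfl⟩, hxW, -⟩ :=
      S.isBasis_affineOpens.exists_subset_of_mem_open
        (Set.mem_univ ((c.π.app i ≫ g) x)) isOpen_univ
    obtain ⟨_, ⟨U, hU : IsAffineOpen U, rfl⟩, hxU, hUW⟩ :=
      (D.obj i).isBasis_affineOpens.exists_subset_of_mem_open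
        (show c.π.app i x ∈ (g ⁻¹ᵁ W : Set _) from hxW) (g ⁻¹ᵁ W).isOpen
    have e : c.π.app i ⁻¹ᵁ U ≤ (c.π.app i ≫ g) ⁻¹ᵁ W := fun y hy => hUW hy
    refine ⟨W, c.π.app i ⁻¹ᵁ U, hxU, e, ?_⟩
    have (j : Over i) : IsAffine ((opensDiagram D i U).obj j) := hU.preimage _
    have : IsAffine W := hW
    have e' (k : Over i) : D.map k.hom ⁻¹ᵁ U ≤ (D.map k.hom ≫ g) ⁻¹ᵁ W := fun y hy => hUW hy
    let G (k : Over i) : (opensDiagram D i U).obj k ⟶ W :=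
      (D.map k.hom ≫ g).resLE W (D.map k.hom ⁻¹ᵁ U) (e' k)
    have (k : Over i) : Flat (G k) :=
      have := hg k.left k.hom
      inferInstanceAs (Flat ((D.map k.hom ≫ g).resLE W (D.map k.hom ⁻¹ᵁ U) (e' k)))
    refine flat_of_isLimit_of_isAffine _ _ (isLimitOpensCone D c hc i U) (S := W) G
      (fun {j k} a => ?_) _ fun k => ?_
    · refine (Scheme.Hom.resLE_comp_resLE ..).trans ?_
      simp only [← Category.assoc, ← D.map_comp, Over.w a]
      rfl
    · refine (Scheme.Hom.resLE_comp_resLE ..).trans ?_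
      simp only [← Category.assoc, c.w]
  choose W V hxV e h using this
  refine (IsZariskiLocalAtSource.iff_of_iSup_eq_top (P := @Flat.{u}) V
    (top_unique fun x _ => TopologicalSpace.Opens.mem_iSup.2 ⟨x, hxV x⟩)).2 fun x => ?_
  have := h x
  rw [← Scheme.Hom.resLE_comp_ι _ (e x)]
  infer_instance

/-- The points of a cofiltered limit of schemes with affine transition maps are separated by the
projections. -/
theorem eq_of_isLimit_of_forall_π_eq (hc : IsLimit c) [∀ {i j} (a : i ⟶ j), IsAffineHom (D.map a)] {x y : c.pt}
    (h : ∀ i, c.π.app i x = c.π.app i y) : x = y := by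
  have hb {U : c.pt.Opens} {z : c.pt} (hz : z ∈ U) :=
    TopologicalSpace.Opens.isBasis_iff_nbhd.1 (isBasis_preimage_isAffineOpen D c hc) hz
  refine Inseparable.eq (inseparable_iff_forall_isOpen.2 fun s hs => ⟨fun hx => ?_, fun hy => ?_⟩)
  · obtain ⟨_, ⟨i, V, -, rfl⟩, hxV, hVs⟩ := hb (U := ⟨s, hs⟩) hx
    exact hVs (show c.π.app i y ∈ V from h i ▸ hxV)
  · obtain ⟨_, ⟨i, V, -, rfl⟩, hyV, hVs⟩ := hb (U := ⟨s, hs⟩) hy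
    exact hVs (show c.π.app i x ∈ V from (h i).symm ▸ hyV)

end Limits

/-! ## Chains of generizations -/

section Generizations

/-- There is a chain of `n` proper generizations starting at `x`. -/
def HasGenChain {X : Type*} [TopologicalSpace X] : ℕ → X → Prop
  | 0, _ => True
  | n + 1, x => ∃ y, y ⤳ x ∧ y ≠ x ∧ HasGenChain n y

/-- A point without proper generizations. -/
def IsGenericPt {X : Type*} [TopologicalSpace X] (x : X) : Prop :=
  ∀ y, y ⤳ x → y = x

/-- A point without proper generizations in its fibre. -/
def IsGenericInFiber {X Y : Type*} [TopologicalSpace X] (f : X → Y) (x : X) : Prop :=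
  ∀ y, y ⤳ x → f y = f x → y = x

/-- A map without proper specializations in its fibres. -/
def HasDiscreteFibers {X Y : Type*} [TopologicalSpace X] (f : X → Y) : Prop :=
  ∀ x y, y ⤳ x → f y = f x → y = x

variable {X Y Z : Type*} [TopologicalSpace X]

theorem HasGenChain.of_map [TopologicalSpace Y] {f : X → Y} (hf : GeneralizingMap f) {n : ℕ} {x : X}
    (h : HasGenChain n (f x)) : HasGenChain n x := by
  induction n generalizing x with
  | zero => trivial
  | succ n ih =>
    obtain ⟨y, hy, hne, h⟩ := h
    obtain ⟨z, hz, rfl⟩ := hf hy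
    exact ⟨z, hz, fun e => hne (e ▸ rfl), ih h⟩

theorem HasGenChain.map [TopologicalSpace Y] {f : X → Y} (hf : Continuous f) (hd : HasDiscreteFibers f) {n : ℕ} {x : X}
    (h : HasGenChain n x) : HasGenChain n (f x) := by
  induction n generalizing x with
  | zero => trivial
  | succ n ih =>
    obtain ⟨y, hy, hne, h⟩ := h
    exact ⟨f y, hy.map hf, fun e => hne (hd _ _ hy e), ih h⟩

theorem IsGenericPt.map [TopologicalSpace Y] {f : X → Y} (hf : GeneralizingMap f) {x : X} (h : IsGenericPt x) :
    IsGenericPt (f x) := fun y hy => by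
  obtain ⟨z, hz, rfl⟩ := hf hy
  rw [h z hz]

theorem IsGenericPt.not_hasGenChain {x : X} (h : IsGenericPt x) (n : ℕ) :
    ¬ HasGenChain (n + 1) x := fun ⟨y, hy, hne, _⟩ => hne (h y hy)

theorem IsGenericInFiber.map [TopologicalSpace Y] {f : X → Y} {g : Y → Z} (hf : GeneralizingMap f) {x : X}
    (h : IsGenericInFiber (g ∘ f) x) : IsGenericInFiber g (f x) := fun y hy e => by
  obtain ⟨z, hz, rfl⟩ := hf hy
  rw [h z hz e]

theorem IsGenericInFiber.of_map [TopologicalSpace Y] {f : X → Y} {g : Y → Z} (hf : Continuous f)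
    (hd : HasDiscreteFibers f) {x : X} (h : IsGenericInFiber g (f x)) :
    IsGenericInFiber (g ∘ f) x := fun _ hy e =>
  hd _ _ hy (h _ (hy.map hf) e)

theorem HasDiscreteFibers.of_injective {f : X → Y} (hf : Function.Injective f) :
    HasDiscreteFibers f := fun _ _ _ e => hf e

end Generizations

/-- A chain has finitely many points, and distinct points of the limit are already distinct at some
stage. The stages can be refined because chains lift along the generalizing transition maps. -/
theorem exists_hasGenChain_of_isLimit {J : Type u} [SmallCategory J] [IsCofiltered J]
    (D : J ⥤ Scheme.{u}) (c : Cone D) (hc : IsLimit c)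
    [∀ {i j} (a : i ⟶ j), IsAffineHom (D.map a)]
    (hg : ∀ {i j} (a : i ⟶ j), GeneralizingMap (D.map a)) {n : ℕ} {x : c.pt}
    (h : HasGenChain n x) : ∃ i, HasGenChain n (c.π.app i x) := by
  induction n generalizing x with
  | zero => exact ⟨IsCofiltered.nonempty.some, trivial⟩
  | succ n ih =>
    obtain ⟨y, hy, hne, h⟩ := h
    obtain ⟨i, hi⟩ := ih h
    have : ∃ j, c.π.app j y ≠ c.π.app j x := by
      by_contra! h'
      exact hne (eq_of_isLimit_of_forall_π_eq D c hc h')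
    obtain ⟨j, hj⟩ := this
    obtain ⟨k, a, b, -⟩ := IsCofilteredOrEmpty.cone_objs i j
    refine ⟨k, c.π.app k y, hy.map (c.π.app k).continuous, fun e => hj ?_, ?_⟩
    · rw [← c.w b]
      simp only [Scheme.Hom.comp_apply]
      exact congrArg _ e
    · refine HasGenChain.of_map (hg a) ?_
      rw [← c.w a] at hi
      exact hi

theorem hasDiscreteFibers_of_locallyQuasiFinite {X Y : Scheme.{u}} (f : X ⟶ Y)
    [LocallyQuasiFinite f] : HasDiscreteFibers f := fun x _ h e =>
  (f.isDiscrete_preimage_singleton (f x)).eq_of_specializes h e rfl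

instance locallyQuasiFinite_of_etale {X Y : Scheme.{u}} (f : X ⟶ Y) [Etale f] :
    LocallyQuasiFinite f where
  quasiFinite_appLE hU _ hV e := by
    have h1 := f.formallyUnramified_appLE hU hV e
    have h2 := f.finiteType_appLE hU hV e
    algebraize [(f.appLE _ _ e).hom]
    change Algebra.QuasiFinite _ _
    have : Algebra.FormallyUnramified _ _ := h1
    infer_instance

/-- Flatness descends along a faithfully flat algebra over the target. -/
theorem Module.Flat.of_faithfullyFlat_trans (R S T : Type*) [CommRing R] [CommRing S] [CommRing T]
    [Algebra R S] [Algebra S T] [Algebra R T] [IsScalarTower R S T] [Module.Flat R T]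
    [Module.FaithfullyFlat S T] : Module.Flat R S := by
  rw [Module.Flat.iff_lTensor_preserves_injective_linearMap]
  intro M N _ _ _ _ f hf
  let F : S ⊗[R] M →ₗ[S] S ⊗[R] N := f.baseChange S
  suffices h : Function.Injective F from h
  rw [← Module.FaithfullyFlat.lTensor_injective_iff_injective S T]
  have h1 : Function.Injective (f.lTensor T) := Module.Flat.lTensor_preserves_injective_linearMap f hf
  let e1 := AlgebraTensorModule.cancelBaseChange R S S T M
  let e2 := AlgebraTensorModule.cancelBaseChange R S S T N
  have h2 : ∀ z, e2 (F.lTensor T z) = f.lTensor T (e1 z) := fun z => by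
    induction z with
    | zero => simp
    | add x y hx hy => simp only [map_add, hx, hy]
    | tmul t z =>
      induction z with
      | zero => simp
      | add x y hx hy => simp only [TensorProduct.tmul_add, map_add, hx, hy]
      | tmul s m => simp [e1, e2, F]
  intro x y hxy
  exact e1.injective (h1 (by rw [← h2, ← h2, hxy]))

/-- Flat local homomorphisms of stalks are faithfully flat, so the stalk map of `j` can be
cancelled. -/
theorem flat_of_etale_locally {X Y : Scheme.{u}} (f : X ⟶ Y)
    (h : ∀ x : X, ∃ (U : Scheme.{u}) (j : U ⟶ X), Flat j ∧ x ∈ Set.range j ∧ Flat (j ≫ f)) :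
    Flat f := by
  refine Flat.of_stalkMap f fun x => ?_
  obtain ⟨U, j, hj, ⟨y, rfl⟩, hjf⟩ := h x
  have h1 := Flat.stalkMap (j ≫ f) y
  have h2 := Flat.stalkMap j y
  rw [Scheme.Hom.stalkMap_comp] at h1
  let _ := (f.stalkMap (j y)).hom.toAlgebra
  let _ := (j.stalkMap y).hom.toAlgebra
  let _ := (f.stalkMap (j y) ≫ j.stalkMap y).hom.toAlgebra
  have : IsScalarTower (Y.presheaf.stalk (f (j y))) (X.presheaf.stalk (j y))
    (U.presheaf.stalk y) := .of_algebraMap_eq fun _ => rfl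
  have : Module.Flat (Y.presheaf.stalk (f (j y))) (U.presheaf.stalk y) := h1
  have : Module.Flat (X.presheaf.stalk (j y)) (U.presheaf.stalk y) := h2
  have : IsLocalHom (algebraMap (X.presheaf.stalk (j y)) (U.presheaf.stalk y)) :=
    inferInstanceAs (IsLocalHom (j.stalkMap y).hom)
  have := Module.FaithfullyFlat.of_flat_of_isLocalHom (A := X.presheaf.stalk (j y))
    (B := U.presheaf.stalk y)
  exact Module.Flat.of_faithfullyFlat_trans _ _ (U.presheaf.stalk y)

/-- The perfection of a flat algebra over a perfect ring is flat. -/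
theorem RingHom.Flat.of_isPRadical {R A B : Type*} [CommRing R] [CommRing A] [CommRing B] (p : ℕ)
    [Fact p.Prime] [CharP R p] [CharP A p] [CharP B p] [PerfectRing R p] [PerfectRing B p]
    (f : R →+* A) (hf : f.Flat) (i : A →+* B) [IsPRadical i p] : (i.comp f).Flat := by
  let F (j : ℕ) : B ≃+* B := iterateFrobeniusEquiv B p j
  have hF (j : ℕ) (b : B) : (F j).symm (b ^ p ^ j) = b := (F j).symm_apply_apply b
  have hFR (j : ℕ) (r : R) : iterateFrobeniusEquiv R p j r = r ^ p ^ j := rfl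
  -- `B` is the colimit of copies of `A` along Frobenius. The `j`-th copy maps to `B` by the `p ^
  -- j`-th root of `i`; its `R`-structure is twisted by the `j`-th power of Frobenius, which
  -- preserves flatness because `R` is perfect.
  refine RingHom.Flat.of_approximation _ (fun _ : ℕ => A)
    (fun j => f.comp (iterateFrobeniusEquiv R p j).toRingHom)
    (fun j => RingHom.Flat.comp (.of_bijective (iterateFrobeniusEquiv R p j).bijective) hf)
    (fun j => (F j).symm.toRingHom.comp i) (fun j => RingHom.ext fun r => ?_) (fun l x => ?_)
    fun j y hy => ?_
  · change (F j).symm (i (f (r ^ p ^ j))) = _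
    rw [map_pow, map_pow, hF]; rfl
  · choose m y hy using fun k => IsPRadical.pow_mem i p (x k)
    refine ⟨∑ k, m k, fun k => y k ^ p ^ (∑ k, m k - m k), fun k => ?_⟩
    change (F _).symm (i (y k ^ _)) = _
    rw [map_pow, hy, ← pow_mul, ← pow_add, Nat.add_sub_of_le, hF]
    exact Finset.single_le_sum (fun _ _ => Nat.zero_le _) (Finset.mem_univ k)
  · have h0 : i y = 0 := (F j).symm.injective (hy.trans (map_zero _).symm)
    obtain ⟨m, hm⟩ := mem_pNilradical.1 (IsPRadical.ker_le i p h0)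
    refine ⟨j + m, iterateFrobenius A p m, RingHom.ext fun a => ?_, RingHom.ext fun r => ?_, hm⟩
    · change (F (j + m)).symm (i (a ^ p ^ m)) = (F j).symm (i a)
      rw [map_pow, RingEquiv.symm_apply_eq]
      change _ = ((F j).symm (i a)) ^ p ^ (j + m)
      rw [pow_add, pow_mul]
      congr 1
      exact ((F j).apply_symm_apply (i a)).symm
    · change (f (r ^ p ^ j)) ^ p ^ m = f (r ^ p ^ (j + m))
      rw [← map_pow, ← pow_mul, ← pow_add]

/-! ## Perfections of schemes -/

theorem IsPRadical.isHomeomorph_comap {A B : Type*} [CommRing A] [CommRing B] (p : ℕ)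
    [Fact p.Prime] (i : A →+* B) [IsPRadical i p] : IsHomeomorph (PrimeSpectrum.comap i) := by
  refine PrimeSpectrum.isHomeomorph_comap i (fun x => ?_) fun x hx => ?_
  · obtain ⟨n, y, h⟩ := IsPRadical.pow_mem i p x
    exact ⟨p ^ n, pow_pos (Fact.out : p.Prime).pos n, y, h⟩
  · obtain ⟨n, hn⟩ := mem_pNilradical.1 (IsPRadical.ker_le i p hx)
    exact ⟨_, hn⟩

theorem IsPRadical.of_bijective {A B : Type*} [CommRing A] [CommRing B] (p : ℕ)
    (i : A →+* B) (h : Function.Bijective i) : IsPRadical i p where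
  pow_mem' x := ⟨0, (h.2 x).choose, by rw [(h.2 x).choose_spec, pow_zero, pow_one]⟩
  ker_le' x hx := by
    rw [h.1 ((RingHom.mem_ker.1 hx).trans (map_zero i).symm)]
    exact zero_mem _

/-- `p`-radical ring homomorphisms induce homeomorphisms of spectra, and the assertion is local on
`X₀`. -/
theorem IsPerfection.isHomeomorph {p : ℕ} [Fact p.Prime] {X X₀ : Scheme.{u}} {π : X ⟶ X₀}
    (h : IsPerfection p π) : IsHomeomorph π := by
  have := h.affine
  have hc : TopologicalSpace.IsOpenCover (fun U : X₀.affineOpens => (U : X₀.Opens)) :=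
    iSup_affineOpens_eq_top X₀
  rw [hc.isHomeomorph_iff_restrictPreimage π.continuous]
  intro U
  have hU : IsAffineOpen U.1 := U.2
  have : IsAffine U.1 := hU
  have : IsAffine (π ⁻¹ᵁ U.1) := hU.preimage π
  have h1 : IsPRadical (π ∣_ U.1).appTop.hom p := by
    have h2 := h.perfectClosure (U.1.ι ''ᵁ ⊤) (by simpa using hU)
    rw [Scheme.Hom.appTop, morphismRestrict_app]
    have := IsPRadical.of_bijective p (X.presheaf.map (eqToHom
      (image_morphismRestrict_preimage π U.1 ⊤)).op).hom
      (ConcreteCategory.bijective_of_isIso _)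
    exact IsPRadical.trans (π.app (U.1.ι ''ᵁ ⊤)).hom (X.presheaf.map (eqToHom
      (image_morphismRestrict_preimage π U.1 ⊤)).op).hom p
  have h3 := IsPRadical.isHomeomorph_comap p (π ∣_ U.1).appTop.hom
  have h4 := Scheme.isoSpec_hom_naturality (π ∣_ U.1)
  have h5 : IsHomeomorph (π ∣_ U.1) := by
    have : (π ∣_ U.1) = (π ⁻¹ᵁ U.1).toScheme.isoSpec.hom ≫ Spec.map (π ∣_ U.1).appTop ≫
        U.1.toScheme.isoSpec.inv := by
      rw [← Category.assoc, h4, Category.assoc, Iso.hom_inv_id, Category.comp_id]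
    rw [this]
    have e1 : IsHomeomorph (π ⁻¹ᵁ U.1).toScheme.isoSpec.hom :=
      (Scheme.homeoOfIso (π ⁻¹ᵁ U.1).toScheme.isoSpec).isHomeomorph
    have e2 : IsHomeomorph U.1.toScheme.isoSpec.inv :=
      (Scheme.homeoOfIso U.1.toScheme.isoSpec.symm).isHomeomorph
    exact e2.comp (h3.comp e1)
  rwa [morphismRestrict_base] at h5

/-- Every point has an affine neighbourhood whose ring is perfect of characteristic `p`. -/
def HasPerfectCharts (p : ℕ) (Y : Scheme.{u}) : Prop :=
  ∀ y : Y, ∃ W : Y.Opens, IsAffineOpen W ∧ y ∈ W ∧ (p : Γ(Y, W)) = 0 ∧ PerfectRing Γ(Y, W) p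

theorem IsPerfectScheme.hasPerfectCharts {p : ℕ} {Y : Scheme.{u}} (h : IsPerfectScheme p Y) :
    HasPerfectCharts p Y := fun y => by
  obtain ⟨_, ⟨W, hW : IsAffineOpen W, rfl⟩, hy, -⟩ :=
    Y.isBasis_affineOpens.exists_subset_of_mem_open (Set.mem_univ y) isOpen_univ
  refine ⟨W, hW, hy, ?_, ⟨h.bijective W⟩⟩
  have := congrArg (Y.presheaf.map (homOfLE le_top : W ⟶ ⊤).op) h.char_p
  simpa using this

theorem hasPerfectCharts_Spec {p : ℕ} (R : Type u) [CommRing R] [CharP R p] [PerfectRing R p] :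
    HasPerfectCharts p (Spec (CommRingCat.of R)) := fun y => by
  let e := (Scheme.ΓSpecIso (CommRingCat.of R)).symm.commRingCatIsoToRingEquiv
  refine ⟨⊤, isAffineOpen_top _, trivial, ?_, ⟨?_⟩⟩
  · rw [← map_natCast e, CharP.cast_eq_zero, map_zero]
  · have : (fun x : Γ(Spec (CommRingCat.of R), ⊤) => x ^ p) =
        e ∘ (fun x : R => x ^ p) ∘ e.symm := funext fun x => by simp
    rw [this]
    exact e.bijective.comp ((PerfectRing.bijective_frobenius (R := R)).comp e.symm.bijective)

/-- This variant admits the zero ring, for which `CharP _ p` fails. -/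
theorem RingHom.Flat.of_isPRadical' {R A B : Type*} [CommRing R] [CommRing A] [CommRing B] (p : ℕ)
    [Fact p.Prime] (h0 : (p : R) = 0) [PerfectRing R p] [PerfectRing B p]
    (f : R →+* A) (hf : f.Flat) (i : A →+* B) [IsPRadical i p] : (i.comp f).Flat := by
  rcases subsingleton_or_nontrivial B with hB | hB
  · algebraize [i.comp f]
    exact inferInstanceAs (Module.Flat R B)
  · have := i.domain_nontrivial
    have := f.domain_nontrivial
    have hp : p.Prime := Fact.out
    have : CharP R p := (CharP.charP_iff_prime_eq_zero hp).2 h0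
    have h1 : (p : A) = 0 := by rw [← map_natCast f, h0, map_zero]
    have : CharP A p := (CharP.charP_iff_prime_eq_zero hp).2 h1
    have : CharP B p := (CharP.charP_iff_prime_eq_zero hp).2
      (by rw [← map_natCast i, h1, map_zero])
    exact RingHom.Flat.of_isPRadical p f hf i

theorem IsPerfection.flat_comp {p : ℕ} [Fact p.Prime] {T A Y : Scheme.{u}} {π : T ⟶ A}
    (h : IsPerfection p π) (hY : HasPerfectCharts p Y) (f : A ⟶ Y) [Flat f] : Flat (π ≫ f) := by
  have := h.affine
  rw [HasRingHomProperty.iff_exists_appLE (P := @Flat.{u})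
    (RingHom.Flat.stableUnderComposition.stableUnderCompositionWithLocalizationAway
      RingHom.Flat.holdsForLocalizationAway).left]
  intro x
  obtain ⟨W, hW, hxW, h0, hperf⟩ := hY ((π ≫ f) x)
  obtain ⟨_, ⟨V, hV : IsAffineOpen V, rfl⟩, hxV, hVW⟩ :=
    A.isBasis_affineOpens.exists_subset_of_mem_open
      (show π x ∈ (f ⁻¹ᵁ W : Set _) from hxW) (f ⁻¹ᵁ W).isOpen
  have hVW' : V ≤ f ⁻¹ᵁ W := hVW
  refine ⟨⟨W, hW⟩, ⟨π ⁻¹ᵁ V, hV.preimage π⟩, hxV, fun y hy => hVW hy, ?_⟩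
  have e : (π ≫ f).appLE W (π ⁻¹ᵁ V) (fun y hy => hVW hy) = f.appLE W V hVW' ≫ π.app V := by
    rw [Scheme.Hom.app_eq_appLE, Scheme.Hom.appLE_comp_appLE]
  change ((π ≫ f).appLE W (π ⁻¹ᵁ V) _).hom.Flat
  rw [e, CommRingCat.hom_comp]
  have : PerfectRing Γ(T, π ⁻¹ᵁ V) p := ⟨h.perfect.bijective _⟩
  have := h.perfectClosure V hV
  exact RingHom.Flat.of_isPRadical' p h0 _
    (HasRingHomProperty.appLE (P := @Flat.{u}) f inferInstance ⟨W, hW⟩ ⟨V, hV⟩ hVW') _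

instance flat_affineSpace (n : Type u) (Y : Scheme.{u}) : Flat (𝔸(n; Y) ↘ Y) := by
  change Flat (pullback.fst (terminal.from Y) (terminal.from (Spec _)))
  suffices h : Flat (terminal.from (Spec (CommRingCat.of (MvPolynomial n (ULift.{u} ℤ))))) from
    inferInstance
  -- Affine space over `Y` is pulled back from a polynomial ring over the integers, whose spectrum
  -- is terminal.
  have := isIso_of_isTerminal specULiftZIsTerminal.{u} terminalIsTerminal (terminal.from _)
  have h : Flat (Spec.map (CommRingCat.ofHom
      (MvPolynomial.C : ULift.{u} ℤ →+* MvPolynomial n (ULift.{u} ℤ)))) := by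
    rw [HasRingHomProperty.Spec_iff (P := @Flat.{u})]
    exact RingHom.flat_algebraMap_iff.2 (inferInstance : Module.Flat (ULift ℤ) (MvPolynomial n (ULift ℤ)))
  rw [← terminal.comp_from (Spec.map (CommRingCat.ofHom MvPolynomial.C))]
  infer_instance

theorem IsPerfectlySmooth.flat {p : ℕ} [Fact p.Prime] {X Y : Scheme.{u}} {f : X ⟶ Y}
    (h : IsPerfectlySmooth p f) (hY : HasPerfectCharts p Y) : Flat f := by
  refine flat_of_etale_locally f fun x => ?_
  obtain ⟨U, j, n, T, π, g, hj, hx, hπ, hg, e⟩ := h x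
  refine ⟨U, j, inferInstance, hx, ?_⟩
  have := hπ.flat_comp hY (𝔸(ULift.{u} (Fin n); Y) ↘ Y)
  rw [← e]
  infer_instance

/-- Chains of generizations descend from the generic points of the fibres of affine spaces
over `Y`. -/
def HasNiceAffineSpaces (Y : Scheme.{u}) : Prop :=
  ∀ (n : ℕ) (τ : 𝔸(ULift.{u} (Fin n); Y)), IsGenericInFiber (𝔸(ULift.{u} (Fin n); Y) ↘ Y) τ →
    ∀ k, HasGenChain k τ → HasGenChain k ((𝔸(ULift.{u} (Fin n); Y) ↘ Y) τ)

/-- A chain at `x` lifts to an étale neighbourhood and keeps its length in the affine space, because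
étale maps have discrete fibres and perfections are injective. Genericity in the fibre is carried
along the same way, so the property of affine spaces over `Y` applies. -/
theorem IsPerfectlySmooth.hasGenChain_map {p : ℕ} [Fact p.Prime] {X Y : Scheme.{u}} {f : X ⟶ Y}
    (h : IsPerfectlySmooth p f) (hY : HasNiceAffineSpaces Y) {x : X}
    (hx : IsGenericInFiber f x) {k : ℕ} (hk : HasGenChain k x) : HasGenChain k (f x) := by
  obtain ⟨U, j, n, T, π, g, hj, ⟨y, rfl⟩, hπ, hg, e⟩ := h x
  let s := 𝔸(ULift.{u} (Fin n); Y) ↘ Y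
  have e' (z : U) : f (j z) = s (π (g z)) := by
    rw [← Scheme.Hom.comp_apply, ← e]
    rfl
  have h1 : HasGenChain k y := hk.of_map (Flat.generalizingMap j)
  have h2 : HasGenChain k (g y) :=
    h1.map g.continuous (hasDiscreteFibers_of_locallyQuasiFinite g)
  have h3 : HasGenChain k (π (g y)) :=
    h2.map π.continuous (.of_injective hπ.isHomeomorph.injective)
  rw [e']
  refine hY n _ ?_ k h3
  have h4 : IsGenericInFiber (f ∘ j) y :=
    hx.of_map j.continuous (hasDiscreteFibers_of_locallyQuasiFinite j)
  have h5 : IsGenericInFiber ((s ∘ π) ∘ g) y := fun z hz ez => h4 z hz (by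
    simpa only [Function.comp_apply, e'] using ez)
  exact IsGenericInFiber.map hπ.isHomeomorph.isOpenEmbedding.generalizingMap
    (IsGenericInFiber.map (Flat.generalizingMap g) h5)

/-! ## Strongly pro perfectly smooth morphisms -/

theorem IsPfp.hasPerfectCharts {p : ℕ} {X Y : Scheme.{u}} {f : X ⟶ Y} (h : IsPfp p f) :
    HasPerfectCharts p X :=
  let ⟨_, _, _, hπ, _⟩ := h
  hπ.perfect.hasPerfectCharts

/-- The limit in `Over Y` is also a limit of schemes. The transition maps are flat, being perfectly
smooth over schemes with perfect charts. -/
theorem IsStronglyProPerfectlySmooth.exists_limit {p : ℕ} [Fact p.Prime] {V Y : Scheme.{u}}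
    {r : V ⟶ Y} (h : IsStronglyProPerfectlySmooth p r) :
    ∃ (J : Type u) (_ : SmallCategory J) (_ : IsCofiltered J) (D : J ⥤ Scheme.{u}) (c : Cone D)
      (_ : IsLimit c) (e : V ≅ c.pt) (g : ∀ j, D.obj j ⟶ Y),
      (∀ j, e.hom ≫ c.π.app j ≫ g j = r) ∧
      (∀ j, IsPfp p (g j) ∧ IsPerfectlySmooth p (g j)) ∧
      (∀ {i j : J} (a : i ⟶ j), D.map a ≫ g j = g i ∧ Flat (D.map a) ∧ IsAffineHom (D.map a)) := by
  obtain ⟨J, _, _, D, c, hc, ⟨iso⟩, h1, h2⟩ := h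
  refine ⟨J, inferInstance, inferInstance, D ⋙ Over.forget Y, (Over.forget Y).mapCone c,
    isLimitOfPreserves (Over.forget Y) hc, (Over.forget Y).mapIso iso.symm, fun j => (D.obj j).hom,
    fun j => ?_, h1, fun {i j} a => ⟨Over.w (D.map a), (h2 i j a).2.1.flat ?_, (h2 i j a).2.2⟩⟩
  · have h3 := Over.w (c.π.app j)
    have h4 := Over.w iso.inv
    simp only [Functor.mapCone_π_app, Over.forget_map, Functor.mapIso_hom, Iso.symm_hom] at *
    exact (congrArg (iso.inv.left ≫ ·) h3).trans h4
  · exact (h1 j).1.hasPerfectCharts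

theorem IsStronglyProPerfectlySmooth.flat {p : ℕ} [Fact p.Prime] {V Y : Scheme.{u}}
    {r : V ⟶ Y} (h : IsStronglyProPerfectlySmooth p r) (hY : HasPerfectCharts p Y) : Flat r := by
  obtain ⟨J, _, _, D, c, hc, e, g, hr, h1, h2⟩ := h.exists_limit
  let j : J := IsCofiltered.nonempty.some
  have (j : J) : Flat (g j) := (h1 j).2.flat hY
  have (i j : J) (a : i ⟶ j) : IsAffineHom (D.map a) := (h2 a).2.2
  have := flat_of_isLimit D c hc j (g j) fun k a => by rw [(h2 a).1]; infer_instance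
  rw [← hr j]
  infer_instance

/-- At the generic points of its fibres, a strongly pro perfectly smooth morphism does not change
the length of chains of generizations. -/
theorem IsStronglyProPerfectlySmooth.hasGenChain_iff {p : ℕ} [Fact p.Prime] {V Y : Scheme.{u}}
    {r : V ⟶ Y} (h : IsStronglyProPerfectlySmooth p r) (hY : HasPerfectCharts p Y)
    (hn : HasNiceAffineSpaces Y) {v : V} (hv : IsGenericInFiber r v) (k : ℕ) :
    HasGenChain k v ↔ HasGenChain k (r v) := by
  have := h.flat hY
  refine ⟨fun hk => ?_, HasGenChain.of_map (Flat.generalizingMap r)⟩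
  obtain ⟨J, _, _, D, c, hc, e, g, hr, h1, h2⟩ := h.exists_limit
  have (i j : J) (a : i ⟶ j) : IsAffineHom (D.map a) := (h2 a).2.2
  have hflat (i j : J) (a : i ⟶ j) : Flat (D.map a) := (h2 a).2.1
  have hk' : HasGenChain k (e.hom v) :=
    hk.map e.hom.continuous (.of_injective e.hom.homeomorph.injective)
  obtain ⟨i, hi⟩ := exists_hasGenChain_of_isLimit D c hc (fun a => Flat.generalizingMap _) hk'
  -- The projection to stage `i` is a limit of flat transition maps, hence generalizing; this
  -- carries genericity in the fibre from `v` to its image at stage `i`.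
  have h3 : Flat (c.π.app i) := by
    have := flat_of_isLimit D c hc i (𝟙 _) fun k a => by
      rw [Category.comp_id]; exact hflat _ _ a
    rwa [Category.comp_id] at this
  have h4 : r v = g i (c.π.app i (e.hom v)) := by
    rw [← hr i]
    rfl
  rw [h4]
  refine (h1 i).2.hasGenChain_map hn ?_ hi
  have h5 : IsGenericInFiber (g i ∘ (e.hom ≫ c.π.app i)) v := fun z hz ez => hv z hz (by
    rw [← hr i]; exact ez)
  exact IsGenericInFiber.map (Flat.generalizingMap (e.hom ≫ c.π.app i)) h5

/-! ## Base change of generic points -/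

theorem exists_fiber_isPullback {Z X₀ V Y₀ : Scheme.{u}} {q : Z ⟶ X₀} {f : Z ⟶ V}
    {f₀ : X₀ ⟶ Y₀} {r : V ⟶ Y₀} (h : IsPullback q f f₀ r) (x : X₀) :
    ∃ F : q.fiber x ⟶ r.fiber (f₀ x), F ≫ r.fiberι (f₀ x) = q.fiberι x ≫ f ∧
      IsPullback F (q.fiberToSpecResidueField x) (r.fiberToSpecResidueField (f₀ x))
        (Spec.map (f₀.residueFieldMap x)) :=
  ⟨_, pullback.lift_fst .., isPullback_fiberToSpecResidueField_of_isPullback h.flip x⟩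

/-- The fibre of `q` through `z` is the base change of a fibre of `r` along an extension of residue
fields. The map between the two fibres is therefore flat and sends generic points to generic points.
-/
theorem isGenericInFiber_of_isPullback {Z X₀ V Y₀ : Scheme.{u}} {q : Z ⟶ X₀} {f : Z ⟶ V}
    {f₀ : X₀ ⟶ Y₀} {r : V ⟶ Y₀} (h : IsPullback q f f₀ r) {z : Z} (hz : IsGenericPt z) :
    IsGenericInFiber r (f z) := by
  obtain ⟨F, hF, sq⟩ := exists_fiber_isPullback h (q z)
  have : Flat F := MorphismProperty.of_isPullback (P := @Flat.{u}) sq.flip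
    (inferInstance : Flat (Spec.map (f₀.residueFieldMap (q z))))
  intro v' hv' e
  have e0 : r (f z) = f₀ (q z) := by
    rw [← Scheme.Hom.comp_apply, ← Scheme.Hom.comp_apply, h.w]
  have hgen : IsGenericPt (q.asFiber z) := fun z' hz' => by
    apply (q.fiberι (q z)).isEmbedding.injective
    rw [q.fiberι_asFiber]
    refine hz _ ?_
    have := hz'.map (q.fiberι (q z)).continuous
    rwa [q.fiberι_asFiber] at this
  have h1 := hgen.map (Flat.generalizingMap F)
  have h2 : r.fiberι (f₀ (q z)) (F (q.asFiber z)) = f z := by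
    rw [← Scheme.Hom.comp_apply, hF, Scheme.Hom.comp_apply, q.fiberι_asFiber]
  obtain ⟨w', rfl⟩ : v' ∈ Set.range (r.fiberι (f₀ (q z))) := by
    rw [r.range_fiberι]; exact e.trans e0
  rw [← h2] at hv' ⊢
  rw [h1 w' ((r.fiberι (f₀ (q z))).isEmbedding.isInducing.specializes_iff.1 hv')]

theorem Module.Finite.of_baseChange_field (k l m : Type*) [Field k] [CommRing l] [Field m]
    [Algebra k l] [Algebra k m] [Module.Finite m (m ⊗[k] l)] : Module.Finite k l := by
  have h1 := Module.rank_lt_aleph0 m (m ⊗[k] l)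
  rw [Module.rank_baseChange, Cardinal.lift_lt_aleph0] at h1
  exact Module.rank_lt_aleph0_iff.1 h1

theorem finite_of_isPullback_of_locallyQuasiFinite {k l m : CommRingCat.{u}} (hk : IsField k)
    (hm : IsField m) {P : Scheme.{u}} {a : k ⟶ l} {b : k ⟶ m} {fst : P ⟶ Spec m} {snd : P ⟶ Spec l}
    (h : IsPullback fst snd (Spec.map b) (Spec.map a)) [LocallyQuasiFinite fst] :
    a.hom.Finite := by
  let _ := hk.toField
  let _ := hm.toField
  algebraize [a.hom, b.hom]
  have h2 := isPullback_SpecMap_of_isPushout _ _ _ _ (CommRingCat.isPushout_tensorProduct k m l)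
  have h : LocallyQuasiFinite (Spec.map (CommRingCat.ofHom (algebraMap m (m ⊗[k] l)))) := by
    have e := IsPullback.isoIsPullback_hom_fst _ _ h2 h
    refine (congrArg (fun q => LocallyQuasiFinite q) e).mp ?_
    infer_instance
  rw [HasRingHomProperty.Spec_iff (P := @LocallyQuasiFinite.{u})] at h
  have h1 : Algebra.QuasiFinite m (m ⊗[k] l) := by
    rw [CommRingCat.hom_ofHom] at h
    exact RingHom.quasiFinite_algebraMap.1 h
  have : Module.Finite m (m ⊗[k] l) := .of_quasiFinite
  exact Module.Finite.of_baseChange_field k l m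

/-- The map between fibres is the base change of the residue field extension, and it inherits local
quasi-finiteness from `f`. Restricting it to one point of the target gives a base change to a field,
from which finiteness descends. -/
theorem finite_residueFieldMap_of_isPullback {Z X₀ V Y₀ : Scheme.{u}} {q : Z ⟶ X₀} {f : Z ⟶ V}
    {f₀ : X₀ ⟶ Y₀} {r : V ⟶ Y₀} (h : IsPullback q f f₀ r) [LocallyQuasiFinite f] (z : Z) :
    (f₀.residueFieldMap (q z)).hom.Finite := by
  obtain ⟨F, hF, sq⟩ := exists_fiber_isPullback h (q z)
  have : LocallyQuasiFinite F := by
    have : LocallyQuasiFinite (F ≫ r.fiberι (f₀ (q z))) := by rw [hF]; infer_instance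
    exact .of_comp F (r.fiberι (f₀ (q z)))
  let w := F (q.asFiber z)
  let b := Spec.preimage ((r.fiber (f₀ (q z))).fromSpecResidueField w ≫
    r.fiberToSpecResidueField (f₀ (q z)))
  have hb : (r.fiber (f₀ (q z))).fromSpecResidueField w ≫ r.fiberToSpecResidueField (f₀ (q z)) =
    Spec.map b := (Spec.map_preimage _).symm
  have sq2 := (IsPullback.of_hasPullback ((r.fiber (f₀ (q z))).fromSpecResidueField w) F).paste_vert
    sq
  rw [hb] at sq2
  exact finite_of_isPullback_of_locallyQuasiFinite (Field.toIsField _) (Field.toIsField _) sq2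

/-! ## Chains of prime ideals in polynomial rings -/

theorem hasGenChain_iff_le_height {R : Type*} [CommRing R] {n : ℕ} {x : PrimeSpectrum R} :
    HasGenChain n x ↔ (n : ℕ∞) ≤ x.asIdeal.height := by
  induction n generalizing x with
  | zero => simp [HasGenChain]
  | succ n ih =>
    rw [PrimeSpectrum.height_eq_orderHeight]
    constructor
    · rintro ⟨y, hy, hne, h⟩
      rw [ih, PrimeSpectrum.height_eq_orderHeight] at h
      have hlt : y < x := lt_of_le_of_ne ((PrimeSpectrum.le_iff_specializes _ _).2 hy) hne
      calc ((n + 1 : ℕ) : ℕ∞) = n + 1 := by push_cast; rfl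
        _ ≤ Order.height y + 1 := by gcongr
        _ ≤ _ := Order.height_add_one_le hlt
    · intro h
      obtain ⟨s, rfl, hs⟩ := Order.exists_series_of_le_height x h
      have hlt : s.eraseLast.last < s.last := RelSeries.eraseLast_last_rel_last s (by omega)
      refine ⟨s.eraseLast.last, (PrimeSpectrum.le_iff_specializes _ _).1 hlt.le, hlt.ne, ih.2 ?_⟩
      rw [PrimeSpectrum.height_eq_orderHeight]
      refine le_trans ?_ Order.length_le_height_last
      simp [hs]

section PolynomialExtension

open MvPolynomial

variable {R : Type*} [CommRing R] (σ : Type*)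

/-- The extension of a prime ideal to a polynomial ring. -/
def PrimeSpectrum.mapC (P : PrimeSpectrum R) : PrimeSpectrum (MvPolynomial σ R) :=
  ⟨P.asIdeal.map C, by
    rw [← Ideal.Quotient.isDomain_iff_prime]
    exact (MvPolynomial.quotientEquivQuotientMvPolynomial P.asIdeal).symm.toMulEquiv.isDomain _⟩

variable {σ}

theorem PrimeSpectrum.mem_mapC {P : PrimeSpectrum R} {f : MvPolynomial σ R} :
    f ∈ (P.mapC σ).asIdeal ↔ ∀ m, f.coeff m ∈ P.asIdeal :=
  MvPolynomial.mem_map_C_iff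

theorem PrimeSpectrum.comap_C_mapC (P : PrimeSpectrum R) :
    PrimeSpectrum.comap C (P.mapC σ) = P := by
  classical
  ext r
  rw [PrimeSpectrum.comap_asIdeal, Ideal.mem_comap, mem_mapC]
  refine ⟨fun h => by simpa using h 0, fun h m => ?_⟩
  rw [coeff_C]
  split_ifs <;> simp [h]

theorem PrimeSpectrum.comap_map_mapC {S : Type*} [CommRing S] (φ : R →+* S) (P : PrimeSpectrum S) :
    PrimeSpectrum.comap (MvPolynomial.map φ) (P.mapC σ) = (PrimeSpectrum.comap φ P).mapC σ := by
  ext f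
  rw [PrimeSpectrum.comap_asIdeal, Ideal.mem_comap, mem_mapC, mem_mapC]
  simp [coeff_map]

theorem PrimeSpectrum.mapC_comap_C_specializes (Q : PrimeSpectrum (MvPolynomial σ R)) :
    (PrimeSpectrum.comap C Q).mapC σ ⤳ Q := by
  rw [← PrimeSpectrum.le_iff_specializes]
  exact Ideal.map_comap_le

variable (R) in
/-- Chains of generizations descend from the extensions of primes to polynomial rings. -/
def HasNicePolynomials : Prop :=
  ∀ (m : ℕ) (P : PrimeSpectrum R) (k : ℕ), HasGenChain k (P.mapC (ULift.{u} (Fin m))) →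
    HasGenChain k P

variable (R) in
-- For a Noetherian flat extension, the height of a prime is the height of its contraction plus its
-- height in the fibre quotient. For an extended prime the second term is zero.
theorem HasNicePolynomials.of_isNoetherianRing [IsNoetherianRing R] : HasNicePolynomials.{u} R := by
  intro m P k h
  rw [hasGenChain_iff_le_height] at h ⊢
  have : (P.mapC (ULift.{u} (Fin m))).asIdeal.LiesOver P.asIdeal :=
    ⟨congrArg PrimeSpectrum.asIdeal P.comap_C_mapC.symm⟩
  have h1 := Ideal.height_eq_height_add_of_liesOver_of_hasGoingDown P.asIdeal
    (P.mapC (ULift.{u} (Fin m))).asIdeal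
  have h2 : (P.mapC (ULift.{u} (Fin m))).asIdeal = P.asIdeal.map (algebraMap R _) := rfl
  have : Nontrivial (MvPolynomial (ULift.{u} (Fin m)) R ⧸ P.asIdeal.map
      (algebraMap R (MvPolynomial (ULift.{u} (Fin m)) R))) :=
    Ideal.Quotient.nontrivial_iff.2 (P.mapC (ULift.{u} (Fin m))).isPrime.ne_top
  rwa [h1, h2, Ideal.map_quotient_self, Ideal.height_bot, add_zero] at h

/-- One element for each strict inclusion witnesses the chain. It survives contraction to any ring
whose image contains these witnesses. -/
theorem HasGenChain.exists_finset {B : Type*} [CommRing B] {k : ℕ} {Q : PrimeSpectrum B}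
    (h : HasGenChain k Q) : ∃ F : Finset B, ∀ {A : Type u} [CommRing A] (φ : A →+* B),
      (F : Set B) ⊆ Set.range φ → HasGenChain k (PrimeSpectrum.comap φ Q) := by
  classical
  induction k generalizing Q with
  | zero => exact ⟨∅, fun _ _ => trivial⟩
  | succ k ih =>
    obtain ⟨y, hy, hne, h⟩ := h
    obtain ⟨F, hF⟩ := ih h
    have hle := (PrimeSpectrum.le_iff_specializes _ _).2 hy
    obtain ⟨f, hfQ, hfy⟩ : ∃ f ∈ Q.asIdeal, f ∉ y.asIdeal := by
      by_contra! h'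
      exact hne (le_antisymm hle h')
    refine ⟨insert f F, fun {A} _ φ hφ => ⟨PrimeSpectrum.comap φ y,
      hy.map (PrimeSpectrum.continuous_comap φ), fun e => ?_, hF φ fun x hx => hφ (by simp [hx])⟩⟩
    obtain ⟨a, rfl⟩ := hφ (by simp : f ∈ _)
    exact hfy (show a ∈ (PrimeSpectrum.comap φ y).asIdeal from e ▸ hfQ)

/-- Finite subsets lie in the images of Noetherian rings under flat homomorphisms. -/
theorem HasNicePolynomials.of_approximation {R : Type u} [CommRing R]
    (hR : ∀ F : Finset R, ∃ (A : Type u) (_ : CommRing A) (_ : IsNoetherianRing A) (φ : A →+* R),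
      φ.Flat ∧ (F : Set R) ⊆ Set.range φ) : HasNicePolynomials.{u} R := by
  classical
  intro m P k h
  obtain ⟨F, hF⟩ := h.exists_finset
  obtain ⟨A, _, _, φ, hφ, hφF⟩ := hR (F.biUnion fun f => f.coeffs)
  have h1 := hF (MvPolynomial.map (σ := ULift.{u} (Fin m)) φ) fun f hf => by
    rw [mem_range_map_iff_coeffs_subset]
    refine subset_trans ?_ hφF
    intro x hx
    simp only [Finset.coe_biUnion, Set.mem_iUnion]
    exact ⟨f, hf, hx⟩
  rw [PrimeSpectrum.comap_map_mapC] at h1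
  exact HasGenChain.of_map hφ.generalizingMap_comap
    (HasNicePolynomials.of_isNoetherianRing A m _ k h1)

theorem isPRadical_mvPolynomial_map {A B : Type*} [CommRing A] [CommRing B] (p : ℕ) [Fact p.Prime]
    [CharP B p] (i : A →+* B) [IsPRadical i p] :
    IsPRadical (MvPolynomial.map (σ := σ) i) p where
  pow_mem' f := by
    induction f using MvPolynomial.induction_on with
    | C b =>
      obtain ⟨n, a, h⟩ := IsPRadical.pow_mem i p b
      exact ⟨n, C a, by rw [map_C, h, C_pow]⟩
    | add f g hf hg =>
      obtain ⟨n, a, ha⟩ := hf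
      obtain ⟨n', a', ha'⟩ := hg
      refine ⟨n + n', a ^ p ^ n' + a' ^ p ^ n, ?_⟩
      rw [map_add, map_pow, map_pow, ha, ha', add_pow_char_pow, ← pow_mul, ← pow_mul, ← pow_add,
        ← pow_add, add_comm n' n]
    | mul_X f j hf =>
      obtain ⟨n, a, ha⟩ := hf
      exact ⟨n, a * X j ^ p ^ n, by rw [map_mul, ha, map_pow, map_X, mul_pow]⟩
  ker_le' f hf := by
    have h : IsNilpotent f := by
      rw [MvPolynomial.isNilpotent_iff]
      intro m
      obtain ⟨n, hn⟩ := mem_pNilradical.1 (IsPRadical.ker_le i p (x := f.coeff m) (by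
        rw [RingHom.mem_ker, ← coeff_map, RingHom.mem_ker.1 hf, coeff_zero]))
      exact ⟨_, hn⟩
    obtain ⟨n, hn⟩ := h
    exact mem_pNilradical.2 ⟨n, pow_eq_zero_of_le
      (Nat.lt_pow_self (Fact.out : p.Prime).one_lt).le hn⟩

theorem HasNicePolynomials.of_isPRadical {A B : Type*} [CommRing A] [CommRing B] (p : ℕ)
    [Fact p.Prime] [CharP B p] (i : A →+* B) [IsPRadical i p] (h : HasNicePolynomials.{u} A) :
    HasNicePolynomials.{u} B := fun m P k hk => by
  have := isPRadical_mvPolynomial_map (σ := ULift.{u} (Fin m)) p i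
  have h1 := hk.map (PrimeSpectrum.continuous_comap (MvPolynomial.map i))
    (.of_injective (IsPRadical.isHomeomorph_comap p _).injective)
  rw [PrimeSpectrum.comap_map_mapC] at h1
  exact (h m _ k h1).of_map (IsPRadical.isHomeomorph_comap p i).isOpenEmbedding.generalizingMap

/-- Finitely many polynomials involve finitely many variables, and the whole ring is a polynomial
ring, hence flat, over the Noetherian subring in those variables. -/
theorem HasNicePolynomials.mvPolynomial (κ : Type u) [Field κ] (τ : Type u) :
    HasNicePolynomials.{u} (MvPolynomial τ κ) := by
  classical
  refine .of_approximation fun F => ?_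
  let s : Finset τ := F.biUnion vars
  refine ⟨MvPolynomial s κ, inferInstance, inferInstance, (rename (R := κ) ((↑) : s → τ)).toRingHom,
    ?_, fun f hf => ?_⟩
  · let e : MvPolynomial ((s : Set τ)ᶜ : Set τ) (MvPolynomial s κ) ≃ₐ[κ] MvPolynomial τ κ :=
      (sumAlgEquiv κ _ _).symm.trans (renameEquiv κ
        ((Equiv.sumComm _ _).trans (Equiv.Set.sumCompl (s : Set τ))))
    have h1 : (rename (R := κ) ((↑) : s → τ)).toRingHom = e.toRingEquiv.toRingHom.comp
        (algebraMap (MvPolynomial s κ) (MvPolynomial ((s : Set τ)ᶜ : Set τ) (MvPolynomial s κ))) := by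
      refine MvPolynomial.ringHom_ext (fun r => ?_) fun t => ?_
      · simp [e, algebraMap_eq]
      · simp [e, algebraMap_eq]
        rfl
    rw [h1]
    exact RingHom.Flat.comp (RingHom.flat_algebraMap_iff.2 inferInstance)
      (.of_bijective e.bijective)
  · have : f ∈ supported κ (s : Set τ) := mem_supported.2 fun x hx =>
      Finset.mem_coe.2 (Finset.mem_biUnion.2 ⟨f, hf, hx⟩)
    rw [supported_eq_range_rename] at this
    exact this

end PolynomialExtension

theorem HasNiceAffineSpaces.of_charts {Y : Scheme.{u}}
    (h : ∀ y : Y, ∃ (R : CommRingCat.{u}) (j : Spec R ⟶ Y), IsOpenImmersion j ∧ y ∈ Set.range j ∧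
      HasNicePolynomials.{u} R) : HasNiceAffineSpaces Y := by
  intro n τ hτ k hk
  let N := ULift.{u} (Fin n)
  obtain ⟨R, j, hj, ⟨y, hy⟩, hR⟩ := h ((𝔸(N; Y) ↘ Y) τ)
  have sq := AffineSpace.isPullback_map (n := N) j
  obtain ⟨τ', h1, h2⟩ := Scheme.exists_preimage_of_isPullback sq τ y hy.symm
  change AffineSpace.map N j τ' = τ at h1
  have h0 (z) : (𝔸(N; Y) ↘ Y) (AffineSpace.map N j z) = j ((𝔸(N; Spec R) ↘ Spec R) z) := by
    rw [← Scheme.Hom.comp_apply, ← Scheme.Hom.comp_apply, sq.w]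
  have : IsOpenImmersion (AffineSpace.map N j) :=
    MorphismProperty.of_isPullback (P := @IsOpenImmersion) sq.flip hj
  have hk1 : HasGenChain k τ' := HasGenChain.of_map (Flat.generalizingMap (AffineSpace.map N j)) (by rwa [h1])
  let e := AffineSpace.SpecIso N R
  have hk2 : HasGenChain k (e.hom τ') :=
    hk1.map e.hom.continuous (.of_injective e.hom.homeomorph.injective)
  have he (z) : (𝔸(N; Spec R) ↘ Spec R) (e.inv z) = PrimeSpectrum.comap MvPolynomial.C z := by
    rw [← Scheme.Hom.comp_apply, AffineSpace.SpecIso_inv_over]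
    rfl
  have he' : e.inv (e.hom τ') = τ' := by simp
  set Q := e.hom τ' with hQ
  -- The extension of the contraction of `Q` specializes to `Q` within the same fibre, so genericity
  -- in the fibre makes the two equal.
  have hQ' : (PrimeSpectrum.comap MvPolynomial.C Q).mapC N = Q := by
    have hs := PrimeSpectrum.mapC_comap_C_specializes Q
    have h3 := hτ (AffineSpace.map N j (e.inv ((PrimeSpectrum.comap MvPolynomial.C Q).mapC N)))
      (by
        rw [← h1, ← he']
        exact (hs.map e.inv.continuous).map (AffineSpace.map N j).continuous)
      (by
        refine (h0 _).trans ((congrArg j ((he _).trans (PrimeSpectrum.comap_C_mapC _))).trans ?_)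
        rw [← h1, h0, ← he']
        exact congrArg j (he Q).symm)
    rw [← h1] at h3
    have h4 := (AffineSpace.map N j).isOpenEmbedding.injective h3
    rw [← he'] at h4
    exact e.inv.homeomorph.injective h4
  rw [← hQ'] at hk2
  have h5 := hR n _ k hk2
  rw [← he, he'] at h5
  rw [← h1, h0]
  exact h5.map j.continuous (.of_injective j.isOpenEmbedding.injective)

/-- Up to perfection the affine charts have finite type over a field, so they are Noetherian. -/
theorem hasNiceAffineSpaces_of_isPfp {p : ℕ} [Fact p.Prime] {κ : Type u} [Field κ] {Y : Scheme.{u}}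
    {s : Y ⟶ Spec (CommRingCat.of κ)} (h : IsPfp p s) : HasNiceAffineSpaces Y := by
  obtain ⟨Y₀, π, s₀, hπ, hs₀, -, -, -⟩ := h
  have := hπ.affine
  have := LocallyOfFiniteType.isLocallyNoetherian s₀
  refine .of_charts fun y => ?_
  obtain ⟨_, ⟨W, hW : IsAffineOpen W, rfl⟩, hyW, -⟩ :=
    Y₀.isBasis_affineOpens.exists_subset_of_mem_open (Set.mem_univ (π y)) isOpen_univ
  have hV := hW.preimage π
  refine ⟨Γ(Y, π ⁻¹ᵁ W), hV.fromSpec, inferInstance, by rw [hV.range_fromSpec]; exact hyW, ?_⟩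
  have := hπ.perfectClosure W hW
  have : IsNoetherianRing Γ(Y₀, W) := IsLocallyNoetherian.component_noetherian ⟨W, hW⟩
  have : Nontrivial Γ(Y, π ⁻¹ᵁ W) := by
    have : Nonempty (π ⁻¹ᵁ W) := ⟨⟨y, hyW⟩⟩
    infer_instance
  have : CharP Γ(Y, π ⁻¹ᵁ W) p := by
    refine (CharP.charP_iff_prime_eq_zero (Fact.out : p.Prime)).2 ?_
    have := congrArg (Y.presheaf.map (homOfLE le_top : π ⁻¹ᵁ W ⟶ ⊤).op) hπ.perfect.char_p
    simpa using this
  exact .of_isPRadical p (π.app W).hom (.of_isNoetherianRing _)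

section

variable (p : ℕ) [Fact p.Prime] (κ : Type u) [Field κ] [CharP κ p]
  (O : Type v) [CommRing O] [Algebra (WittVector p κ) O] (Ω : Type w) [AddCommGroup Ω] [Module O Ω]

instance : IsPRadical (ArcRing.of p κ O Ω) p :=
  inferInstanceAs (IsPRadical (PerfectClosure.of (MvPolynomial (ArcIndex p κ O Ω) κ) p) p)

theorem hasNiceAffineSpaces_arcSpace : HasNiceAffineSpaces (ArcSpace p κ O Ω) :=
  .of_charts fun y => ⟨CommRingCat.of (ArcRing p κ O Ω), 𝟙 (ArcSpace p κ O Ω),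
    (inferInstance : IsOpenImmersion (𝟙 (ArcSpace p κ O Ω))), ⟨y, rfl⟩,
    .of_isPRadical p (ArcRing.of p κ O Ω) (by
      let e := MvPolynomial.renameEquiv κ (Equiv.ulift.{u} (α := ArcIndex p κ O Ω))
      have := IsPRadical.of_bijective p e.toRingEquiv.toRingHom e.bijective
      exact .of_isPRadical p e.toRingEquiv.toRingHom (.mvPolynomial κ _))⟩

theorem hasPerfectCharts_arcSpace : HasPerfectCharts p (ArcSpace p κ O Ω) :=
  hasPerfectCharts_Spec _

end

/-! ## Algebraic rank -/

section AlgebraicRank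

variable (κ : Type*) [Field κ] {F : Type*} [Field F] [Algebra κ F]

/-- The algebraic closure in `F` of the subfield generated by `s` over `κ`. -/
def algCl (s : Set F) : Set F := (AlgebraicIndependent.matroid κ F).closure s

/-- The transcendence degree of the subfield generated by `s` over `κ`. -/
def algRk (s : Set F) : ℕ∞ := (AlgebraicIndependent.matroid κ F).eRk s

variable {κ}

theorem mem_algCl {s : Set F} {x : F} : x ∈ algCl κ s ↔ IsAlgebraic (Algebra.adjoin κ s) x := by
  rw [algCl, AlgebraicIndependent.matroid_closure_eq]
  rfl

theorem subset_algCl (s : Set F) : s ⊆ algCl κ s :=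
  Matroid.subset_closure _ s (Set.subset_univ s)

theorem algCl_mono {s t : Set F} (h : s ⊆ t) : algCl κ s ⊆ algCl κ t :=
  Matroid.closure_subset_closure _ h

theorem algCl_subset_algCl {s t : Set F} (h : s ⊆ algCl κ t) : algCl κ s ⊆ algCl κ t :=
  Matroid.closure_subset_closure_of_subset_closure h

theorem algCl_algCl (s : Set F) : algCl κ (algCl κ s) = algCl κ s :=
  Matroid.closure_closure _ s

theorem algRk_mono {s t : Set F} (h : s ⊆ t) : algRk κ s ≤ algRk κ t :=
  Matroid.eRk_mono _ h

theorem algRk_algCl (s : Set F) : algRk κ (algCl κ s) = algRk κ s :=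
  Matroid.eRk_closure_eq _ s

theorem algRk_eq {s t : Set F} (h : s ⊆ algCl κ t) (h' : t ⊆ algCl κ s) : algRk κ s = algRk κ t := by
  rw [← algRk_algCl s, ← algRk_algCl t,
    (algCl_subset_algCl h).antisymm (algCl_subset_algCl h')]

theorem algRk_insert_of_mem {s : Set F} {x : F} (h : x ∈ algCl κ s) :
    algRk κ (insert x s) = algRk κ s :=
  algRk_eq (Set.insert_subset h (subset_algCl s)) ((Set.subset_insert x s).trans (subset_algCl _))

theorem algRk_insert_of_notMem {s : Set F} {x : F} (h : x ∉ algCl κ s) :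
    algRk κ (insert x s) = algRk κ s + 1 :=
  Matroid.eRk_insert_eq_add_one ⟨Set.mem_univ x, h⟩

theorem algebra_adjoin_subset_algCl (s : Set F) : (Algebra.adjoin κ s : Set F) ⊆ algCl κ s :=
  fun x hx => mem_algCl.2 (isAlgebraic_algebraMap (⟨x, hx⟩ : Algebra.adjoin κ s))

theorem algRk_le_encard (s : Set F) : algRk κ s ≤ s.encard := Matroid.eRk_le_encard _ s

theorem algRk_range_eq_of_surjective {A B : Type*} [CommRing A] [CommRing B] [Algebra κ A]
    [Algebra κ B] {π : A →ₐ[κ] B} (hπ : Function.Surjective π) (ψ : B →ₐ[κ] F) :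
    algRk κ (Set.range (ψ.comp π)) = algRk κ (Set.range ψ) := by
  rw [AlgHom.coe_comp, hπ.range_comp]

theorem algRk_range_mvPolynomial {σ : Type*} (φ : MvPolynomial σ κ →ₐ[κ] F) :
    algRk κ (Set.range φ) = algRk κ (Set.range fun i => φ (MvPolynomial.X i)) := by
  have h : (φ.range : Set F) = Algebra.adjoin κ (Set.range fun i => φ (MvPolynomial.X i)) := by
    rw [← Algebra.map_top, ← MvPolynomial.adjoin_range_X, AlgHom.map_adjoin, ← Set.range_comp]
    rfl
  refine algRk_eq ?_ ?_
  · rw [← AlgHom.coe_range, h]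
    exact algebra_adjoin_subset_algCl _
  · exact (Set.range_comp_subset_range MvPolynomial.X φ).trans (subset_algCl _)

end AlgebraicRank

/-! ## Heights of prime ideals in polynomial rings -/

section Height

open Polynomial

/-- The fibre over `P` is the spectrum of a polynomial ring in one variable over a field, of
dimension at most one. -/
theorem not_lt_lt_of_comap_C_eq {R : Type*} [CommRing R] (P : PrimeSpectrum R)
    {q₀ q₁ q₂ : PrimeSpectrum R[X]} (h₀ : PrimeSpectrum.comap C q₀ = P)
    (h₁ : PrimeSpectrum.comap C q₁ = P) (h₂ : PrimeSpectrum.comap C q₂ = P) (h01 : q₀ < q₁)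
    (h12 : q₁ < q₂) : False := by
  have hdim : Order.krullDim ((PrimeSpectrum.comap (algebraMap R R[X])) ⁻¹' {P}) ≤ 1 := by
    rw [Order.krullDim_eq_of_orderIso (PrimeSpectrum.preimageOrderIsoFiber R R[X] P),
      ← ringKrullDim,
      ← ringKrullDim_eq_of_ringEquiv (polyEquivTensor R (P.asIdeal.ResidueField)).toRingEquiv]
    exact (Ring.krullDimLE_iff (n := 1)).1 inferInstance
  let S : LTSeries ((PrimeSpectrum.comap (algebraMap R R[X])) ⁻¹' {P}) :=
    { length := 2
      toFun := ![⟨q₀, h₀⟩, ⟨q₁, h₁⟩, ⟨q₂, h₂⟩]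
      step := fun i => by
        fin_cases i
        · exact h01
        · exact h12 }
  have := (Order.LTSeries.length_le_krullDim S).trans hdim
  have h : (2 : ℕ) ≤ 1 := by exact_mod_cast this
  omega

/-- By going down, only the height of `Q` modulo the extension of its contraction is in question. It
is positive as `Q` is larger than that extension, and at most one because the fibre is
one-dimensional. -/
theorem height_eq_height_comap_add_one {R : Type*} [CommRing R] [IsNoetherianRing R] (Q : Ideal R[X])
    [Q.IsPrime] (h : ¬ Q ≤ (Q.comap C).map C) : Q.height = (Q.comap C).height + 1 := by
  have : Q.LiesOver (Q.comap C) := ⟨rfl⟩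
  rw [Ideal.height_eq_height_add_of_liesOver_of_hasGoingDown (Q.comap C) Q]
  congr 1
  set I : Ideal R[X] := (Q.comap C).map (algebraMap R R[X]) with hI
  have hIprime : I.IsPrime := Ideal.isPrime_map_C_of_isPrime
  have hIQ : I ≤ Q := Ideal.map_comap_le
  have hlt : I < Q := lt_of_le_not_ge hIQ h
  have hmap : (Q.map (Ideal.Quotient.mk I)).IsPrime :=
    Ideal.map_isPrime_of_surjective Ideal.Quotient.mk_surjective (by rwa [Ideal.mk_ker])
  have hcm : (Q.map (Ideal.Quotient.mk I)).comap (Ideal.Quotient.mk I) = Q :=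
    Ideal.comap_map_quotientMk I Q |>.trans (sup_eq_right.2 hIQ)
  have hcomapC (q : PrimeSpectrum R[X]) (h1 : I ≤ q.asIdeal) (h2 : q.asIdeal ≤ Q) :
      PrimeSpectrum.comap C q = ⟨Q.comap C, inferInstance⟩ :=
    PrimeSpectrum.ext (le_antisymm (Ideal.comap_mono h2) (Ideal.map_le_iff_le_comap.1 h1))
  let x : PrimeSpectrum (R[X] ⧸ I) := ⟨_, hmap⟩
  let φ := PrimeSpectrum.comap (Ideal.Quotient.mk I)
  have hφ : StrictMono φ := by
    have h1 : Function.Injective φ :=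
      PrimeSpectrum.comap_injective_of_surjective _ Ideal.Quotient.mk_surjective
    exact Monotone.strictMono_of_injective (fun a b hab => Ideal.comap_mono hab) h1
  have hIφ (z) : I ≤ (φ z).asIdeal := fun a ha => by
    change Ideal.Quotient.mk I a ∈ z.asIdeal
    rw [Ideal.Quotient.eq_zero_iff_mem.2 ha]
    exact zero_mem _
  have hφx : φ x = ⟨Q, inferInstance⟩ := PrimeSpectrum.ext hcm
  refine le_antisymm ?_ ?_
  · by_contra! h1
    have h2 : HasGenChain 2 x := by
      rw [hasGenChain_iff_le_height]
      exact (ENat.add_one_le_iff (by simp)).2 h1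
    obtain ⟨y, hy, hyx, z, hz, hzy, -⟩ := h2
    have hy' : y < x := lt_of_le_of_ne ((PrimeSpectrum.le_iff_specializes _ _).2 hy) hyx
    have hz' : z < y := lt_of_le_of_ne ((PrimeSpectrum.le_iff_specializes _ _).2 hz) hzy
    have hle {w} (hw : w ≤ x) : (φ w).asIdeal ≤ Q := (hφ.monotone hw).trans hφx.le
    exact not_lt_lt_of_comap_C_eq _ (hcomapC (φ z) (hIφ z) (hle (hz'.trans hy').le))
      (hcomapC (φ y) (hIφ y) (hle hy'.le)) (hcomapC (φ x) (hIφ x) (hle le_rfl)) (hφ hz') (hφ hy')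
  · have h1 : HasGenChain 1 x := by
      refine ⟨⊥, (PrimeSpectrum.le_iff_specializes _ _).1 bot_le, fun e => ?_, trivial⟩
      refine h fun f hf => ?_
      have h2 : Ideal.Quotient.mk I f ∈ x.asIdeal := Ideal.mem_map_of_mem _ hf
      rw [← e] at h2
      exact Ideal.Quotient.eq_zero_iff_mem.1 h2
    rw [hasGenChain_iff_le_height] at h1
    exact h1

theorem height_eq_height_comap {R : Type*} [CommRing R] [IsNoetherianRing R] (Q : Ideal R[X])
    [Q.IsPrime] (h : Q ≤ (Q.comap C).map C) : Q.height = (Q.comap C).height := by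
  have : Q.LiesOver (Q.comap C) := ⟨rfl⟩
  rw [Ideal.height_eq_height_add_of_liesOver_of_hasGoingDown (Q.comap C) Q]
  have hQ : (Q.comap C).map (algebraMap R R[X]) = Q := le_antisymm Ideal.map_comap_le h
  have : Nontrivial (R[X] ⧸ Q) := Ideal.Quotient.nontrivial_iff.2 Ideal.IsPrime.ne_top'
  rw [hQ, Ideal.map_quotient_self, Ideal.height_bot, add_zero]

variable {κ : Type*} [Field κ] {F : Type*} [Field F] [Algebra κ F]

/-- Either `ψ X` is algebraic over the image of `φ`, and then `ker ψ` exceeds the extension of `ker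
φ` and the height grows by one; or it is transcendental, `ker ψ` is extended, and the rank grows by
one. -/
theorem height_ker_add_algRk_polynomial {R : Type*} [CommRing R] [IsNoetherianRing R] [Algebra κ R]
    (ψ : R[X] →ₐ[κ] F) (φ : R →ₐ[κ] F) (hφ : ∀ r, φ r = ψ (C r)) :
    (RingHom.ker ψ).height + algRk κ (insert (ψ X) (Set.range φ)) =
      (RingHom.ker φ).height + algRk κ (Set.range φ) + 1 := by
  have hc : (RingHom.ker ψ).comap C = RingHom.ker φ := by
    ext r
    rw [Ideal.mem_comap, RingHom.mem_ker, RingHom.mem_ker, hφ]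
  have hψ (f : R[X]) : ψ f = f.eval₂ (φ : R →+* F) (ψ X) := by
    have : (ψ : R[X] →+* F) = eval₂RingHom (φ : R →+* F) (ψ X) :=
      Polynomial.ringHom_ext (fun r => by simp [hφ]) (by simp)
    exact RingHom.congr_fun this f
  have hprime : (RingHom.ker ψ).IsPrime := RingHom.ker_isPrime _
  have hadj : Algebra.adjoin κ (Set.range φ) = φ.range := by
    rw [← AlgHom.coe_range, Algebra.adjoin_eq]
  by_cases hX : ψ X ∈ algCl κ (Set.range φ)
  · rw [algRk_insert_of_mem hX, height_eq_height_comap_add_one, hc]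
    · ring
    · intro h
      rw [mem_algCl, hadj] at hX
      obtain ⟨f, hf0, hf⟩ := hX
      obtain ⟨g, rfl⟩ := Polynomial.map_surjective φ.rangeRestrict.toRingHom
        φ.rangeRestrict_surjective f
      have hg : g ∈ RingHom.ker ψ := by
        rw [RingHom.mem_ker, hψ]
        rw [aeval_def, eval₂_map] at hf
        exact hf
      refine hf0 (Polynomial.ext fun n => ?_)
      have h1 := Ideal.mem_map_C_iff.1 (h hg) n
      rw [hc, RingHom.mem_ker] at h1
      rw [coeff_map, coeff_zero]
      exact Subtype.ext h1
  · rw [algRk_insert_of_notMem hX, height_eq_height_comap, hc]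
    · ring
    · intro f hf
      rw [hc, Ideal.mem_map_C_iff]
      by_contra! h
      refine hX (mem_algCl.2 ?_)
      rw [hadj]
      refine ⟨f.map φ.rangeRestrict.toRingHom, fun h0 => ?_, ?_⟩
      · obtain ⟨n, hn⟩ := h
        have := congrArg (fun q => q.coeff n) h0
        rw [coeff_map, coeff_zero] at this
        exact hn (congrArg Subtype.val this)
      · rw [aeval_def, eval₂_map]
        exact (hψ f).symm.trans hf

/-- The dimension formula for polynomial rings over a field, obtained by adjoining one variable at a
time. It is the source of every passage between heights and transcendence degrees below. -/
theorem height_ker_add_algRk_fin (n : ℕ) (φ : MvPolynomial (Fin n) κ →ₐ[κ] F) :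
    (RingHom.ker φ).height + algRk κ (Set.range φ) = n := by
  induction n with
  | zero =>
    have h1 : RingHom.ker φ = ⊥ := by
      rw [← RingHom.injective_iff_ker_eq_bot]
      intro a b hab
      obtain ⟨a, rfl⟩ := MvPolynomial.C_surjective (Fin 0) a
      obtain ⟨b, rfl⟩ := MvPolynomial.C_surjective (Fin 0) b
      have h2 (r : κ) : φ (MvPolynomial.C r) = algebraMap κ F r := φ.commutes r
      change φ _ = φ _ at hab
      rw [h2, h2] at hab
      rw [(algebraMap κ F).injective hab]
    rw [h1, Ideal.height_bot, algRk_range_mvPolynomial]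
    simp [algRk]
  | succ n ih =>
    let e := MvPolynomial.finSuccEquiv κ n
    let ψ : (MvPolynomial (Fin n) κ)[X] →ₐ[κ] F := φ.comp e.symm.toAlgHom
    let φ' : MvPolynomial (Fin n) κ →ₐ[κ] F := φ.comp (MvPolynomial.rename Fin.succ)
    have h1 : (RingHom.ker φ).height = (RingHom.ker ψ).height := by
      have : RingHom.ker ψ = (RingHom.ker φ).comap e.symm.toRingEquiv := rfl
      rw [this, RingEquiv.height_comap]
    have h2 (r) : φ' r = ψ (C r) := by
      have : φ' = ψ.comp (Algebra.algHom κ (MvPolynomial (Fin n) κ) (MvPolynomial (Fin n) κ)[X]) := by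
        refine MvPolynomial.algHom_ext fun i => ?_
        have h5 : e.symm (C (MvPolynomial.X i)) = MvPolynomial.X i.succ := by
          rw [← MvPolynomial.finSuccEquiv_X_succ]
          exact e.symm_apply_apply _
        change φ (MvPolynomial.rename Fin.succ (MvPolynomial.X i)) = φ (e.symm (C (MvPolynomial.X i)))
        rw [h5, MvPolynomial.rename_X]
      exact DFunLike.congr_fun this r
    have h3 : ψ X = φ (MvPolynomial.X 0) := congrArg φ (by
      rw [← MvPolynomial.finSuccEquiv_X_zero]; exact e.symm_apply_apply _)
    have h4 := height_ker_add_algRk_polynomial ψ φ' h2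
    rw [ih] at h4
    rw [h1, Nat.cast_succ, ← h4]
    congr 1
    rw [algRk_range_mvPolynomial]
    refine algRk_eq ?_ ?_
    · rintro _ ⟨i, rfl⟩
      refine subset_algCl _ ?_
      refine Fin.cases ?_ (fun j => ?_) i
      · exact Or.inl h3.symm
      · exact Or.inr ⟨MvPolynomial.X j, by simp [φ']⟩
    · refine Set.insert_subset (subset_algCl _ ⟨0, h3.symm⟩) ?_
      have h5 : Set.range φ' ⊆ Algebra.adjoin κ (Set.range fun i => φ' (MvPolynomial.X i)) := by
        rw [← AlgHom.coe_range, ← Algebra.map_top, ← MvPolynomial.adjoin_range_X, AlgHom.map_adjoin,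
          ← Set.range_comp]
        rfl
      refine h5.trans ((algebra_adjoin_subset_algCl _).trans (algCl_mono ?_))
      rintro _ ⟨i, rfl⟩
      exact ⟨i.succ, by simp [φ']⟩

theorem height_ker_add_algRk {σ : Type*} [Finite σ] (φ : MvPolynomial σ κ →ₐ[κ] F) :
    (RingHom.ker φ).height + algRk κ (Set.range φ) = Nat.card σ := by
  have e := MvPolynomial.renameEquiv κ (Finite.equivFin σ).symm
  rw [← height_ker_add_algRk_fin (Nat.card σ) (φ.comp e.toAlgHom)]
  congr 1
  · have : RingHom.ker (φ.comp e.toAlgHom) = (RingHom.ker φ).comap e.toRingEquiv := rfl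
    rw [this, RingEquiv.height_comap]
  · exact (algRk_range_eq_of_surjective e.surjective φ).symm

end Height

/-! ## Dimension of finitely generated algebras -/

section

variable {κ : Type*} [Field κ] {A : Type*} [CommRing A] [Algebra κ A]

theorem hasGenChain_mono {x y : PrimeSpectrum A} {n : ℕ} (h : HasGenChain n y) (hy : y ≤ x) :
    HasGenChain n x := by
  rw [hasGenChain_iff_le_height] at h ⊢
  exact h.trans (Ideal.height_mono hy)

theorem hasGenChain_comap_mk {P : PrimeSpectrum A} {k j : ℕ} (hP : HasGenChain k P)
    {y : PrimeSpectrum (A ⧸ P.asIdeal)} (hy : HasGenChain j y) :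
    HasGenChain (k + j) (PrimeSpectrum.comap (Ideal.Quotient.mk P.asIdeal) y) := by
  induction j generalizing y with
  | zero =>
    refine hasGenChain_mono hP fun a ha => ?_
    change Ideal.Quotient.mk P.asIdeal a ∈ y.asIdeal
    rw [Ideal.Quotient.eq_zero_iff_mem.2 ha]
    exact zero_mem _
  | succ j ih =>
    obtain ⟨z, hz, hzy, h⟩ := hy
    exact ⟨_, hz.map (PrimeSpectrum.continuous_comap _), fun e => hzy
      (PrimeSpectrum.comap_injective_of_surjective _ Ideal.Quotient.mk_surjective e), ih h⟩

variable {F : Type*} [Field F] [Algebra κ F]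

theorem algRk_range_comp_of_isIntegral {B : Type*} [CommRing B] [Algebra κ B] (g : A →ₐ[κ] B)
    (hg : g.IsIntegral) (ψ : B →ₐ[κ] F) :
    algRk κ (Set.range (ψ.comp g)) = algRk κ (Set.range ψ) := by
  refine algRk_eq ?_ ?_
  · rintro _ ⟨a, rfl⟩
    exact subset_algCl _ ⟨g a, rfl⟩
  · rintro _ ⟨b, rfl⟩
    obtain ⟨f, hf, h⟩ := hg b
    let ρ : A →+* Algebra.adjoin κ (Set.range (ψ.comp g)) :=
      (ψ.comp g : A →+* F).codRestrict _ fun a => Algebra.subset_adjoin ⟨a, rfl⟩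
    refine mem_algCl.2 ⟨f.map ρ, (hf.map ρ).ne_zero, ?_⟩
    rw [Polynomial.aeval_def, Polynomial.eval₂_map]
    have h1 : (algebraMap (Algebra.adjoin κ (Set.range (ψ.comp g))) F).comp ρ =
      (ψ : B →+* F).comp (g : A →+* B) := rfl
    rw [h1]
    exact (Polynomial.hom_eval₂ _ _ _ _).symm.trans ((congrArg ψ h).trans (map_zero ψ))

theorem height_comap_le_of_generalizingMap {B : Type*} [CommRing B] (g : A →+* B)
    (hg : GeneralizingMap (PrimeSpectrum.comap g)) (P : PrimeSpectrum B) :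
    (PrimeSpectrum.comap g P).asIdeal.height ≤ P.asIdeal.height := by
  rw [← ENat.forall_natCast_le_iff_le]
  intro n hn
  rw [← hasGenChain_iff_le_height] at hn ⊢
  exact hn.of_map hg

/-- Noether normalization makes `A` integral over a polynomial ring, where the dimension formula is
an equality. Integral maps preserve ranks, and going down into the domain `A` shows that contraction
does not increase heights. -/
theorem algRk_range_le_height_ker_add [IsDomain A] [Algebra.FiniteType κ A] {F₀ : Type*} [Field F₀]
    [Algebra κ F₀] (ψ₀ : A →ₐ[κ] F₀) (hψ₀ : Function.Injective ψ₀) (ψ : A →ₐ[κ] F) :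
    algRk κ (Set.range ψ₀) ≤ (RingHom.ker ψ).height + algRk κ (Set.range ψ) := by
  obtain ⟨s, g, hg, hint⟩ := exists_integral_inj_algHom_of_fg κ A
  let _ := g.toRingHom.toAlgebra
  have : Algebra.IsIntegral (MvPolynomial (Fin s) κ) A := ⟨hint⟩
  have : FaithfulSMul (MvPolynomial (Fin s) κ) A := (faithfulSMul_iff_algebraMap_injective _ _).2 hg
  have hgd := Algebra.HasGoingDown.iff_generalizingMap_primeSpectrumComap.1
    (inferInstance : Algebra.HasGoingDown (MvPolynomial (Fin s) κ) A)
  have h1 := height_comap_le_of_generalizingMap g.toRingHom hgd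
    ⟨RingHom.ker ψ, RingHom.ker_isPrime _⟩
  have h2 := height_ker_add_algRk_fin s (ψ.comp g)
  have h3 := height_ker_add_algRk_fin s (ψ₀.comp g)
  have h4 : RingHom.ker (ψ₀.comp g) = ⊥ := (RingHom.injective_iff_ker_eq_bot (ψ₀.comp g)).1 (hψ₀.comp hg)
  rw [h4, Ideal.height_bot, zero_add, algRk_range_comp_of_isIntegral g hint] at h3
  rw [algRk_range_comp_of_isIntegral g hint] at h2
  rw [h3, ← h2]
  gcongr
  exact h1

/-- Zariski's lemma: a field of finite type over `κ` is finite over `κ`. -/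
theorem algRk_range_of_ker_isMaximal [Algebra.FiniteType κ A] (ψ : A →ₐ[κ] F)
    (hψ : Function.Surjective ψ) : algRk κ (Set.range ψ) = 0 := by
  have : Algebra.FiniteType κ F := .of_surjective ψ hψ
  have := finite_of_finite_type_of_isJacobsonRing κ F
  rw [show (0 : ℕ∞) = algRk κ (∅ : Set F) by simp [algRk]]
  refine algRk_eq (fun x _ => mem_algCl.2 ?_) (Set.empty_subset _)
  exact (Algebra.IsAlgebraic.isAlgebraic (R := κ) x).extendScalars
    (FaithfulSMul.algebraMap_injective κ _)

/-- The kernel of a homomorphism to a field, as a point of the spectrum. -/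
def kerPt (φ : A →ₐ[κ] F) : PrimeSpectrum A := ⟨RingHom.ker φ, RingHom.ker_isPrime _⟩

/-- A chain of length `k` below the kernel is continued upwards to a maximal ideal, where the rank
drops to zero. The height gained is at least the rank at the kernel. -/
theorem add_algRk_le_ringKrullDim [Algebra.FiniteType κ A] (φ : A →ₐ[κ] F) {k : ℕ}
    (hk : HasGenChain k (kerPt φ)) :
    ((k + algRk κ (Set.range φ) : ℕ∞) : WithBot ℕ∞) ≤ ringKrullDim A := by
  let P := kerPt φ
  have hdom : IsDomain (A ⧸ P.asIdeal) := (Ideal.Quotient.isDomain_iff_prime _).2 P.isPrime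
  let ψ₀ : A ⧸ P.asIdeal →ₐ[κ] F := Ideal.kerLiftAlg φ
  have hψ₀ : Function.Injective ψ₀ := Ideal.kerLiftAlg_injective φ
  obtain ⟨n, hn⟩ := Ideal.exists_maximal (A ⧸ P.asIdeal)
  let _ : Field ((A ⧸ P.asIdeal) ⧸ n) := Ideal.Quotient.field n
  let ψ : A ⧸ P.asIdeal →ₐ[κ] (A ⧸ P.asIdeal) ⧸ n := Ideal.Quotient.mkₐ κ n
  have h1 := algRk_range_le_height_ker_add ψ₀ hψ₀ ψ
  rw [algRk_range_of_ker_isMaximal ψ (Ideal.Quotient.mkₐ_surjective κ n), add_zero] at h1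
  have h2 : Set.range φ = Set.range ψ₀ := by
    have : φ = ψ₀.comp (Ideal.Quotient.mkₐ κ _) := by
      ext a
      rfl
    rw [this, AlgHom.coe_comp, (Ideal.Quotient.mkₐ_surjective κ _).range_comp]
  rw [h2]
  let y : PrimeSpectrum (A ⧸ P.asIdeal) := ⟨RingHom.ker ψ, RingHom.ker_isPrime _⟩
  have h3 : (k + algRk κ (Set.range ψ₀) : ℕ∞) ≤
      (PrimeSpectrum.comap (Ideal.Quotient.mk P.asIdeal) y).asIdeal.height := by
    rw [← ENat.forall_natCast_le_iff_le]
    intro m hm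
    rcases le_total m k with hmk | hmk
    · exact (Nat.cast_le.2 hmk).trans (le_trans (by simp)
        (hasGenChain_iff_le_height.1 (hasGenChain_comap_mk hk (y := y) (j := 0) trivial)))
    · obtain ⟨j, rfl⟩ := Nat.exists_eq_add_of_le hmk
      rw [Nat.cast_add, ENat.add_le_add_iff_left (by simp)] at hm
      exact hasGenChain_iff_le_height.1 (hasGenChain_comap_mk hk
        (hasGenChain_iff_le_height.2 (hm.trans h1)))
  refine le_trans (WithBot.coe_le_coe.2 h3) ?_
  exact Ideal.height_le_ringKrullDim_of_ne_top (PrimeSpectrum.isPrime _).ne_top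

theorem height_add_length_le {B : Type*} [CommRing B] (s : LTSeries (PrimeSpectrum B)) :
    s.head.asIdeal.height + s.length ≤ s.last.asIdeal.height := by
  have h (i : ℕ) (hi : i ≤ s.length) :
      s.head.asIdeal.height + i ≤ (s ⟨i, by omega⟩).asIdeal.height := by
    induction i with
    | zero => simp [RelSeries.head]
    | succ i ih =>
      have hlt : s ⟨i, by omega⟩ < s ⟨i + 1, by omega⟩ := s.step ⟨i, by omega⟩
      have h1 := Order.height_add_one_le hlt
      rw [← PrimeSpectrum.height_eq_orderHeight, ← PrimeSpectrum.height_eq_orderHeight] at h1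
      refine le_trans ?_ h1
      rw [Nat.cast_succ, ← add_assoc]
      gcongr
      exact ih (by omega)
  exact h s.length le_rfl

/-- The homomorphism to the residue field of a point. -/
def resHom (κ : Type*) [Field κ] {A : Type*} [CommRing A] [Algebra κ A] (P : PrimeSpectrum A) :
    A →ₐ[κ] P.asIdeal.ResidueField :=
  IsScalarTower.toAlgHom κ A _

theorem kerPt_resHom (P : PrimeSpectrum A) : kerPt (resHom κ P) = P :=
  PrimeSpectrum.ext (Ideal.ker_algebraMap_residueField P.asIdeal)

/-- In a polynomial ring mapping onto `A`, height plus rank is constant, and the height grows by at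
least the length of the chain. -/
theorem algRk_add_length_le [Algebra.FiniteType κ A] (s : LTSeries (PrimeSpectrum A))
    {F₀ : Type*} [Field F₀] [Algebra κ F₀] (φ₀ : A →ₐ[κ] F₀) (h₀ : kerPt φ₀ ≤ s.head)
    (φ : A →ₐ[κ] F) (h : s.last ≤ kerPt φ) :
    algRk κ (Set.range φ) + s.length ≤ algRk κ (Set.range φ₀) := by
  obtain ⟨n, π, hπ⟩ := Algebra.FiniteType.iff_quotient_mvPolynomial''.1
    (inferInstance : Algebra.FiniteType κ A)
  have hmono : StrictMono (PrimeSpectrum.comap π.toRingHom) :=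
    Monotone.strictMono_of_injective (fun a b hab => Ideal.comap_mono hab)
      (PrimeSpectrum.comap_injective_of_surjective _ hπ)
  have h1 := height_ker_add_algRk_fin n (φ₀.comp π)
  have h2 := height_ker_add_algRk_fin n (φ.comp π)
  rw [algRk_range_eq_of_surjective hπ] at h1 h2
  have h3 := height_add_length_le (s.map _ hmono)
  rw [LTSeries.head_map, LTSeries.last_map, LTSeries.map_length] at h3
  have h4 : (RingHom.ker (φ₀.comp π)).height + s.length ≤ (RingHom.ker (φ.comp π)).height :=
    (add_le_add_left (Ideal.height_mono (Ideal.comap_mono h₀)) _).trans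
      (h3.trans (Ideal.height_mono (Ideal.comap_mono h)))
  have h5 : (RingHom.ker (φ₀.comp π)).height ≠ ⊤ := fun e => by simp [e] at h1
  refine (ENat.add_le_add_iff_left h5).1 ?_
  rw [h1, ← h2]
  calc _ = (RingHom.ker (φ₀.comp π)).height + s.length + algRk κ (Set.range φ) := by ring
    _ ≤ _ := by gcongr

/-- The element `g` lies in every minimal prime not contained in the kernel of `φ`, so after
inverting it every chain starts above a minimal prime `p` below that kernel. The length of the chain
is at most the rank of `A ⧸ p`, which is bounded by the height of the kernel in `A ⧸ p` plus the
rank of `φ`. -/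
theorem exists_ringKrullDim_away_le [Algebra.FiniteType κ A] (φ : A →ₐ[κ] F) {k : ℕ}
    (hk : ¬ HasGenChain (k + 1) (kerPt φ)) :
    ∃ g, φ g ≠ 0 ∧ ∀ (B : Type*) [CommRing B] [Algebra A B] [IsLocalization.Away g B],
      ringKrullDim B ≤ ((k + algRk κ (Set.range φ) : ℕ∞) : WithBot ℕ∞) := by
  classical
  have : IsNoetherianRing A := Algebra.FiniteType.isNoetherianRing κ A
  have hfin := minimalPrimes.finite_of_isNoetherianRing A
  have h1 (p : Ideal A) : ∃ g, φ g ≠ 0 ∧ (¬ p ≤ RingHom.ker φ → g ∈ p) := by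
    by_cases hp : p ≤ RingHom.ker φ
    · exact ⟨1, by simp, fun h => absurd hp h⟩
    · obtain ⟨g, hg, hg'⟩ := SetLike.not_le_iff_exists.1 hp
      exact ⟨g, hg', fun _ => hg⟩
  choose G hG hG' using h1
  refine ⟨∏ p ∈ hfin.toFinset, G p, ?_, fun B _ _ _ => ?_⟩
  · rw [map_prod]
    exact Finset.prod_ne_zero_iff.2 fun p _ => hG p
  set g := ∏ p ∈ hfin.toFinset, G p
  rw [ringKrullDim_le_iff_height_le]
  intro q hq
  rw [WithBot.coe_le_coe, ← ENat.forall_natCast_le_iff_le]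
  intro m hm
  have hinj : Function.Injective (PrimeSpectrum.comap (algebraMap A B)) :=
    PrimeSpectrum.localization_comap_injective B (Submonoid.powers g)
  have hmono : StrictMono (PrimeSpectrum.comap (algebraMap A B)) :=
    Monotone.strictMono_of_injective (fun a b hab => Ideal.comap_mono hab) hinj
  obtain ⟨s, hs, hsm⟩ := Order.exists_series_of_le_height (⟨q, hq⟩ : PrimeSpectrum B) (by
    rwa [← PrimeSpectrum.height_eq_orderHeight])
  let s' := s.map _ hmono
  obtain ⟨p, hp, hps⟩ := Ideal.exists_minimalPrimes_le (bot_le (a := s'.head.asIdeal))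
  have hpφ : p ≤ RingHom.ker φ := by
    by_contra hne
    have hgp : g ∈ p := Ideal.mem_of_dvd _ (Finset.dvd_prod_of_mem G (hfin.mem_toFinset.2 hp)) (hG' p hne)
    have h2 : algebraMap A B g ∈ s.head.asIdeal := by
      have := hps hgp
      rw [LTSeries.head_map] at this
      exact this
    exact s.head.isPrime.ne_top (Ideal.eq_top_of_isUnit_mem _ h2
      (IsLocalization.map_units B (⟨g, Submonoid.mem_powers g⟩ : Submonoid.powers g)))
  have hpp : p.IsPrime := hp.1.1
  let P : PrimeSpectrum A := ⟨p, hpp⟩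
  have h2 := algRk_add_length_le s' (resHom κ P) (by rw [kerPt_resHom]; exact hps)
    (resHom κ s'.last) (by rw [kerPt_resHom])
  have hs'm : s'.length = m := hsm
  rw [hs'm] at h2
  refine le_trans (le_add_self.trans h2) ?_
  let ψ₀ : A ⧸ p →ₐ[κ] p.ResidueField := IsScalarTower.toAlgHom κ (A ⧸ p) _
  have hψ₀ : Function.Injective ψ₀ := FaithfulSMul.algebraMap_injective (A ⧸ p) p.ResidueField
  have hr : Set.range (resHom κ P) = Set.range ψ₀ := by
    have : resHom κ P = ψ₀.comp (Ideal.Quotient.mkₐ κ p) := by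
      ext a
      exact IsScalarTower.algebraMap_apply A (A ⧸ p) p.ResidueField a
    rw [this, AlgHom.coe_comp, (Ideal.Quotient.mkₐ_surjective κ p).range_comp]
  let ψ : A ⧸ p →ₐ[κ] F := Ideal.Quotient.liftₐ p φ fun a ha => hpφ ha
  have hr' : Set.range φ = Set.range ψ := by
    have : φ = ψ.comp (Ideal.Quotient.mkₐ κ p) := by
      ext a
      rfl
    conv_lhs => rw [this]
    rw [AlgHom.coe_comp, (Ideal.Quotient.mkₐ_surjective κ p).range_comp]
  have h3 := algRk_range_le_height_ker_add ψ₀ hψ₀ ψ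
  rw [hr, hr']
  refine h3.trans ?_
  gcongr
  by_contra! hlt
  refine hk ?_
  have h4 : HasGenChain (k + 1) (kerPt ψ) :=
    hasGenChain_iff_le_height.2 (by rw [Nat.cast_succ]; exact (ENat.add_one_le_iff (by simp)).2 hlt)
  exact h4.map (PrimeSpectrum.continuous_comap (Ideal.Quotient.mk p))
    (.of_injective (PrimeSpectrum.comap_injective_of_surjective _ Ideal.Quotient.mk_surjective))

end

/-! ### Relatively algebraically closed subfields -/

section AlgebraicClosure

variable (κ : Type*) [Field κ] {F : Type*} [Field F] [Algebra κ F]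

/-- The algebraic closure in `F` of the subfield generated by `s` over `κ`, as a field. -/
def algClField (s : Set F) : IntermediateField κ F where
  toSubalgebra := (Subalgebra.algebraicClosure (Algebra.adjoin κ s) F).restrictScalars κ
  inv_mem' _ hx := IsAlgebraic.inv hx

variable {κ}

theorem mem_algClField {s : Set F} {x : F} : x ∈ algClField κ s ↔ x ∈ algCl κ s :=
  mem_algCl.symm

theorem mem_algCl_of_pow_mem {s : Set F} {x : F} {n : ℕ} (hn : 0 < n) (h : x ^ n ∈ algCl κ s) :
    x ∈ algCl κ s :=
  mem_algCl.2 (IsAlgebraic.of_pow hn (mem_algCl.1 h))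

theorem mem_algCl_of_isIntegralElem {s : Set F} {A : Type*} [CommRing A] (ρ : A →+* F)
    (hρ : ∀ a, ρ a ∈ algCl κ s) {x : F} (hx : ρ.IsIntegralElem x) : x ∈ algCl κ s := by
  obtain ⟨f, hf, h⟩ := hx
  have h1 : IsAlgebraic (algClField κ s) x := by
    let ρ' : A →+* algClField κ s := ρ.codRestrict _ fun a => mem_algClField.2 (hρ a)
    refine ⟨f.map ρ', (hf.map ρ').ne_zero, ?_⟩
    rw [Polynomial.aeval_def, Polynomial.eval₂_map]
    exact h
  have h2 : x ∈ algCl κ (algCl κ s) := by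
    rw [mem_algCl]
    let i : algClField κ s →+* Algebra.adjoin κ (algCl κ s) :=
      (algClField κ s).val.toRingHom.codRestrict _ fun a =>
        Algebra.subset_adjoin (mem_algClField.1 a.2)
    obtain ⟨g, hg0, hg⟩ := h1
    refine ⟨g.map i, (Polynomial.map_ne_zero_iff i.injective).2 hg0, ?_⟩
    rw [Polynomial.aeval_def, Polynomial.eval₂_map]
    exact hg
  rwa [algCl_algCl] at h2

end AlgebraicClosure

theorem exists_isGenericPt_specializes {X : Scheme.{u}} (x : X) : ∃ y : X, IsGenericPt y ∧ y ⤳ x := by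
  have hirr := isIrreducible_irreducibleComponent (x := x)
  have hcl := hirr.closure_genericPoint isClosed_irreducibleComponent
  have hx : hirr.genericPoint ⤳ x := by
    rw [specializes_iff_mem_closure, hcl]
    exact mem_irreducibleComponent
  refine ⟨hirr.genericPoint, fun y hy => ?_, hx⟩
  have h1 : closure {y} = irreducibleComponent x := eq_irreducibleComponent
    isIrreducible_singleton.closure.2 (by
      rw [← hcl]
      exact closure_minimal (Set.singleton_subset_iff.2 hy.mem_closure) isClosed_closure)
  refine Specializes.antisymm hy ?_ |>.eq
  rw [specializes_iff_mem_closure, hcl, ← h1]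
  exact subset_closure rfl

/-! ### Local dimension of pfp schemes over a field -/

section DimAt

variable {p : ℕ} [Fact p.Prime] {κ : Type u} [Field κ] {F : Type u} [Field F] [Algebra κ F]

theorem exists_germ_residue_eq {Y : Scheme.{u}} {U : Y.Opens} (hU : IsAffineOpen U) {y : Y}
    (hy : y ∈ U) (c : Y.residueField y) : ∃ a b : Γ(Y, U),
      c = (Y.presheaf.germ U y hy ≫ Y.residue y).hom a / (Y.presheaf.germ U y hy ≫ Y.residue y).hom b := by
  obtain ⟨c, rfl⟩ := Y.residue_surjective y c
  let _ : Algebra Γ(Y, U) (Y.presheaf.stalk y) := (Y.presheaf.germ U y hy).hom.toAlgebra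
  have : IsLocalization.AtPrime (Y.presheaf.stalk y) (hU.primeIdealOf ⟨y, hy⟩).asIdeal :=
    hU.isLocalization_stalk ⟨y, hy⟩
  obtain ⟨⟨a, b⟩, h⟩ := IsLocalization.surj (hU.primeIdealOf ⟨y, hy⟩).asIdeal.primeCompl c
  refine ⟨a, b, ?_⟩
  have h1 : IsUnit ((Y.presheaf.germ U y hy).hom b) := IsLocalization.map_units (Y.presheaf.stalk y) b
  have h2 := (h1.map (Y.residue y).hom).ne_zero
  rw [CommRingCat.hom_comp, RingHom.comp_apply, RingHom.comp_apply, eq_div_iff h2]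
  exact ((Y.residue y).hom.map_mul c _).symm.trans (congrArg (Y.residue y).hom h)

/-- The chart data at a point of a scheme perfectly finitely presented over a field. -/
theorem IsPerfection.exists_chart {Y Y₀ : Scheme.{u}} {π : Y ⟶ Y₀} (hπ : IsPerfection p π)
    {s₀ : Y₀ ⟶ Spec (CommRingCat.of κ)} [LocallyOfFiniteType s₀] (y : Y)
    (β : Y.residueField y ⟶ CommRingCat.of F) (hβ : β.hom.IsIntegral)
    (hs : Spec.map β ≫ Y.fromSpecResidueField y ≫ π ≫ s₀ =
      Spec.map (CommRingCat.ofHom (algebraMap κ F))) {V : Y₀.Opens} (hV : IsAffineOpen V)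
    (hy : π y ∈ V) :
    ∃ (_ : Algebra κ Γ(Y₀, V)) (φ : Γ(Y₀, V) →ₐ[κ] F), Algebra.FiniteType κ Γ(Y₀, V) ∧
      algRk κ (Set.range φ) = algRk κ (Set.univ : Set F) ∧ hV.fromSpec (kerPt φ) = π y := by
  have := hπ.affine
  have hU : IsAffineOpen (π ⁻¹ᵁ V) := hV.preimage π
  let φB : Γ(Y, π ⁻¹ᵁ V) ⟶ CommRingCat.of F :=
    Y.presheaf.germ (π ⁻¹ᵁ V) y hy ≫ Y.residue y ≫ β
  let φA : Γ(Y₀, V) ⟶ CommRingCat.of F := π.app V ≫ φB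
  let ρ : CommRingCat.of κ ⟶ Γ(Y₀, V) := Spec.preimage (hV.fromSpec ≫ s₀)
  have hρ : Spec.map ρ = hV.fromSpec ≫ s₀ := Spec.map_preimage _
  have h1 : Spec.map φB ≫ hU.fromSpec = Spec.map β ≫ Y.fromSpecResidueField y := by
    rw [Scheme.fromSpecResidueField, ← hU.fromSpecStalk_eq_fromSpecStalk hy]
    have h0 : hU.fromSpecStalk hy = Spec.map (Y.presheaf.germ _ y hy) ≫ hU.fromSpec := rfl
    rw [h0]
    simp only [φB, Spec.map_comp, Category.assoc]
  have h2 : Spec.map φA ≫ hV.fromSpec = Spec.map β ≫ Y.fromSpecResidueField y ≫ π := by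
    simp only [φA, Spec.map_comp, Category.assoc]
    rw [Scheme.Hom.app_eq_appLE, IsAffineOpen.SpecMap_appLE_fromSpec π hV hU, ← Category.assoc, h1,
      Category.assoc]
  have h3 : ρ ≫ φA = CommRingCat.ofHom (algebraMap κ F) := by
    apply Spec.map_injective
    rw [Spec.map_comp, hρ, ← Category.assoc, h2, ← hs]
    simp only [Category.assoc]
  let _ : Algebra κ Γ(Y₀, V) := ρ.hom.toAlgebra
  let φ : Γ(Y₀, V) →ₐ[κ] F :=
    { φA.hom with commutes' := fun r => congrArg (fun q => q.hom r) h3 }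
  refine ⟨inferInstance, φ, ?_, ?_, ?_⟩
  · have : LocallyOfFiniteType (Spec.map ρ) := by rw [hρ]; infer_instance
    exact (HasRingHomProperty.Spec_iff (P := @LocallyOfFiniteType)).1 this
  · refine algRk_eq ((Set.subset_univ _).trans ?_) ?_
    · exact subset_algCl _
    · intro x _
      refine mem_algCl_of_isIntegralElem β.hom (fun c => ?_) (hβ x)
      obtain ⟨a, b, rfl⟩ := exists_germ_residue_eq hU hy c
      have hB (b : Γ(Y, π ⁻¹ᵁ V)) : φB.hom b ∈ algClField κ (Set.range φ) := by
        have := hπ.perfectClosure V hV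
        obtain ⟨n, a, ha⟩ := IsPRadical.pow_mem (π.app V).hom p b
        refine mem_algClField.2 (mem_algCl_of_pow_mem (pow_pos (Fact.out : p.Prime).pos n)
          (subset_algCl _ ⟨a, ?_⟩))
        rw [← map_pow, ← ha]
        rfl
      rw [map_div₀, ← mem_algClField]
      exact div_mem (hB a) (hB b)
  · have h4 : kerPt φ = PrimeSpectrum.comap φA.hom ⊥ := by
      ext a
      rfl
    rw [h4]
    have h5 := congrArg (fun q => q (⊥ : PrimeSpectrum F)) h2
    refine h5.trans ?_
    change π (Y.fromSpecResidueField y _) = _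
    rw [Scheme.fromSpecResidueField_apply]

/-- The local dimension is height plus transcendence degree, in the form of two inequalities. Any
integral extension `F` of the residue field may compute the transcendence degree, so that one field
can serve for both ends of a morphism. -/
theorem dimAt_of_isPfp {Y : Scheme.{u}} {s : Y ⟶ Spec (CommRingCat.of κ)} (h : IsPfp p s) (y : Y)
    (β : Y.residueField y ⟶ CommRingCat.of F) (hβ : β.hom.IsIntegral)
    (hs : Spec.map β ≫ Y.fromSpecResidueField y ≫ s =
      Spec.map (CommRingCat.ofHom (algebraMap κ F))) (k : ℕ) :
    (HasGenChain k y → ((k + algRk κ (Set.univ : Set F) : ℕ∞) : WithBot ℕ∞) ≤ dimAt Y y) ∧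
    (¬ HasGenChain (k + 1) y →
      dimAt Y y ≤ ((k + algRk κ (Set.univ : Set F) : ℕ∞) : WithBot ℕ∞)) := by
  obtain ⟨Y₀, π, s₀, hπ, hs₀, -, -, rfl⟩ := h
  have := hπ.affine
  have hhom := hπ.isHomeomorph
  have hgen {V : Y₀.Opens} (hV : IsAffineOpen V) {z : Spec Γ(Y₀, V)} (hz : hV.fromSpec z = π y) (k) :
      HasGenChain k y ↔ HasGenChain k z := by
    constructor
    · intro hk
      have h1 := hk.map π.continuous (.of_injective hhom.injective)
      rw [← hz] at h1
      exact h1.of_map hV.fromSpec.isOpenEmbedding.generalizingMap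
    · intro hk
      have h1 := hk.map hV.fromSpec.continuous (.of_injective hV.fromSpec.isOpenEmbedding.injective)
      rw [hz] at h1
      exact h1.of_map hhom.isOpenEmbedding.generalizingMap
  constructor
  · intro hk
    refine le_iInf fun U => ?_
    obtain ⟨_, ⟨V, hV : IsAffineOpen V, rfl⟩, hyV, hVU⟩ :=
      Y₀.isBasis_affineOpens.exists_subset_of_mem_open
        (show π y ∈ π '' (U.1 : Set Y) from ⟨y, U.2, rfl⟩) (hhom.isOpenMap _ U.1.isOpen)
    obtain ⟨_, φ, hft, hrk, hpt⟩ := hπ.exists_chart y β hβ hs hV hyV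
    rw [← hrk]
    refine (add_algRk_le_ringKrullDim φ ((hgen hV hpt k).1 hk)).trans ?_
    rw [← PrimeSpectrum.topologicalKrullDim_eq_ringKrullDim]
    let j : PrimeSpectrum Γ(Y₀, V) → Y := fun z => hhom.homeomorph.symm (hV.fromSpec z)
    have hj : Topology.IsInducing j := hhom.homeomorph.symm.isInducing.comp
      hV.fromSpec.isOpenEmbedding.isInducing
    have hjU (z) : j z ∈ U.1 := by
      have h1 : hV.fromSpec z ∈ V := by
        rw [← SetLike.mem_coe, ← hV.range_fromSpec]
        exact ⟨z, rfl⟩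
      obtain ⟨u, hu, hu'⟩ := hVU h1
      have : j z = u := by
        change hhom.homeomorph.symm (hV.fromSpec z) = u
        rw [← hu']
        exact hhom.homeomorph.symm_apply_apply u
      rw [this]
      exact hu
    exact (hj.codRestrict hjU).topologicalKrullDim_le
  · intro hk
    obtain ⟨_, ⟨V, hV : IsAffineOpen V, rfl⟩, hyV, -⟩ :=
      Y₀.isBasis_affineOpens.exists_subset_of_mem_open (Set.mem_univ (π y)) isOpen_univ
    obtain ⟨_, φ, hft, hrk, hpt⟩ := hπ.exists_chart y β hβ hs hV hyV
    obtain ⟨g, hg, hdim⟩ := exists_ringKrullDim_away_le φ (k := k) fun h => hk ((hgen hV hpt _).2 h)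
    have hW : IsAffineOpen (Y₀.basicOpen g) := hV.basicOpen g
    have hyW : π y ∈ Y₀.basicOpen g := by
      have h1 : kerPt φ ∈ hV.fromSpec ⁻¹ᵁ Y₀.basicOpen g := by
        rw [hV.fromSpec_preimage_basicOpen]
        exact hg
      rw [← hpt]
      exact h1
    have := hV.isLocalization_basicOpen g
    rw [← hrk]
    refine le_trans ?_ (hdim Γ(Y₀, Y₀.basicOpen g))
    rw [← PrimeSpectrum.topologicalKrullDim_eq_ringKrullDim]
    refine (iInf_le _ ⟨π ⁻¹ᵁ Y₀.basicOpen g, hyW⟩).trans ?_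
    have h2 : Topology.IsInducing fun z : (π ⁻¹ᵁ Y₀.basicOpen g : Y.Opens) =>
        (⟨π z.1, z.2⟩ : Y₀.basicOpen g) :=
      .of_comp (by fun_prop) continuous_subtype_val
        (hhom.isOpenEmbedding.isInducing.comp .subtypeVal)
    exact ((Scheme.homeoOfIso hW.isoSpec).isInducing.comp h2).topologicalKrullDim_le

end DimAt

/-- The height of the image of a generic point under a morphism of constant relative dimension. -/
theorem HasRelDim.hasGenChain_iff {p : ℕ} [Fact p.Prime] {κ : Type u} [Field κ] {X Y : Scheme.{u}}
    {s : Y ⟶ Spec (CommRingCat.of κ)} {f : X ⟶ Y} {d : ℤ} (h : HasRelDim p s f d)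
    (hY : HasPerfectCharts p Y) (hn : HasNiceAffineSpaces Y) [LocallyQuasiFinite f] {x : X}
    (hx : IsGenericPt x) (k : ℕ) : HasGenChain k (f x) ↔ (k : ℤ) ≤ -d := by
  obtain ⟨A, V, v, hV, hsplit, h⟩ := h
  obtain ⟨U, j, a, t, -, ⟨u, hu⟩, hj⟩ := hsplit (f x)
  have hv0 : f x = v a (t u) := by
    rw [← hu, ← hj]
    rfl
  obtain ⟨B, Z, z, hZ, hcov, hrel⟩ := h a
  obtain ⟨w, hw1, hw2⟩ := Scheme.Pullback.exists_preimage_pullback x (t u) hv0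
  obtain ⟨b, ζ₀, rfl⟩ := hcov w
  -- A generic point of the étale chart still lies over `x`, because `x` has no proper
  -- generizations.
  obtain ⟨ζ, hζ, hζ0⟩ := exists_isGenericPt_specializes ζ₀
  have := (hZ b).2
  have hflat : Flat (v a) := (hV a).2.flat hY
  have hx' : pullback.fst f (v a) (z b ζ) = x := by
    refine hx _ ?_
    have h1 := (hζ0.map (z b).continuous).map (pullback.fst f (v a)).continuous
    rwa [show pullback.fst f (v a) (z b ζ₀) = x from hw1] at h1
  have hw := hζ.map (Flat.generalizingMap (z b))
  have h1 := isGenericInFiber_of_isPullback (IsPullback.of_hasPullback f (v a)) hw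
  have h2 := (hV a).2.hasGenChain_iff hY hn h1 k
  have h3 : v a (pullback.snd f (v a) (z b ζ)) = f x := by
    rw [← hx']
    exact (congrArg (fun q : pullback f (v a) ⟶ Y => q (z b ζ)) pullback.condition).symm
  rw [h3] at h2
  obtain ⟨X₀, Y₀, f₀, s₀, q, r, sq, hrs, hr, hs₀, hs₁, hdim⟩ := hrel b
  have hY₀ := hs₀.hasPerfectCharts
  have hrflat : Flat r := hr.flat hY₀
  have hqflat : Flat q := MorphismProperty.of_isPullback (P := @Flat.{u}) sq.flip hrflat
  have h4 := isGenericInFiber_of_isPullback sq hζ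
  have h5 := hr.hasGenChain_iff hY₀ (hasNiceAffineSpaces_of_isPfp hs₀) h4 k
  have h6 : r ((z b ≫ pullback.snd f (v a)) ζ) = f₀ (q ζ) := by
    rw [← Scheme.Hom.comp_apply, ← Scheme.Hom.comp_apply, sq.w]
  rw [h6] at h5
  have h7 : HasGenChain k (f x) ↔ HasGenChain k (f₀ (q ζ)) := h2.symm.trans h5
  rw [h7]
  -- The residue field of `q ζ` is finite over that of its image, so it computes the transcendence
  -- degree at both points.
  have hfin := finite_residueFieldMap_of_isPullback sq ζ
  have hgen : IsGenericPt (q ζ) := hζ.map (Flat.generalizingMap q)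
  let F : Type u := X₀.residueField (q ζ)
  let ρ : CommRingCat.of κ ⟶ X₀.residueField (q ζ) :=
    Spec.preimage (X₀.fromSpecResidueField (q ζ) ≫ f₀ ≫ s₀)
  have hρ : Spec.map ρ = X₀.fromSpecResidueField (q ζ) ≫ f₀ ≫ s₀ := Spec.map_preimage _
  let _ : Algebra κ F := ρ.hom.toAlgebra
  have hdX := dimAt_of_isPfp (F := F) hs₁ (q ζ) (𝟙 _)
    (RingHom.isIntegral_of_surjective _ Function.surjective_id)
    (by rw [Spec.map_id]; exact (Category.id_comp _).trans hρ.symm) 0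
  have hdY := dimAt_of_isPfp (F := F) hs₀ (f₀ (q ζ)) (f₀.residueFieldMap (q ζ)) hfin.to_isIntegral
    (by
      rw [← Category.assoc, Scheme.Hom.SpecMap_residueFieldMap_fromSpecResidueField, Category.assoc]
      exact hρ.symm)
  obtain ⟨da, db, ha, hb, hab⟩ := hdim (q ζ)
  -- `q ζ` is generic, of height zero, so the dimension of `X₀` there is the transcendence degree
  -- alone.
  have hrk : algRk κ (Set.univ : Set F) = da := by
    have h8 := hdX.1 trivial
    have h9 := hdX.2 (hgen.not_hasGenChain 0)
    rw [ha] at h8 h9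
    rw [Nat.cast_zero, zero_add] at h8 h9
    exact le_antisymm (WithBot.coe_le_coe.1 h8) (WithBot.coe_le_coe.1 h9)
  rw [hrk, hb] at hdY
  constructor
  · intro hk
    have h8 := (hdY k).1 hk
    have h9 : k + da ≤ db := by exact_mod_cast h8
    omega
  · intro hk
    by_contra hne
    obtain ⟨m, rfl⟩ : ∃ m, k = m + 1 := Nat.exists_eq_succ_of_ne_zero fun e => hne (e ▸ trivial)
    have h8 := (hdY m).2 hne
    have h9 : db ≤ m + da := by exact_mod_cast h8
    omega

/-! ### Smith normal form of square matrices -/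

section SmithForm

/-- The range of `J` has full rank, hence a basis `a i • b' i` with `b'` a basis of the whole space;
the preimages `c i` form a basis of the source. -/
theorem Matrix.exists_smith_form {R : Type*} [CommRing R] [IsDomain R] [IsPrincipalIdealRing R]
    {σ : Type*} [Fintype σ] [DecidableEq σ] (J : Matrix σ σ R) (hJ : J.det ≠ 0) :
    ∃ (U V : Matrix σ σ R) (a : σ → R), IsUnit U.det ∧ IsUnit V.det ∧
      J = U * Matrix.diagonal a * V := by
  have hinj : Function.Injective J.mulVecLin := Matrix.mulVec_injective_of_det_ne_zero hJ
  obtain ⟨b', a, ab', h⟩ := Submodule.exists_smith_normal_form_of_rank_eq (Pi.basisFun R σ)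
    (LinearMap.finrank_range_of_inj hinj)
  let c : Module.Basis σ R (σ → R) := ab'.map (LinearEquiv.ofInjective J.mulVecLin hinj).symm
  have hc (i : σ) : J.mulVec (c i) = a i • b' i := by
    rw [← h i]
    exact congrArg Subtype.val ((LinearEquiv.ofInjective J.mulVecLin hinj).apply_symm_apply (ab' i))
  have hunit (d : Module.Basis σ R (σ → R)) : IsUnit ((Pi.basisFun R σ).toMatrix d).det :=
    (Pi.basisFun R σ).isUnit_det d
  have h1 : J * (Pi.basisFun R σ).toMatrix c = (Pi.basisFun R σ).toMatrix b' * Matrix.diagonal a := by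
    ext i j
    rw [Matrix.mul_diagonal, Matrix.mul_apply]
    have := congrFun (hc j) i
    rw [Pi.smul_apply, smul_eq_mul, mul_comm] at this
    exact this
  refine ⟨(Pi.basisFun R σ).toMatrix b', ((Pi.basisFun R σ).toMatrix c)⁻¹, a, hunit b',
    Matrix.isUnit_nonsing_inv_det _ (hunit c), ?_⟩
  rw [← h1, Matrix.mul_nonsing_inv_cancel_right _ _ (hunit c)]

end SmithForm

/-! ### Witt vectors rational over a subfield modulo a power of `p` -/

section WittRat

variable (p : ℕ) [Fact p.Prime] {κ : Type*} [Field κ] {F : Type*} [Field F] [Algebra κ F]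

/-- The homomorphism of rings of Witt vectors attached to a subfield. -/
def wittIncl (L : IntermediateField κ F) : WittVector p L →+* WittVector p F :=
  WittVector.map (algebraMap L F)

theorem wittIncl_coeff (L : IntermediateField κ F) (l : WittVector p L) (k : ℕ) :
    (wittIncl p L l).coeff k = l.coeff k :=
  WittVector.map_coeff _ _ _

/-- The Witt vectors whose first `m` components lie in a subfield. -/
def wittRat (L : IntermediateField κ F) (m : ℕ) : Subring (WittVector p F) :=
  ((WittVector.truncate m).comp (wittIncl p L)).range.comap (WittVector.truncate m)

variable {p}

theorem truncate_eq_truncate_iff {R : Type*} [CommRing R] {m : ℕ} {x y : WittVector p R} :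
    WittVector.truncate m x = WittVector.truncate m y ↔ ∀ k < m, x.coeff k = y.coeff k := by
  constructor
  · intro h k hk
    simpa using congrArg (fun t => t.coeff ⟨k, hk⟩) h
  · intro h
    ext i
    simpa using h i i.2

theorem mem_wittRat {L : IntermediateField κ F} {m : ℕ} {u : WittVector p F} :
    u ∈ wittRat p L m ↔ ∀ k < m, u.coeff k ∈ L := by
  constructor
  · rintro ⟨l, hl⟩ k hk
    change WittVector.truncate m (wittIncl p L l) = _ at hl
    rw [← truncate_eq_truncate_iff.1 hl k hk, wittIncl_coeff]
    exact (l.coeff k).2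
  · intro h
    classical
    refine ⟨WittVector.mk p fun k => if hk : k < m then ⟨u.coeff k, h k hk⟩ else 0, ?_⟩
    refine (truncate_eq_truncate_iff (x := wittIncl p L _)).2 fun k hk => ?_
    rw [wittIncl_coeff, WittVector.coeff_mk, dif_pos hk]

theorem wittIncl_mem_wittRat {L : IntermediateField κ F} (m : ℕ) (l : WittVector p L) :
    wittIncl p L l ∈ wittRat p L m :=
  ⟨l, rfl⟩

theorem wittRat_anti (L : IntermediateField κ F) {m m' : ℕ} (h : m ≤ m') :
    wittRat p L m' ≤ wittRat p L m :=
  fun _ hu => mem_wittRat.2 fun k hk => mem_wittRat.1 hu k (hk.trans_le h)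

theorem wittRat_mono {L L' : IntermediateField κ F} (h : L ≤ L') (m : ℕ) :
    wittRat p L m ≤ wittRat p L' m :=
  fun _ hu => mem_wittRat.2 fun k hk => h (mem_wittRat.1 hu k hk)

theorem p_pow_dvd_iff {R : Type*} [CommRing R] [CharP R p] [PerfectRing R p] {m : ℕ}
    {u : WittVector p R} : (p : WittVector p R) ^ m ∣ u ↔ ∀ k < m, u.coeff k = 0 := by
  rw [← Ideal.mem_span_singleton]
  exact WittVector.mem_span_p_pow_iff_le_coeff_eq_zero u m

theorem mem_wittRat_of_dvd [CharP F p] [PerfectRing F p] (L : IntermediateField κ F) {m : ℕ} {u : WittVector p F}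
    (h : (p : WittVector p F) ^ m ∣ u) : u ∈ wittRat p L m :=
  mem_wittRat.2 fun k hk => by rw [p_pow_dvd_iff.1 h k hk]; exact zero_mem L

theorem exists_eq_add_of_mem_wittRat [CharP F p] [PerfectRing F p] {L : IntermediateField κ F} {m : ℕ} {u : WittVector p F}
    (h : u ∈ wittRat p L m) : ∃ (l : WittVector p L) (w : WittVector p F),
      u = wittIncl p L l + p ^ m * w := by
  obtain ⟨l, hl⟩ := h
  change WittVector.truncate m (wittIncl p L l) = _ at hl
  obtain ⟨w, hw⟩ := p_pow_dvd_iff.2 (WittVector.le_coeff_eq_iff_le_sub_coeff_eq_zero.1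
    (truncate_eq_truncate_iff.1 hl.symm))
  exact ⟨l, w, by rw [← hw]; exact (add_sub_cancel _ _).symm⟩

/-- In characteristic `p`, multiplication by `p ^ n` shifts the components by `n` places and raises
them to the power `p ^ n`. The hypothesis `hL` undoes these powers. -/
theorem pow_mul_mem_wittRat_iff [CharP F p] {L : IntermediateField κ F} (hL : ∀ x : F, x ^ p ∈ L → x ∈ L)
    {m n : ℕ} {u : WittVector p F} : (p : WittVector p F) ^ n * u ∈ wittRat p L (m + n) ↔
      u ∈ wittRat p L m := by
  have hL' (x : F) (n : ℕ) : x ^ p ^ n ∈ L → x ∈ L := by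
    induction n with
    | zero => simp
    | succ n ih =>
      intro h
      rw [pow_succ, pow_mul] at h
      exact ih (hL _ h)
  rw [mem_wittRat, mem_wittRat, mul_comm]
  constructor
  · intro h k hk
    have := h (k + n) (by omega)
    rw [WittVector.mul_pow_charP_coeff_succ] at this
    exact hL' _ _ this
  · intro h k hk
    rcases lt_or_ge k n with hkn | hkn
    · rw [WittVector.mul_pow_charP_coeff_zero _ hkn]
      exact zero_mem L
    · obtain ⟨j, rfl⟩ := Nat.exists_eq_add_of_le' hkn
      rw [WittVector.mul_pow_charP_coeff_succ]
      exact pow_mem (h j (by omega)) _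

instance algClField_charP [CharP F p] (s : Set F) : CharP (algClField κ s) p :=
  (RingHom.charP_iff _ (algebraMap (algClField κ s) F).injective p).2 inferInstance

theorem algClField_of_pow_mem (s : Set F) (x : F) (h : x ^ p ∈ algClField κ s) :
    x ∈ algClField κ s :=
  mem_algClField.2 (mem_algCl_of_pow_mem (Fact.out : p.Prime).pos (mem_algClField.1 h))

instance algClField_perfectRing [CharP F p] [PerfectRing F p] (s : Set F) : PerfectRing (algClField κ s) p :=
  PerfectRing.ofSurjective _ p fun x => by
    obtain ⟨y, hy⟩ := surjective_frobenius F p (x : F)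
    exact ⟨⟨y, algClField_of_pow_mem (p := p) s y (by rw [← frobenius_def, hy]; exact x.2)⟩, Subtype.ext hy⟩

theorem exists_eq_pow_mul_unit {R : Type*} [Field R] [CharP R p] [PerfectRing R p] {e : ℕ}
    {d : WittVector p R} (h0 : ∀ k < e, d.coeff k = 0) (h1 : d.coeff e ≠ 0) :
    ∃ v : (WittVector p R)ˣ, d = p ^ e * v := by
  obtain ⟨v, rfl⟩ := p_pow_dvd_iff.2 h0
  have hv : IsUnit v := WittVector.isUnit_of_coeff_zero_ne_zero v fun hv => by
    rw [mul_comm, ← zero_add e, zero_add e] at h1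
    have := WittVector.mul_pow_charP_coeff_succ v (m := 0) (n := e)
    rw [zero_add] at this
    exact h1 (by rw [this, hv, zero_pow (pow_ne_zero _ (Fact.out : p.Prime).ne_zero)])
  exact ⟨hv.unit, rfl⟩

/-- `d` is `p ^ e` times a unit with components in the subfield. Dividing by it costs `e`
components. -/
theorem mem_wittRat_of_mul_mem [CharP F p] [PerfectRing F p] {s : Set F} {m e : ℕ} {d : WittVector p (algClField κ s)}
    (h0 : ∀ k < e, d.coeff k = 0) (h1 : d.coeff e ≠ 0) {u : WittVector p F}
    (h : wittIncl p (algClField κ s) d * u ∈ wittRat p (algClField κ s) (m + e)) :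
    u ∈ wittRat p (algClField κ s) m := by
  obtain ⟨v, rfl⟩ := exists_eq_pow_mul_unit h0 h1
  have h2 := mul_mem (wittIncl_mem_wittRat (m + e) (↑v⁻¹ : WittVector p (algClField κ s))) h
  rw [← mul_assoc, ← map_mul, mul_comm (p ^ e : WittVector p (algClField κ s)), ← mul_assoc,
    Units.inv_mul, one_mul, map_pow, map_natCast] at h2
  exact (pow_mul_mem_wittRat_iff (algClField_of_pow_mem s)).1 h2

end WittRat

/-! ### Transcendence degrees of Witt components under maps with a Jacobian -/

section WittJacobian

variable {p : ℕ} [Fact p.Prime] {κ : Type*} [Field κ] {F : Type*} [Field F] [Algebra κ F]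
  {σ : Type*}

/-- The first `m` components of the entries of a vector of Witt vectors. -/
def wittDigits (x : σ → WittVector p F) (m : ℕ) : Set F :=
  {c | ∃ i, ∃ k < m, (x i).coeff k = c}

theorem wittDigits_subset_iff {x : σ → WittVector p F} {m : ℕ} {s : Set F} :
    wittDigits x m ⊆ algCl κ s ↔ ∀ i, x i ∈ wittRat p (algClField κ s) m := by
  simp only [mem_wittRat, mem_algClField]
  exact ⟨fun h i k hk => h ⟨i, k, hk, rfl⟩, fun h c ⟨i, k, hk, hc⟩ => hc ▸ h i k hk⟩

theorem algClField_le {s t : Set F} (h : s ⊆ algCl κ t) : algClField κ s ≤ algClField κ t :=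
  fun _ hx => mem_algClField.2 (algCl_subset_algCl h (mem_algClField.1 hx))

theorem map_mem_wittRat {L L' : IntermediateField κ F} (hL : L ≤ L') (m : ℕ)
    (A : Matrix σ σ (WittVector p L)) (i j : σ) : A.map (wittIncl p L) i j ∈ wittRat p L' m :=
  wittRat_mono hL m (wittIncl_mem_wittRat m (A i j))

theorem exists_eq_add_smul [CharP F p] [PerfectRing F p] {L : IntermediateField κ F} {m : ℕ} {x : σ → WittVector p F}
    (hx : ∀ i, x i ∈ wittRat p L m) : ∃ (z : σ → WittVector p L) (h : σ → WittVector p F),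
      x = (fun i => wittIncl p L (z i)) + (p : WittVector p F) ^ m • h := by
  choose z h hzh using fun i => exists_eq_add_of_mem_wittRat (hx i)
  exact ⟨z, h, funext hzh⟩

variable [Fintype σ]

theorem mulVec_mem_wittRat {L : IntermediateField κ F} {m : ℕ} {A : Matrix σ σ (WittVector p F)}
    (hA : ∀ i j, A i j ∈ wittRat p L m) {h : σ → WittVector p F} (hh : ∀ i, h i ∈ wittRat p L m)
    (i : σ) : (A.mulVec h) i ∈ wittRat p L m :=
  sum_mem fun j _ => mul_mem (hA i j) (hh j)

variable [DecidableEq σ]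

theorem mulVec_mem_wittRat_iff {L L' : IntermediateField κ F} (hL : L ≤ L') (m : ℕ)
    {A : Matrix σ σ (WittVector p L)} (hA : IsUnit A.det) (h : σ → WittVector p F) :
    (∀ i, ((A.map (wittIncl p L)).mulVec h) i ∈ wittRat p L' m) ↔ ∀ i, h i ∈ wittRat p L' m := by
  refine ⟨fun h1 => ?_, fun h1 => mulVec_mem_wittRat (map_mem_wittRat hL m A) h1⟩
  have h2 := mulVec_mem_wittRat (map_mem_wittRat hL m A⁻¹) h1
  rwa [Matrix.mulVec_mulVec, ← Matrix.map_mul, Matrix.nonsing_inv_mul _ hA,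
    Matrix.map_one _ (map_zero _) (map_one _), Matrix.one_mulVec] at h2

variable [CharP F p] [PerfectRing F p]

/-- Multiplying by the adjugate replaces the matrix by its determinant, of valuation `e`. -/
theorem mem_wittRat_of_mulVec_mem {s : Set F} {t e : ℕ}
    {A : Matrix σ σ (WittVector p (algClField κ s))}
    (h0 : ∀ k < e, A.det.coeff k = 0) (h1 : A.det.coeff e ≠ 0) {h : σ → WittVector p F}
    (hh : ∀ i, ((A.map (wittIncl p (algClField κ s))).mulVec h) i ∈
      wittRat p (algClField κ s) (t + e)) (i : σ) : h i ∈ wittRat p (algClField κ s) t := by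
  refine mem_wittRat_of_mul_mem h0 h1 ?_
  have h2 := mulVec_mem_wittRat (map_mem_wittRat le_rfl (t + e) A.adjugate) hh i
  rwa [Matrix.mulVec_mulVec, ← Matrix.map_mul, Matrix.adjugate_mul, ← RingHom.mapMatrix_apply,
    Matrix.smul_one_eq_diagonal, RingHom.mapMatrix_apply, Matrix.diagonal_map (map_zero _),
    Matrix.mulVec_diagonal] at h2

theorem algRk_union_range_le (s : Set F) {ι : Type*} [Fintype ι] (c : ι → F) :
    algRk κ (s ∪ Set.range c) ≤ algRk κ s + Fintype.card ι := by
  refine (Matroid.eRk_union_le_eRk_add_eRk _ _ _).trans (add_le_add_right ?_ _)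
  refine (algRk_le_encard _).trans ?_
  rw [← Set.image_univ]
  refine (Set.encard_image_le _ _).trans ?_
  rw [Set.encard_univ, ENat.card_eq_coe_fintype_card]

/-- By `hh` the first `e` components of `h` contribute the largest possible rank over `s`. In the
Smith form the two invertible matrices do not affect rationality, and the diagonal entry of
valuation `α i` leaves only the first `e - α i` components of the `i`-th entry visible modulo `p ^
e`. As `∑ α i = e`, exactly `e` components disappear. -/
theorem algRk_union_wittDigits_mulVec {s : Set F} {e : ℕ}
    {A : Matrix σ σ (WittVector p (algClField κ s))}
    (h0 : ∀ k < e, A.det.coeff k = 0) (h1 : A.det.coeff e ≠ 0) {h : σ → WittVector p F}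
    (hh : algRk κ (s ∪ wittDigits h e) = algRk κ s + (Fintype.card σ * e : ℕ)) :
    algRk κ (s ∪ wittDigits ((A.map (wittIncl p (algClField κ s))).mulVec h) e) + e =
      algRk κ s + (Fintype.card σ * e : ℕ) := by
  have hdet : A.det ≠ 0 := fun h => h1 (by rw [h, WittVector.zero_coeff])
  obtain ⟨U, V, a, hU, hV, rfl⟩ := A.exists_smith_form hdet
  have ha (i : σ) : a i ≠ 0 := fun hi => hdet (by
    rw [Matrix.det_mul, Matrix.det_mul, Matrix.det_diagonal, Finset.prod_eq_zero (Finset.mem_univ i) hi,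
      mul_zero, zero_mul])
  choose α v hα using fun i => WittVector.exists_eq_pow_p_mul' (a i) (ha i)
  -- Compare the valuations of the determinants in the Smith form.
  have hsum : ∑ i, α i = e := by
    obtain ⟨v', hv'⟩ := exists_eq_pow_mul_unit h0 h1
    have h2 : Associated ((p : WittVector p (algClField κ s)) ^ e) (p ^ ∑ i, α i) := by
      have h3 : Associated (p ^ e : WittVector p (algClField κ s))
        (U * Matrix.diagonal a * V).det := ⟨v', hv'.symm⟩
      refine h3.trans ?_
      rw [Matrix.det_mul, Matrix.det_mul, Matrix.det_diagonal]
      refine (associated_mul_unit_left _ _ hV).trans ((associated_unit_mul_left _ _ hU).trans ?_)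
      rw [← Finset.prod_pow_eq_pow_sum]
      exact Associated.prod _ _ _ fun i _ => Associated.symm ⟨v i, (hα i).symm⟩
    have hp := WittVector.irreducible (p := p) (k := algClField κ s)
    exact le_antisymm ((pow_dvd_pow_iff hp.ne_zero hp.not_isUnit).1 h2.dvd')
      ((pow_dvd_pow_iff hp.ne_zero hp.not_isUnit).1 h2.dvd)
  have hαe (i : σ) : α i ≤ e := hsum ▸ Finset.single_le_sum (fun _ _ => Nat.zero_le _) (Finset.mem_univ i)
  let ι := wittIncl p (algClField κ s)
  let h' := (V.map ι).mulVec h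
  have hAh : ((U * Matrix.diagonal a * V).map ι).mulVec h =
      (U.map ι).mulVec fun i => ι (a i) * h' i := by
    rw [Matrix.map_mul, Matrix.map_mul, Matrix.diagonal_map (map_zero _), ← Matrix.mulVec_mulVec,
      ← Matrix.mulVec_mulVec]
    congr 1
    ext1 i
    rw [Matrix.mulVec_diagonal]
  have hle {t : Set F} : algClField κ s ≤ algClField κ (s ∪ t) :=
    algClField_le (Set.subset_union_left.trans (subset_algCl _))
  have hsub {t : Set F} : s ⊆ algCl κ (s ∪ t) := Set.subset_union_left.trans (subset_algCl _)
  have hsub' {t : Set F} : t ⊆ algCl κ (s ∪ t) := Set.subset_union_right.trans (subset_algCl _)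
  have hh' : algRk κ (s ∪ wittDigits h' e) = algRk κ s + (Fintype.card σ * e : ℕ) := by
    rw [← hh]
    refine algRk_eq (Set.union_subset hsub ?_) (Set.union_subset hsub ?_)
    · exact wittDigits_subset_iff.2 ((mulVec_mem_wittRat_iff hle e hV h).2
        (wittDigits_subset_iff.1 hsub'))
    · exact wittDigits_subset_iff.2 ((mulVec_mem_wittRat_iff hle e hV h).1
        (wittDigits_subset_iff.1 hsub'))
  -- `T` lists the components that remain visible and `T'` the `e` components that are lost.
  let T : (Σ i, Fin (e - α i)) → F := fun q => (h' q.1).coeff q.2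
  let T' : (Σ i, Fin (α i)) → F := fun q => (h' q.1).coeff (e - α q.1 + q.2)
  have hiff (t : Set F) : wittDigits (((U * Matrix.diagonal a * V).map ι).mulVec h) e ⊆
      algCl κ (s ∪ t) ↔ Set.range T ⊆ algCl κ (s ∪ t) := by
    rw [wittDigits_subset_iff, hAh, mulVec_mem_wittRat_iff hle e hU]
    have h2 (i : σ) : ι (a i) * h' i ∈ wittRat p (algClField κ (s ∪ t)) e ↔
        h' i ∈ wittRat p (algClField κ (s ∪ t)) (e - α i) := by
      rw [← pow_mul_mem_wittRat_iff (algClField_of_pow_mem _) (n := α i) (u := h' i),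
        Nat.sub_add_cancel (hαe i), hα i, map_mul, map_pow, map_natCast]
      have h3 (c : WittVector p (algClField κ s)) : ι c ∈ wittRat p (algClField κ (s ∪ t)) e :=
        wittRat_mono hle _ (wittIncl_mem_wittRat _ _)
      constructor
      · intro h4
        have h5 := mul_mem (h3 (v i)⁻¹.1) h4
        rwa [mul_comm (_ ^ _), mul_assoc, ← mul_assoc, ← map_mul, Units.inv_mul, map_one,
          one_mul] at h5
      · intro h4
        rw [mul_comm (_ ^ _), mul_assoc]
        exact mul_mem (h3 (v i)) h4
    simp only [h2, mem_wittRat, mem_algClField]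
    constructor
    · rintro h3 _ ⟨⟨i, k⟩, rfl⟩
      exact h3 i k k.2
    · intro h3 i k hk
      exact h3 ⟨⟨i, k, hk⟩, rfl⟩
  have hT : algRk κ (s ∪ wittDigits (((U * Matrix.diagonal a * V).map ι).mulVec h) e) =
      algRk κ (s ∪ Set.range T) :=
    algRk_eq (Set.union_subset hsub ((hiff _).2 hsub')) (Set.union_subset hsub ((hiff _).1 hsub'))
  rw [hT]
  -- Counting `T` bounds the rank from above. Counting `T'` bounds it from below, since adding the
  -- `e` lost components restores the full rank of `h'`.
  have hcT := algRk_union_range_le (κ := κ) s T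
  have hcT' := algRk_union_range_le (κ := κ) (s ∪ Set.range T) T'
  have hsubT : s ∪ wittDigits h' e ⊆ s ∪ Set.range T ∪ Set.range T' := by
    rintro c (hc | ⟨i, k, hk, rfl⟩)
    · exact Or.inl (Or.inl hc)
    · rcases lt_or_ge k (e - α i) with hki | hki
      · exact Or.inl (Or.inr ⟨⟨i, k, hki⟩, rfl⟩)
      · refine Or.inr ⟨⟨i, k - (e - α i), by have := hαe i; omega⟩, ?_⟩
        exact congrArg (h' i).coeff (by simp only; omega)
  have h2 := hh' ▸ (algRk_mono (κ := κ) hsubT).trans hcT'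
  have h3 : Fintype.card (Σ i, Fin (e - α i)) + e = Fintype.card σ * e := by
    rw [Fintype.card_sigma]
    simp only [Fintype.card_fin]
    rw [← hsum, ← Finset.sum_add_distrib, hsum, Finset.sum_congr rfl fun i _ => Nat.sub_add_cancel (hαe i),
      Finset.sum_const, Finset.card_univ, smul_eq_mul]
  have h4 : Fintype.card (Σ i, Fin (α i)) = e := by
    rw [Fintype.card_sigma]
    simpa only [Fintype.card_fin] using hsum
  rw [h4] at h2
  refine le_antisymm ?_ h2
  rw [← h3, Nat.cast_add, ← add_assoc]
  exact add_le_add_left hcT _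

variable (p κ) in
/-- A map between spaces of vectors of Witt vectors that is defined over all subfields
containing `κ`, together with a Jacobian matrix for it. -/
structure HasWittJacobian (f : (σ → WittVector p F) → σ → WittVector p F)
    (J : (σ → WittVector p F) → Matrix σ σ (WittVector p F)) : Prop where
  taylor : ∀ (m : ℕ) (z h : σ → WittVector p F) (i : σ), (p : WittVector p F) ^ (2 * m) ∣
    f (z + (p : WittVector p F) ^ m • h) i - f z i - p ^ m * (J z).mulVec h i
  rat : ∀ (L : IntermediateField κ F) (z : σ → WittVector p L) (i : σ),
    ∃ l, f (fun i => wittIncl p L (z i)) i = wittIncl p L l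
  rat_jacobian : ∀ (L : IntermediateField κ F) (z : σ → WittVector p L),
    ∃ A : Matrix σ σ (WittVector p L), J (fun i => wittIncl p L (z i)) = A.map (wittIncl p L)
  det_congr : ∀ (m : ℕ) (z h : σ → WittVector p F), (p : WittVector p F) ^ m ∣
    (J (z + (p : WittVector p F) ^ m • h)).det - (J z).det

namespace HasWittJacobian

variable {f : (σ → WittVector p F) → σ → WittVector p F}
  {J : (σ → WittVector p F) → Matrix σ σ (WittVector p F)}

/-- Since `e < m`, a perturbation by `p ^ m • h` does not change the components of the determinant
up to the `e`-th. The valuation is therefore still `e` at the rational vector `z`. -/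
theorem exists_jacobian (H : HasWittJacobian p κ f J)
    {e m : ℕ} (hm : e < m) {L : IntermediateField κ F}
    {z : σ → WittVector p L} {h : σ → WittVector p F}
    (h0 : ∀ k < e, (J ((fun i => wittIncl p L (z i)) + (p : WittVector p F) ^ m • h)).det.coeff k = 0)
    (h1 : (J ((fun i => wittIncl p L (z i)) + (p : WittVector p F) ^ m • h)).det.coeff e ≠ 0) :
    ∃ A : Matrix σ σ (WittVector p L), J (fun i => wittIncl p L (z i)) = A.map (wittIncl p L) ∧
      (∀ k < e, A.det.coeff k = 0) ∧ A.det.coeff e ≠ 0 := by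
  obtain ⟨A, hA⟩ := H.rat_jacobian L z
  have h2 := WittVector.le_coeff_eq_iff_le_sub_coeff_eq_zero.2
    (p_pow_dvd_iff.1 (H.det_congr m (fun i => wittIncl p L (z i)) h))
  have h3 (k : ℕ) : (A.det.coeff k : F) = (J (fun i => wittIncl p L (z i))).det.coeff k := by
    rw [hA, ← wittIncl_coeff, RingHom.map_det]
    rfl
  refine ⟨A, hA, fun k hk => Subtype.ext ?_, fun h => h1 ?_⟩
  · rw [h3, ← h2 k (hk.trans hm), h0 k hk]
    rfl
  · rw [h2 e hm, ← h3, h]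
    rfl

theorem sub_sub_mem_wittRat (H : HasWittJacobian p κ f J)
    {L : IntermediateField κ F} {m t : ℕ} (ht : t ≤ 2 * m)
    (z h : σ → WittVector p F) (i : σ) :
    f (z + (p : WittVector p F) ^ m • h) i - f z i - p ^ m * (J z).mulVec h i ∈ wittRat p L t :=
  mem_wittRat_of_dvd L ((pow_dvd_pow _ ht).trans (H.taylor m z h i))

/-- Modulo `p ^ t` with `t ≤ 2 m`, the map `f` is affine on residue classes modulo `p ^ m`. -/
theorem apply_mem_wittRat_iff (H : HasWittJacobian p κ f J)
    {s s' : Set F} (hs : s ⊆ algCl κ s') {m t : ℕ} (ht : m + t ≤ 2 * m)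
    (z : σ → WittVector p (algClField κ s)) (h : σ → WittVector p F) (i : σ) :
    f ((fun i => wittIncl p (algClField κ s) (z i)) + (p : WittVector p F) ^ m • h) i ∈
        wittRat p (algClField κ s') (m + t) ↔
      (J fun i => wittIncl p (algClField κ s) (z i)).mulVec h i ∈
        wittRat p (algClField κ s') t := by
  rw [← pow_mul_mem_wittRat_iff (algClField_of_pow_mem _) (n := m) (m := t), add_comm t]
  have h1 := H.sub_sub_mem_wittRat (L := algClField κ s') ht
    (fun i => wittIncl p (algClField κ s) (z i)) h i
  obtain ⟨l, hl⟩ := H.rat _ z i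
  have h2 : f (fun i => wittIncl p (algClField κ s) (z i)) i ∈
      wittRat p (algClField κ s') (m + t) := by
    rw [hl]
    exact wittRat_mono (algClField_le hs) _ (wittIncl_mem_wittRat _ _)
  constructor
  · intro h3
    simpa using sub_mem (sub_mem h3 h2) h1
  · intro h3
    simpa using add_mem (add_mem h1 h3) h2

/-- Successive approximation. Once `x = z + p ^ m • h` with `z` rational, the rationality of `f x`
controls `J(z) h`, and solving this linear system loses `e` components. Each round yields one
further component of `x`, up to precision `M - e`. -/
theorem mem_wittRat_of_apply_mem (H : HasWittJacobian p κ f J)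
    {x : σ → WittVector p F} {s : Set F} {e M : ℕ}
    (h0 : ∀ k < e, (J x).det.coeff k = 0) (h1 : (J x).det.coeff e ≠ 0)
    (hx : ∀ i, x i ∈ wittRat p (algClField κ s) (e + 1))
    (hy : ∀ i, f x i ∈ wittRat p (algClField κ s) M) {m : ℕ} (hm : e + 1 ≤ m) (hmM : m + e ≤ M)
    (i : σ) : x i ∈ wittRat p (algClField κ s) m := by
  induction m, hm using Nat.le_induction generalizing i with
  | base => exact hx i
  | succ m hm ih =>
    obtain ⟨z, h, rfl⟩ := exists_eq_add_smul (ih (by omega))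
    obtain ⟨A, hA, hA0, hA1⟩ := H.exists_jacobian hm h0 h1
    refine add_mem (wittIncl_mem_wittRat _ _) ?_
    rw [Pi.smul_apply, smul_eq_mul, add_comm m,
      pow_mul_mem_wittRat_iff (algClField_of_pow_mem _)]
    -- One new component of `x` needs `e + 1` components of `J(z) h`. They are visible in `f x`
    -- because `m + (e + 1) ≤ 2 * m`.
    refine mem_wittRat_of_mulVec_mem (t := 1) hA0 hA1 (fun j => ?_) i
    rw [← hA]
    exact (H.apply_mem_wittRat_iff (subset_algCl s) (by omega) z h j).1
      (wittRat_anti _ (by omega) (hy j))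

/-- Set `m = M - e` and let `s` be the first `m` layers of `x`, which are algebraic over the first
`M` layers of `f x`. Relative to `s`, the layers of `x` up to `M` are the first `e` layers of `h`,
and those of `f x` are the first `e` layers of `J(z) h`; this leaves the linear problem. -/
theorem algRk_wittDigits (H : HasWittJacobian p κ f J)
    {x : σ → WittVector p F} {e : ℕ}
    (h0 : ∀ k < e, (J x).det.coeff k = 0) (h1 : (J x).det.coeff e ≠ 0) {c M₀ : ℕ}
    (hc : ∀ M ≥ M₀, c + algRk κ (wittDigits x M) = (Fintype.card σ * M : ℕ))
    {M₁ : ℕ} (hM₁ : wittDigits x (e + 1) ⊆ algCl κ (wittDigits (f x) M₁)) {M : ℕ}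
    (hM : M₀ + e ≤ M) (hM' : M₁ ≤ M) (hM'' : 2 * e + 1 ≤ M) :
    algRk κ (wittDigits (f x) M) + e = algRk κ (wittDigits x M) := by
  obtain ⟨m, rfl⟩ := Nat.exists_eq_add_of_le' (show e ≤ M by omega)
  have hmono : wittDigits (f x) M₁ ⊆ wittDigits (f x) (m + e) :=
    fun _ ⟨i, k, hk, hc⟩ => ⟨i, k, hk.trans_le hM', hc⟩
  have hx : wittDigits x m ⊆ algCl κ (wittDigits (f x) (m + e)) :=
    wittDigits_subset_iff.2 fun i => H.mem_wittRat_of_apply_mem h0 h1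
      (wittDigits_subset_iff.1 (hM₁.trans (algCl_mono hmono)))
      (wittDigits_subset_iff.1 (subset_algCl _)) (by omega) le_rfl i
  have hxx : wittDigits x m ⊆ algCl κ (wittDigits x (m + e)) :=
    fun _ ⟨i, k, hk, hc⟩ => subset_algCl _ ⟨i, k, by omega, hc⟩
  have hc1 := hc m (by omega)
  have hc2 := hc (m + e) (by omega)
  have hxs : ∀ i, x i ∈ wittRat p (algClField κ (wittDigits x m)) m :=
    wittDigits_subset_iff.1 (subset_algCl _)
  -- Abstracting `s` keeps the substitution `x = z + p ^ m • h` from altering the field over which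
  -- `z` is defined.
  generalize wittDigits x m = s at hx hxx hc1 hxs
  obtain ⟨z, h, hzh⟩ := exists_eq_add_smul hxs
  obtain ⟨A, hA, hA0, hA1⟩ := H.exists_jacobian (m := m) (by omega) (hzh ▸ h0) (hzh ▸ h1)
  have hsub {t : Set F} : s ⊆ algCl κ (s ∪ t) := Set.subset_union_left.trans (subset_algCl _)
  have hsub' {t : Set F} : t ⊆ algCl κ (s ∪ t) := Set.subset_union_right.trans (subset_algCl _)
  have hy (t : Set F) (ht : s ⊆ algCl κ t) : wittDigits (f x) (m + e) ⊆ algCl κ t ↔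
      wittDigits ((A.map (wittIncl p (algClField κ s))).mulVec h) e ⊆ algCl κ t := by
    rw [wittDigits_subset_iff, wittDigits_subset_iff, hzh, ← hA]
    exact forall_congr' fun i => H.apply_mem_wittRat_iff ht (by omega) z h i
  have hx' (t : Set F) (ht : s ⊆ algCl κ t) : wittDigits x (m + e) ⊆ algCl κ t ↔
      wittDigits h e ⊆ algCl κ t := by
    rw [wittDigits_subset_iff, wittDigits_subset_iff]
    refine forall_congr' fun i => ?_
    rw [← pow_mul_mem_wittRat_iff (algClField_of_pow_mem _) (n := m) (u := h i), add_comm e]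
    have h2 : wittIncl p (algClField κ s) (z i) ∈ wittRat p (algClField κ t) (m + e) :=
      wittRat_mono (algClField_le ht) _ (wittIncl_mem_wittRat _ _)
    rw [hzh]
    exact add_mem_cancel_left h2
  have hrx : algRk κ (wittDigits x (m + e)) = algRk κ (s ∪ wittDigits h e) :=
    algRk_eq ((hx' _ hsub).2 hsub') (Set.union_subset hxx ((hx' _ hxx).1 (subset_algCl _)))
  have hry : algRk κ (wittDigits (f x) (m + e)) =
      algRk κ (s ∪ wittDigits ((A.map (wittIncl p (algClField κ s))).mulVec h) e) :=
    algRk_eq ((hy _ hsub).2 hsub') (Set.union_subset hx ((hy _ hx).1 (subset_algCl _)))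
  -- The hypothesis `hc` at `m` and at `m + e`, after cancelling `c`, shows that the last `e` layers
  -- of `x` have maximal rank over `s`.
  have hrk : algRk κ (s ∪ wittDigits h e) = algRk κ s + (Fintype.card σ * e : ℕ) := by
    rw [← hrx]
    have : (c : ℕ∞) + algRk κ (wittDigits x (m + e)) = c + (algRk κ s + (Fintype.card σ * e : ℕ)) := by
      rw [hc2, ← add_assoc, hc1, mul_add, Nat.cast_add]
    exact ENat.add_right_injective_of_ne_top (ENat.natCast_ne_top c) this
  rw [hry, hrx, hrk]
  exact algRk_union_wittDigits_mulVec hA0 hA1 hrk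

end HasWittJacobian

end WittJacobian

/-! ### Constructible sets in affine spaces with arbitrarily many coordinates -/

section ConstructibleMvPolynomial

open MvPolynomial

theorem HasGenChain.of_mapC_of_finite {R : Type*} [CommRing R] [IsNoetherianRing R] {σ : Type*}
    [Finite σ] {P : PrimeSpectrum R} {k : ℕ} (h : HasGenChain k (P.mapC σ)) : HasGenChain k P := by
  rw [hasGenChain_iff_le_height] at h ⊢
  have : (P.mapC σ).asIdeal.LiesOver P.asIdeal :=
    ⟨congrArg PrimeSpectrum.asIdeal P.comap_C_mapC.symm⟩
  have h1 := Ideal.height_eq_height_add_of_liesOver_of_hasGoingDown P.asIdeal (P.mapC σ).asIdeal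
  have h2 : (P.mapC σ).asIdeal = P.asIdeal.map (algebraMap R _) := rfl
  have : Nontrivial (MvPolynomial σ R ⧸ P.asIdeal.map (algebraMap R (MvPolynomial σ R))) :=
    Ideal.Quotient.nontrivial_iff.2 (P.mapC σ).isPrime.ne_top
  rwa [h1, h2, Ideal.map_quotient_self, Ideal.height_bot, add_zero] at h

/-- The witnesses of a chain involve finitely many variables, which reduces to the finite case. -/
theorem HasGenChain.of_mapC {R : Type u} [CommRing R] [IsNoetherianRing R] {σ : Type v}
    {P : PrimeSpectrum R} {k : ℕ} (h : HasGenChain k (P.mapC σ)) : HasGenChain k P := by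
  classical
  obtain ⟨S, hS⟩ := h.exists_finset
  let s : Finset σ := S.biUnion vars
  have h1 := hS (rename (R := R) ((↑) : s → σ)).toRingHom fun f hf => by
    have : f ∈ supported R (s : Set σ) := mem_supported.2 fun x hx =>
      Finset.mem_coe.2 (Finset.mem_biUnion.2 ⟨f, hf, hx⟩)
    rw [supported_eq_range_rename] at this
    exact this
  refine HasGenChain.of_mapC_of_finite (σ := s) (P := P) ?_
  convert h1
  ext f
  rw [PrimeSpectrum.comap_asIdeal, Ideal.mem_comap, PrimeSpectrum.mem_mapC, PrimeSpectrum.mem_mapC]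
  constructor
  · intro h m
    change coeff m (rename _ f) ∈ _
    by_cases hm : ∃ u : s →₀ ℕ, u.mapDomain (↑) = m ∧ coeff u f ≠ 0
    · obtain ⟨u, rfl, -⟩ := hm
      rw [coeff_rename_mapDomain _ Subtype.val_injective]
      exact h u
    · push Not at hm
      rw [coeff_rename_eq_zero _ _ _ hm]
      exact zero_mem _
  · intro h m
    have := h (m.mapDomain (↑))
    change coeff _ (rename _ f) ∈ _ at this
    rwa [coeff_rename_mapDomain _ Subtype.val_injective] at this

variable {κ : Type u} [Field κ] {ι : Type v}

theorem exists_finset_of_isConstructible {C : Set (PrimeSpectrum (MvPolynomial ι κ))}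
    (hC : Topology.IsConstructible C) : ∃ s : Finset ι, ∀ y y' : PrimeSpectrum (MvPolynomial ι κ),
      (∀ f ∈ supported κ (s : Set ι), f ∈ y.asIdeal ↔ f ∈ y'.asIdeal) → (y ∈ C ↔ y' ∈ C) := by
  classical
  obtain ⟨S, rfl⟩ := PrimeSpectrum.exists_constructibleSetData_iff.2 hC
  refine ⟨S.biUnion fun D => D.f.vars ∪ Finset.univ.biUnion fun i => (D.g i).vars,
    fun y y' h => ?_⟩
  simp only [PrimeSpectrum.ConstructibleSetData.toSet, Set.mem_iUnion,
    PrimeSpectrum.BasicConstructibleSetData.toSet, Set.mem_sdiff, PrimeSpectrum.mem_zeroLocus,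
    Set.range_subset_iff, Set.singleton_subset_iff, SetLike.mem_coe]
  refine exists_congr fun D => exists_congr fun hD => and_congr (forall_congr' fun i => ?_)
    (not_congr ?_)
  · exact h _ (mem_supported.2 fun t ht => Finset.mem_coe.2 (Finset.mem_biUnion.2 ⟨D, hD,
      Finset.mem_union_right _ (Finset.mem_biUnion.2 ⟨i, Finset.mem_univ i, ht⟩)⟩))
  · exact h _ (mem_supported.2 fun t ht => Finset.mem_coe.2 (Finset.mem_biUnion.2 ⟨D, hD,
      Finset.mem_union_left _ ht⟩))

/-- The Nullstellensatz applies in the finitely many variables that describe one basic piece of the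
set; the other variables are set to zero. -/
theorem exists_kerPt_mem_of_isConstructible [IsAlgClosed κ]
    {C : Set (PrimeSpectrum (MvPolynomial ι κ))} (hC : Topology.IsConstructible C)
    (hne : C.Nonempty) : ∃ ψ : MvPolynomial ι κ →ₐ[κ] κ, kerPt ψ ∈ C := by
  classical
  obtain ⟨S, rfl⟩ := PrimeSpectrum.exists_constructibleSetData_iff.2 hC
  obtain ⟨y, hy⟩ := hne
  simp only [PrimeSpectrum.ConstructibleSetData.toSet, Set.mem_iUnion,
    PrimeSpectrum.BasicConstructibleSetData.toSet, Set.mem_sdiff, PrimeSpectrum.mem_zeroLocus,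
    Set.range_subset_iff, Set.singleton_subset_iff, SetLike.mem_coe] at hy ⊢
  obtain ⟨D, hD, hg, hf⟩ := hy
  let s : Finset ι := D.f.vars ∪ Finset.univ.biUnion fun i => (D.g i).vars
  have hs (q : MvPolynomial ι κ) (hq : q.vars ⊆ s) : ∃ q' : MvPolynomial s κ, rename (↑) q' = q := by
    have : q ∈ supported κ (s : Set ι) := mem_supported.2 (Finset.coe_subset.2 hq)
    rw [supported_eq_range_rename] at this
    exact this
  obtain ⟨f, hf'⟩ := hs D.f Finset.subset_union_left
  choose g hg' using fun i => hs (D.g i) ((Finset.subset_biUnion_of_mem (fun i => (D.g i).vars)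
    (Finset.mem_univ i)).trans Finset.subset_union_right)
  let I : Ideal (MvPolynomial s κ) := Ideal.span (Set.range g)
  have hI : f ∉ I.radical := by
    intro h
    rw [← hf'] at hf
    refine hf ?_
    have hle : I ≤ y.asIdeal.comap (rename (R := κ) ((↑) : s → ι)) := by
      rw [Ideal.span_le]
      rintro _ ⟨i, rfl⟩
      change rename _ (g i) ∈ y.asIdeal
      rw [hg']
      exact hg i
    exact Ideal.IsRadical.radical_le_iff (Ideal.IsPrime.isRadical inferInstance) |>.2 hle h
  rw [← vanishingIdeal_zeroLocus_eq_radical (K := κ), mem_vanishingIdeal_iff] at hI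
  push Not at hI
  obtain ⟨x, hx, hxf⟩ := hI
  let x' : ι → κ := fun i => if h : i ∈ s then x ⟨i, h⟩ else 0
  have hx' (q : MvPolynomial s κ) : aeval x' (rename (↑) q) = aeval x q := by
    rw [aeval_rename]
    congr 2
    ext i
    exact dif_pos i.2
  refine ⟨aeval x', D, hD, fun i => ?_, ?_⟩
  · change aeval (R := κ) x' (D.g i) = 0
    rw [← hg', hx']
    exact hx (g i) (Ideal.subset_span ⟨i, rfl⟩ : g i ∈ I)
  · change ¬ (aeval (R := κ) x' D.f = 0)
    rw [← hf', hx']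
    exact hxf

theorem exists_ringEquiv_mvPolynomial_compl (κ : Type*) [Field κ] {ι : Type*} (s : Finset ι) :
    ∃ e : MvPolynomial ((s : Set ι)ᶜ : Set ι) (MvPolynomial s κ) ≃+* MvPolynomial ι κ,
      ∀ q : MvPolynomial s κ, e (C q) = rename (↑) q := by
  classical
  let e : MvPolynomial ((s : Set ι)ᶜ : Set ι) (MvPolynomial s κ) ≃ₐ[κ] MvPolynomial ι κ :=
    (sumAlgEquiv κ _ _).symm.trans (renameEquiv κ
      ((Equiv.sumComm _ _).trans (Equiv.Set.sumCompl (s : Set ι))))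
  have h1 : (rename (R := κ) ((↑) : s → ι)).toRingHom = e.toRingEquiv.toRingHom.comp
      (algebraMap (MvPolynomial s κ) (MvPolynomial ((s : Set ι)ᶜ : Set ι) (MvPolynomial s κ))) := by
    refine MvPolynomial.ringHom_ext (fun r => ?_) fun t => ?_
    · simp [e, algebraMap_eq]
    · simp [e, algebraMap_eq]
      rfl
  exact ⟨e.toRingEquiv, fun q => (congrArg (fun f => f q) h1).symm⟩

/-- The height of a point that is generic in a constructible subset of an affine space. -/
theorem exists_finset_height_add_algRk {F : Type*} [Field F] [Algebra κ F]
    (φ : MvPolynomial ι κ →ₐ[κ] F) {D : Set (PrimeSpectrum (MvPolynomial ι κ))}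
    (hC : Topology.IsConstructible D) (hφ : kerPt φ ∈ D)
    (hgen : ∀ y ∈ D, y ⤳ kerPt φ → y = kerPt φ) :
    ∃ s₀ : Finset ι, ∀ s : Finset ι, s₀ ⊆ s →
      (kerPt φ).asIdeal.height + algRk κ ((fun i => φ (X i)) '' s) = s.card := by
  classical
  obtain ⟨s₀, hs₀⟩ := exists_finset_of_isConstructible hC
  refine ⟨s₀, fun s hs => ?_⟩
  obtain ⟨e, he⟩ := exists_ringEquiv_mvPolynomial_compl κ s
  let j : MvPolynomial s κ →ₐ[κ] MvPolynomial ι κ := rename (↑)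
  have hj : j.toRingHom = e.toRingHom.comp C := RingHom.ext fun q => (he q).symm
  have hflat : j.toRingHom.Flat := by
    rw [hj]
    exact RingHom.Flat.comp (RingHom.flat_algebraMap_iff.2 inferInstance) (.of_bijective e.bijective)
  let P : PrimeSpectrum (MvPolynomial s κ) := PrimeSpectrum.comap j.toRingHom (kerPt φ)
  have hP : P = PrimeSpectrum.comap C (PrimeSpectrum.comap e.toRingHom (kerPt φ)) := by
    change PrimeSpectrum.comap j.toRingHom (kerPt φ) = _
    rw [hj]
    rfl
  -- `y` is the extension of the prime that `kerPt φ` induces in the variables of `s`. It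
  -- specializes to `kerPt φ`, and it lies in `D` because `D` depends only on the variables of `s₀`.
  -- Genericity then makes them equal, so `kerPt φ` is extended from finitely many variables.
  let y := PrimeSpectrum.comap e.symm.toRingHom (P.mapC ((s : Set ι)ᶜ : Set ι))
  have hye : PrimeSpectrum.comap e.toRingHom y = P.mapC _ := by
    ext q
    change e.symm (e q) ∈ (P.mapC _).asIdeal ↔ _
    rw [e.symm_apply_apply]
  have hyφ : y ⤳ kerPt φ := by
    rw [← PrimeSpectrum.le_iff_specializes]
    intro q hq
    have h1 : e.symm q ∈ (P.mapC ((s : Set ι)ᶜ : Set ι)).asIdeal := hq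
    rw [hP] at h1
    have h2 := (PrimeSpectrum.le_iff_specializes _ _).2 (PrimeSpectrum.mapC_comap_C_specializes _) h1
    change e (e.symm q) ∈ (kerPt φ).asIdeal at h2
    rwa [e.apply_symm_apply] at h2
  have hyC : y ∈ D := by
    refine (hs₀ _ _ fun f hf => ?_).1 hφ
    obtain ⟨f, rfl⟩ : ∃ f' : MvPolynomial s κ, j f' = f := by
      have := supported_mono (R := κ) (Finset.coe_subset.2 hs) hf
      rw [supported_eq_range_rename] at this
      exact this
    have h3 : PrimeSpectrum.comap j.toRingHom y = P := by
      have : PrimeSpectrum.comap j.toRingHom y =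
          PrimeSpectrum.comap C (PrimeSpectrum.comap e.toRingHom y) := by
        rw [hj]
        rfl
      rw [this, hye, PrimeSpectrum.comap_C_mapC]
    exact (SetLike.ext_iff.1 (congrArg PrimeSpectrum.asIdeal h3) f).symm
  have hy := hgen y hyC hyφ
  have hheight : (kerPt φ).asIdeal.height = P.asIdeal.height := by
    refine le_antisymm ?_ (height_comap_le_of_generalizingMap _ hflat.generalizingMap_comap _)
    rw [← ENat.forall_natCast_le_iff_le]
    intro k hk
    rw [← hasGenChain_iff_le_height] at hk ⊢
    refine HasGenChain.of_mapC (σ := ((s : Set ι)ᶜ : Set ι)) ?_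
    rw [← hye, hy]
    exact hk.map (PrimeSpectrum.continuous_comap _) (.of_injective
      (PrimeSpectrum.comap_injective_of_surjective _ e.surjective))
  have h4 := height_ker_add_algRk (φ.comp j)
  rw [algRk_range_mvPolynomial, Nat.card_eq_fintype_card, Fintype.card_coe] at h4
  rw [hheight, ← h4]
  congr 2
  ext c
  constructor
  · rintro ⟨i, hi, rfl⟩
    exact ⟨⟨i, hi⟩, by simp [j]⟩
  · rintro ⟨i, rfl⟩
    exact ⟨i, i.2, by simp [j]⟩

end ConstructibleMvPolynomial

/-! ### Taylor expansion of polynomials -/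

section Taylor

open MvPolynomial

theorem MvPolynomial.sq_dvd_aeval_add_mul_sub {τ O A : Type*} [CommRing O] [CommRing A] [Algebra O A]
    [Fintype τ] (π : A) (z h : τ → A) (P : MvPolynomial τ O) :
    π ^ 2 ∣ aeval (z + π • h) P - aeval z P - π * ∑ k, aeval z (pderiv k P) * h k := by
  classical
  induction P using MvPolynomial.induction_on with
  | C a => simp
  | add P Q hP hQ =>
    convert dvd_add hP hQ using 1
    simp only [map_add, add_mul, Finset.sum_add_distrib]
    ring
  | mul_X P i hP =>
    have h1 : ∑ k, aeval z (pderiv k (P * X i)) * h k =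
        (∑ k, aeval z (pderiv k P) * h k) * z i + aeval z P * h i := by
      have h2 (k : τ) : aeval z (pderiv k (P * X i)) * h k =
          aeval z (pderiv k P) * h k * z i + if i = k then aeval z P * h i else 0 := by
        rw [Derivation.leibniz, pderiv_X, map_add, smul_eq_mul, smul_eq_mul, map_mul, map_mul, aeval_X]
        by_cases hik : i = k
        · subst hik
          simp
          ring
        · simp [hik]
          ring
      rw [Finset.sum_congr rfl fun k _ => h2 k, Finset.sum_add_distrib, Finset.sum_mul,
        Finset.sum_ite_eq]
      simp
    rw [h1, map_mul, map_mul, aeval_X, aeval_X]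
    obtain ⟨c, hc⟩ := hP
    refine ⟨c * (z i + π * h i) + (∑ k, aeval z (pderiv k P) * h k) * h i, ?_⟩
    rw [Pi.add_apply, Pi.smul_apply, smul_eq_mul]
    linear_combination (z i + π * h i) * hc

theorem MvPolynomial.dvd_aeval_add_mul_sub {τ O A : Type*} [CommRing O] [CommRing A] [Algebra O A]
    [Fintype τ] (π : A) (z h : τ → A) (P : MvPolynomial τ O) :
    π ∣ aeval (z + π • h) P - aeval z P := by
  have h1 := (dvd_pow_self π two_ne_zero).trans (sq_dvd_aeval_add_mul_sub π z h P)
  simpa using dvd_add h1 (Dvd.intro (∑ k, aeval z (pderiv k P) * h k) rfl)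

theorem Matrix.dvd_det_sub_det {R n : Type*} [CommRing R] [Fintype n] [DecidableEq n] (π : R)
    (A B : Matrix n n R) (h : ∀ i j, π ∣ A i j - B i j) : π ∣ A.det - B.det := by
  rw [← Ideal.mem_span_singleton, ← Ideal.Quotient.eq, RingHom.map_det, RingHom.map_det]
  congr 1
  ext i j
  exact Ideal.Quotient.eq.2 (Ideal.mem_span_singleton.2 (h i j))

end Taylor

/-! ### Coordinates of `W_O(R)` over `W(R)` -/

section RamWitt

variable (p : ℕ) [Fact p.Prime] (κ : Type u) [Field κ]
  (O : Type v) [CommRing O] [Algebra (WittVector p κ) O]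
  [Module.Free (WittVector p κ) O] [Module.Finite (WittVector p κ) O]

/-- The index set for the coordinates of `O` over `W(κ)`. -/
abbrev RamIndex : Type := Fin (Module.finrank (WittVector p κ) O)

variable {R S : Type*} [CommRing R] [Algebra κ R] [CommRing S] [Algebra κ S]

/-- The coordinates of an element of `W_O(R)` over `W(R)`. -/
def RamWitt.coord (j : RamIndex p κ O) : RamWitt p κ O R →ₗ[WittVector p κ] WittAlg p κ R :=
  Finsupp.lapply j ∘ₗ (TensorProduct.equivFinsuppOfBasisLeft (N := WittAlg p κ R)
    (Module.finBasis (WittVector p κ) O)).toLinearMap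

/-- The element of `W_O(R)` with given coordinates over `W(R)`. -/
def RamWitt.ofCoord (x : RamIndex p κ O → WittAlg p κ R) : RamWitt p κ O R :=
  ∑ j, Module.finBasis (WittVector p κ) O j ⊗ₜ[WittVector p κ] x j

theorem RamWitt.coord_tmul (j : RamIndex p κ O) (o : O) (w : WittAlg p κ R) :
    coord p κ O j (o ⊗ₜ w) = (Module.finBasis (WittVector p κ) O).repr o j • w :=
  TensorProduct.equivFinsuppOfBasisLeft_apply_tmul_apply _ _ _ _

theorem RamWitt.coord_ofCoord (x : RamIndex p κ O → WittAlg p κ R) (j : RamIndex p κ O) :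
    coord p κ O j (ofCoord p κ O x) = x j := by
  classical
  rw [ofCoord, map_sum, Finset.sum_eq_single j]
  · rw [coord_tmul, Module.Basis.repr_self, Finsupp.single_eq_same, one_smul]
  · intro l _ hl
    rw [coord_tmul, Module.Basis.repr_self, Finsupp.single_eq_of_ne hl.symm, zero_smul]
  · exact fun h => absurd (Finset.mem_univ j) h

theorem RamWitt.ext_coord {u v : RamWitt p κ O R} (h : ∀ j, coord p κ O j u = coord p κ O j v) :
    u = v :=
  (TensorProduct.equivFinsuppOfBasisLeft (N := WittAlg p κ R)
    (Module.finBasis (WittVector p κ) O)).injective (Finsupp.ext h)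

theorem RamWitt.ofCoord_coord (u : RamWitt p κ O R) :
    ofCoord p κ O (fun j => coord p κ O j u) = u :=
  ext_coord p κ O fun j => coord_ofCoord p κ O _ j

theorem RamWitt.coord_mul_tmul (j : RamIndex p κ O) (u : RamWitt p κ O R) (w : WittAlg p κ R) :
    coord p κ O j (u * (1 ⊗ₜ w)) = coord p κ O j u * w := by
  induction u using TensorProduct.induction_on with
  | zero => simp
  | tmul o v => rw [Algebra.TensorProduct.tmul_mul_tmul, coord_tmul, coord_tmul, mul_one,
      smul_mul_assoc]
  | add a b ha hb => rw [add_mul, map_add, map_add, add_mul, ha, hb]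

theorem RamWitt.coord_natCast_mul (j : RamIndex p κ O) (m : ℕ) (u : RamWitt p κ O R) :
    coord p κ O j ((m : RamWitt p κ O R) * u) = m * coord p κ O j u := by
  rw [← nsmul_eq_mul, map_nsmul, nsmul_eq_mul]

theorem RamWitt.dvd_coord (j : RamIndex p κ O) {m : ℕ} {u : RamWitt p κ O R}
    (h : (m : RamWitt p κ O R) ∣ u) : (m : WittAlg p κ R) ∣ coord p κ O j u := by
  obtain ⟨v, rfl⟩ := h
  exact ⟨_, coord_natCast_mul p κ O j m v⟩

theorem RamWitt.coord_map (φ : R →ₐ[κ] S) (j : RamIndex p κ O) (u : RamWitt p κ O R) :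
    coord p κ O j (RamWitt.map p κ O φ u) = WittAlg.map p κ φ (coord p κ O j u) := by
  induction u using TensorProduct.induction_on with
  | zero => simp
  | tmul o v =>
    rw [RamWitt.map, Algebra.TensorProduct.map_tmul, coord_tmul, coord_tmul, map_smul]
    rfl
  | add a b ha hb => simp only [map_add, ha, hb]

variable {τ : Type*}

/-- The vector over `W_O(R)` with given coordinates over `W(R)`. -/
def ramPoint (x : τ × RamIndex p κ O → WittAlg p κ R) (i : τ) : RamWitt p κ O R :=
  RamWitt.ofCoord p κ O fun j => x (i, j)

/-- The map between spaces of vectors over `W(R)` given by polynomials over `O`. -/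
def ramEval (P : τ → MvPolynomial τ O) (x : τ × RamIndex p κ O → WittAlg p κ R)
    (t : τ × RamIndex p κ O) : WittAlg p κ R :=
  RamWitt.coord p κ O t.2 (MvPolynomial.aeval (ramPoint p κ O x) (P t.1))

/-- The Jacobian matrix of `ramEval`. -/
def ramJacobian (P : τ → MvPolynomial τ O) (x : τ × RamIndex p κ O → WittAlg p κ R) :
    Matrix (τ × RamIndex p κ O) (τ × RamIndex p κ O) (WittAlg p κ R) :=
  Matrix.of fun t s => RamWitt.coord p κ O t.2
    (MvPolynomial.aeval (ramPoint p κ O x) (MvPolynomial.pderiv s.1 (P t.1)) *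
      (Module.finBasis (WittVector p κ) O s.2 ⊗ₜ 1))

theorem ramPoint_map (φ : R →ₐ[κ] S) (x : τ × RamIndex p κ O → WittAlg p κ R) (i : τ) :
    ramPoint p κ O (fun t => WittAlg.map p κ φ (x t)) i =
      RamWitt.map p κ O φ (ramPoint p κ O x i) :=
  RamWitt.ext_coord p κ O fun j => by
    rw [RamWitt.coord_map, ramPoint, ramPoint, RamWitt.coord_ofCoord, RamWitt.coord_ofCoord]

theorem aeval_ramPoint_map (φ : R →ₐ[κ] S) (x : τ × RamIndex p κ O → WittAlg p κ R)
    (P : MvPolynomial τ O) :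
    MvPolynomial.aeval (ramPoint p κ O fun t => WittAlg.map p κ φ (x t)) P =
      RamWitt.map p κ O φ (MvPolynomial.aeval (ramPoint p κ O x) P) := by
  rw [funext (ramPoint_map p κ O φ x)]
  exact (MvPolynomial.comp_aeval_apply _ (RamWitt.map p κ O φ) P).symm

theorem ramEval_map (P : τ → MvPolynomial τ O) (φ : R →ₐ[κ] S)
    (x : τ × RamIndex p κ O → WittAlg p κ R) (t : τ × RamIndex p κ O) :
    ramEval p κ O P (fun t => WittAlg.map p κ φ (x t)) t =
      WittAlg.map p κ φ (ramEval p κ O P x t) := by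
  rw [ramEval, aeval_ramPoint_map, RamWitt.coord_map]
  rfl

theorem ramJacobian_map (P : τ → MvPolynomial τ O) (φ : R →ₐ[κ] S)
    (x : τ × RamIndex p κ O → WittAlg p κ R) :
    ramJacobian p κ O P (fun t => WittAlg.map p κ φ (x t)) =
      (ramJacobian p κ O P x).map (WittAlg.map p κ φ) := by
  ext t s
  rw [ramJacobian, Matrix.map_apply, ramJacobian, Matrix.of_apply, Matrix.of_apply,
    aeval_ramPoint_map, ← RamWitt.coord_map, map_mul (RamWitt.map p κ O φ)]
  congr 2
  rw [RamWitt.map, Algebra.TensorProduct.map_tmul, map_one]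
  rfl

theorem ramPoint_add_smul (m : ℕ) (z h : τ × RamIndex p κ O → WittAlg p κ R) :
    ramPoint p κ O (z + (m : WittAlg p κ R) • h) =
      ramPoint p κ O z + (m : RamWitt p κ O R) • ramPoint p κ O h := by
  funext i
  refine RamWitt.ext_coord p κ O fun j => ?_
  rw [Pi.add_apply, Pi.smul_apply, smul_eq_mul, map_add, RamWitt.coord_natCast_mul, ramPoint,
    ramPoint, ramPoint, RamWitt.coord_ofCoord, RamWitt.coord_ofCoord, RamWitt.coord_ofCoord]
  rfl

theorem ramJacobian_mulVec [Fintype τ] (P : τ → MvPolynomial τ O) (x h : τ × RamIndex p κ O → WittAlg p κ R)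
    (t : τ × RamIndex p κ O) : (ramJacobian p κ O P x).mulVec h t =
      RamWitt.coord p κ O t.2 (∑ k, MvPolynomial.aeval (ramPoint p κ O x)
        (MvPolynomial.pderiv k (P t.1)) * ramPoint p κ O h k) := by
  rw [map_sum, Matrix.mulVec, dotProduct, Fintype.sum_prod_type]
  refine Finset.sum_congr rfl fun k _ => ?_
  rw [ramPoint, RamWitt.ofCoord, Finset.mul_sum, map_sum]
  refine Finset.sum_congr rfl fun l _ => ?_
  rw [ramJacobian, Matrix.of_apply, ← RamWitt.coord_mul_tmul, mul_assoc,
    Algebra.TensorProduct.tmul_mul_tmul, mul_one, one_mul]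

variable [Fintype τ] [DecidableEq τ] {F : Type*} [Field F] [Algebra κ F]

/-- The Taylor formula holds over `W_O(F)` and passes to coordinates because `p ^ m` is an integer.
Rationality over subfields is functoriality in the field. -/
theorem hasWittJacobian_ramEval (P : τ → MvPolynomial τ O) :
    HasWittJacobian p κ (F := F) (σ := τ × RamIndex p κ O) (ramEval p κ O (R := F) P)
      (ramJacobian p κ O (R := F) P) where
  taylor m z h t := by
    let z' : τ × RamIndex p κ O → WittAlg p κ F := z
    let h' : τ × RamIndex p κ O → WittAlg p κ F := h
    have h1 := MvPolynomial.sq_dvd_aeval_add_mul_sub ((p ^ m : ℕ) : RamWitt p κ O F)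
      (ramPoint p κ O z') (ramPoint p κ O h') (P t.1)
    rw [← ramPoint_add_smul, ← Nat.cast_pow] at h1
    have h2 := RamWitt.dvd_coord p κ O t.2 h1
    rw [map_sub, map_sub, RamWitt.coord_natCast_mul, ← ramJacobian_mulVec, ← pow_mul, mul_comm m,
      Nat.cast_pow, Nat.cast_pow] at h2
    exact h2
  rat L z t := ⟨_, ramEval_map p κ O P L.val z t⟩
  rat_jacobian L z := ⟨_, ramJacobian_map p κ O P L.val z⟩
  det_congr m z h := by
    let z' : τ × RamIndex p κ O → WittAlg p κ F := z
    let h' : τ × RamIndex p κ O → WittAlg p κ F := h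
    refine Matrix.dvd_det_sub_det _ _ _ fun t s => ?_
    have h1 := MvPolynomial.dvd_aeval_add_mul_sub ((p ^ m : ℕ) : RamWitt p κ O F)
      (ramPoint p κ O z') (ramPoint p κ O h') (MvPolynomial.pderiv s.1 (P t.1))
    have h2 := RamWitt.dvd_coord p κ O t.2
      (h1.mul_right (Module.finBasis (WittVector p κ) O s.2 ⊗ₜ 1))
    rw [← ramPoint_add_smul, sub_mul, map_sub, Nat.cast_pow] at h2
    exact h2

end RamWitt

/-! ### Valuations and norms in the ring of integers -/

section Ramification

theorem isAdicComplete_of_basis {R M ι : Type*} [CommRing R] [AddCommGroup M] [Module R M] [Fintype ι]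
    (I : Ideal R) [IsAdicComplete I R] (b : Module.Basis ι R M) : IsAdicComplete I M := by
  have h1 (n : ℕ) (i : ι) {x : M} (hx : x ∈ (I ^ n • ⊤ : Submodule R M)) :
      b.coord i x ∈ (I ^ n • ⊤ : Submodule R R) := by
    have := Submodule.mem_map_of_mem (f := b.coord i) hx
    rw [Submodule.map_smul''] at this
    exact Submodule.smul_mono le_rfl le_top this
  have h2 (n : ℕ) {x : M} (hx : ∀ i, b.coord i x ∈ (I ^ n • ⊤ : Submodule R R)) :
      x ∈ (I ^ n • ⊤ : Submodule R M) := by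
    rw [← b.sum_repr x]
    refine sum_mem fun i _ => Submodule.smul_mem_smul ?_ trivial
    simpa using hx i
  refine { haus' := fun x hx => ?_, prec' := fun f hf => ?_ }
  · refine b.ext_elem fun i => ?_
    rw [map_zero]
    refine IsHausdorff.haus (I := I) inferInstance _ fun n => ?_
    have := hx n
    rw [SModEq.zero] at this ⊢
    exact h1 n i this
  · have h3 (i : ι) := IsPrecomplete.prec (I := I) (M := R) inferInstance
      (f := fun n => b.coord i (f n)) fun {m n} hmn => by
        have := hf hmn
        rw [SModEq.sub_mem] at this ⊢
        rw [← map_sub]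
        exact h1 m i this
    choose L hL using h3
    refine ⟨∑ i, L i • b i, fun n => ?_⟩
    rw [SModEq.sub_mem]
    refine h2 n fun i => ?_
    have := hL i n
    rw [SModEq.sub_mem] at this
    rw [map_sub]
    convert this using 2
    rw [Module.Basis.coord_apply, b.repr_sum_self]

/-- Split off the largest power of the variable from an integral equation of `x`; the remaining
factor has an invertible constant term. -/
theorem IsIntegral.exists_pow_eq {k A : Type*} [Field k] [CommRing A] [Algebra k A] {x : A}
    (hx : IsIntegral k x) : ∃ (n : ℕ) (y : A), x ^ n = x ^ (n + 1) * y := by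
  obtain ⟨f, hf, h⟩ := hx
  obtain ⟨g, hfg, hg⟩ := Polynomial.exists_eq_pow_rootMultiplicity_mul_and_not_dvd f hf.ne_zero 0
  rw [map_zero, sub_zero] at hfg hg
  rw [Polynomial.X_dvd_iff] at hg
  refine ⟨f.rootMultiplicity 0, - (algebraMap k A (g.coeff 0)⁻¹ * Polynomial.aeval x g.divX), ?_⟩
  have h1 : x ^ f.rootMultiplicity 0 * (Polynomial.aeval x g) = 0 := by
    rw [← Polynomial.aeval_def, hfg, map_mul, map_pow, Polynomial.aeval_X] at h
    exact h
  rw [← g.divX_mul_X_add, map_add, map_mul, Polynomial.aeval_X, Polynomial.aeval_C] at h1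
  have h2 : algebraMap k A (g.coeff 0)⁻¹ * algebraMap k A (g.coeff 0) = 1 := by
    rw [← map_mul, inv_mul_cancel₀ hg, map_one]
  linear_combination algebraMap k A (g.coeff 0)⁻¹ * h1 - x ^ f.rootMultiplicity 0 * h2

/-- The element `x ^ n * y ^ n` is idempotent. If it is `0` then `x` is nilpotent, and if it is `1`
then `x` is a unit. -/
theorem isUnit_or_isUnit_one_sub {A : Type*} [CommRing A] (hA : ∀ e : A, e * e = e → e = 0 ∨ e = 1)
    {x : A} {n : ℕ} {y : A} (h : x ^ n = x ^ (n + 1) * y) : IsUnit x ∨ IsUnit (1 - x) := by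
  have h1 (j : ℕ) : x ^ n = x ^ (n + j) * y ^ j := by
    induction j with
    | zero => simp
    | succ j ih =>
      calc x ^ n = x ^ n * x ^ j * y ^ j := by rw [← pow_add]; exact ih
        _ = x ^ (n + (j + 1)) * y ^ (j + 1) := by rw [h]; ring
  rcases hA (x ^ n * y ^ n) (by
    calc x ^ n * y ^ n * (x ^ n * y ^ n) = (x ^ (n + n) * y ^ n) * y ^ n := by ring
      _ = _ := by rw [← h1 n]) with h0 | h0
  · right
    have h2 : x ^ n = 0 := by
      rw [h1 n, pow_add, mul_assoc, h0, mul_zero]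
    exact IsNilpotent.isUnit_one_sub ⟨n, h2⟩
  · left
    rcases n with _ | n
    · refine IsUnit.of_mul_eq_one y ?_
      simpa using h.symm
    · exact IsUnit.of_mul_eq_one (x ^ n * y ^ (n + 1)) (by rw [← h0]; ring)

variable (p : ℕ) [Fact p.Prime] (κ : Type u) [Field κ] [IsAlgClosed κ] [CharP κ p]
  (O : Type v) [CommRing O] [Algebra (WittVector p κ) O]

theorem exists_residue_hom [Module.Finite (WittVector p κ) O] (J : Ideal O) (hJ : (p : O) ∈ J) : ∃ ψ : κ →+* O ⧸ J,
    (∀ w : WittVector p κ, ψ (w.coeff 0) = Ideal.Quotient.mk J (algebraMap _ O w)) ∧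
      ψ.IsIntegral := by
  have h0 (a : WittVector p κ) (ha : a ∈ Ideal.span {(p : WittVector p κ)}) :
      (Ideal.Quotient.mk J).comp (algebraMap (WittVector p κ) O) a = 0 := by
    obtain ⟨c, rfl⟩ := Ideal.mem_span_singleton.1 ha
    rw [RingHom.comp_apply, map_mul, map_natCast]
    exact Ideal.Quotient.eq_zero_iff_mem.2 (Ideal.mul_mem_right _ _ hJ)
  let ψ : κ →+* O ⧸ J := (Ideal.Quotient.lift (Ideal.span {(p : WittVector p κ)})
    ((Ideal.Quotient.mk J).comp (algebraMap (WittVector p κ) O)) h0).comp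
    (WittVector.quotientPEquiv (p := p) (k := κ)).symm.toRingHom
  have hψ (w : WittVector p κ) : ψ (w.coeff 0) = Ideal.Quotient.mk J (algebraMap _ O w) := by
    have : (WittVector.quotientPEquiv (p := p) (k := κ)).symm (w.coeff 0) =
        Ideal.Quotient.mk (Ideal.span {(p : WittVector p κ)}) w :=
      (RingEquiv.symm_apply_eq _).2 (WittVector.quotientPEquiv_mk w).symm
    exact congrArg (Ideal.Quotient.lift (Ideal.span {(p : WittVector p κ)})
      ((Ideal.Quotient.mk J).comp (algebraMap (WittVector p κ) O)) h0) this
  refine ⟨ψ, hψ, fun x => ?_⟩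
  obtain ⟨x, rfl⟩ := Ideal.Quotient.mk_surjective x
  obtain ⟨f, hf, h⟩ := Algebra.IsIntegral.isIntegral (R := WittVector p κ) x
  refine ⟨f.map WittVector.constantCoeff, hf.map _, ?_⟩
  rw [Polynomial.eval₂_map]
  have : ψ.comp WittVector.constantCoeff =
      (Ideal.Quotient.mk J).comp (algebraMap (WittVector p κ) O) :=
    RingHom.ext hψ
  rw [this, ← Polynomial.hom_eval₂, h, map_zero]

/-- `O` is `p`-adically complete, so idempotents of `O ⧸ I` lift to the domain `O` and are trivial.
An algebra integral over the field `κ` with only trivial idempotents is local, and units lift from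
`O ⧸ I`. -/
theorem isLocalRing_of_finite_wittVector [IsDomain O]
    [Module.Free (WittVector p κ) O] [Module.Finite (WittVector p κ) O] : IsLocalRing O := by
  let I : Ideal O := (Ideal.span {(p : WittVector p κ)}).map (algebraMap _ O)
  have hpI : (p : O) ∈ I := by
    rw [← map_natCast (algebraMap (WittVector p κ) O)]
    exact Ideal.mem_map_of_mem _ (Ideal.mem_span_singleton_self _)
  have h1 := isAdicComplete_of_basis (Ideal.span {(p : WittVector p κ)})
    (Module.finBasis (WittVector p κ) O)
  have : IsAdicComplete I O :=
    { toIsHausdorff := IsHausdorff.map_algebraMap_iff.2 h1.toIsHausdorff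
      toIsPrecomplete := IsPrecomplete.map_algebraMap_iff.2 h1.toIsPrecomplete }
  have hH : HenselianRing O I := inferInstance
  have hidem (e : O ⧸ I) (he : e * e = e) : e = 0 ∨ e = 1 := by
    obtain ⟨a, rfl⟩ := Ideal.Quotient.mk_surjective e
    have ha : a ^ 2 - a ∈ I := by
      rw [← Ideal.Quotient.eq_zero_iff_mem, map_sub, map_pow, sq, he, sub_self]
    -- The derivative `2 * a - 1` is its own inverse modulo `I`, since its square differs from `1`
    -- by `4 * (a ^ 2 - a)`.
    obtain ⟨a', h2, h3⟩ := hH.is_henselian (Polynomial.X ^ 2 - Polynomial.X)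
      (by monicity!) a (by simpa using ha) (by
        refine IsUnit.of_mul_eq_one (Ideal.Quotient.mk I (2 * a - 1)) ?_
        rw [← map_mul, ← map_one (Ideal.Quotient.mk I), Ideal.Quotient.eq]
        have := I.mul_mem_left 4 ha
        convert this using 1
        simp
        ring)
    have h4 : a' * (a' - 1) = 0 := by
      have := h2.eq_zero
      simp at this
      linear_combination this
    have h5 : Ideal.Quotient.mk I a = Ideal.Quotient.mk I a' :=
      (Ideal.Quotient.eq.2 h3).symm
    rcases mul_eq_zero.1 h4 with h | h
    · left; rw [h5, h, map_zero]
    · right; rw [h5, sub_eq_zero.1 h, map_one]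
  have hunit (x : O) (hx : IsUnit (Ideal.Quotient.mk I x)) : IsUnit x := by
    obtain ⟨y, hy⟩ := hx.exists_right_inv
    obtain ⟨y, rfl⟩ := Ideal.Quotient.mk_surjective y
    rw [← map_mul, ← map_one (Ideal.Quotient.mk I), Ideal.Quotient.eq] at hy
    have := Ideal.mem_jacobson_bot.1 (hH.jac hy) 1
    rw [mul_one, sub_add_cancel] at this
    exact isUnit_of_mul_isUnit_left this
  obtain ⟨ψ, hψ, hint⟩ := exists_residue_hom p κ O I hpI
  refine IsLocalRing.of_isUnit_or_isUnit_one_sub_self fun x => ?_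
  let _ := ψ.toAlgebra
  obtain ⟨n, y, h⟩ := IsIntegral.exists_pow_eq (k := κ) (hint (Ideal.Quotient.mk I x))
  rcases isUnit_or_isUnit_one_sub hidem h with h | h
  · exact Or.inl (hunit x h)
  · rw [← map_one (Ideal.Quotient.mk I), ← map_sub] at h
    exact Or.inr (hunit _ h)

theorem not_isUnit_natCast_of_free [IsDomain O]
    [Module.Free (WittVector p κ) O] [Module.Finite (WittVector p κ) O] : ¬ IsUnit (p : O) := by
  intro h
  have h1 := h.map (Algebra.norm (WittVector p κ))
  rw [← map_natCast (algebraMap (WittVector p κ) O), Algebra.norm_algebraMap] at h1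
  exact (WittVector.irreducible (p := p) (k := κ)).not_isUnit ((isUnit_pow_iff Module.finrank_pos.ne').1 h1)

theorem exists_natCast_eq_pow_mul [IsDedekindDomain O]
    [Module.Free (WittVector p κ) O] [Module.Finite (WittVector p κ) O]
    {ϖ : O} (hϖ : Irreducible ϖ) :
    IsDiscreteValuationRing O ∧ ∃ (t : ℕ) (v : Oˣ), 0 < t ∧ (p : O) = ϖ ^ t * v := by
  have := isLocalRing_of_finite_wittVector p κ O
  have hp := not_isUnit_natCast_of_free p κ O
  have hp0 : (p : O) ≠ 0 := by
    rw [← map_natCast (algebraMap (WittVector p κ) O)]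
    exact fun h => (WittVector.p_nonzero p κ)
      (FaithfulSMul.algebraMap_injective (WittVector p κ) O (h.trans (map_zero _).symm))
  have hf : ¬ IsField O := fun h => hp (by
    obtain ⟨b, hb⟩ := h.mul_inv_cancel hp0
    exact IsUnit.of_mul_eq_one b hb)
  have hdvr : IsDiscreteValuationRing O := 
    ((IsDiscreteValuationRing.TFAE O hf).out 0 2).2 ‹_›
  obtain ⟨t, v, h⟩ := IsDiscreteValuationRing.associated_pow_irreducible hp0 hϖ
  refine ⟨hdvr, t, v⁻¹, Nat.pos_of_ne_zero ?_, by rw [← h, mul_assoc, Units.mul_inv, mul_one]⟩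
  rintro rfl
  rw [pow_zero] at h
  exact hp (IsUnit.of_mul_eq_one _ h)

/-- The residue field of `O` is integral over the algebraically closed field `κ`, hence equal to it.
-/
theorem exists_dvd_sub_algebraMap [IsDedekindDomain O]
    [Module.Free (WittVector p κ) O] [Module.Finite (WittVector p κ) O]
    {ϖ : O} (hϖ : Irreducible ϖ) (x : O) :
    ∃ w : WittVector p κ, ϖ ∣ x - algebraMap _ O w := by
  obtain ⟨hdvr, t, v, ht, hpt⟩ := exists_natCast_eq_pow_mul p κ O hϖ
  have hmax : (Ideal.span {ϖ}).IsPrime := (Ideal.span_singleton_prime hϖ.ne_zero).2 hϖ.prime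
  obtain ⟨ψ, hψ, hint⟩ := exists_residue_hom p κ O (Ideal.span {ϖ}) (by
    rw [hpt, Ideal.mem_span_singleton]
    exact (dvd_pow_self ϖ ht.ne').mul_right _)
  let _ := ψ.toAlgebra
  have : Algebra.IsIntegral κ (O ⧸ Ideal.span {ϖ}) := ⟨hint⟩
  obtain ⟨c, hc⟩ := (IsAlgClosed.algebraMap_bijective_of_isIntegral
    (k := κ) (K := O ⧸ Ideal.span {ϖ})).2 (Ideal.Quotient.mk _ x)
  obtain ⟨w, rfl⟩ := WittVector.constantCoeff_surjective p c
  refine ⟨w, ?_⟩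
  rw [← Ideal.mem_span_singleton, ← Ideal.Quotient.eq, ← hc]
  exact hψ w

/-- The powers of `ϖ` below `t` generate `O` modulo `p`, by repeated approximation modulo `ϖ`, and
Nakayama's lemma lifts this to `O`. -/
theorem finrank_le_of_natCast_eq [IsDedekindDomain O]
    [Module.Free (WittVector p κ) O] [Module.Finite (WittVector p κ) O]
    {ϖ : O} (hϖ : Irreducible ϖ) {t : ℕ} {v : Oˣ}
    (h : (p : O) = ϖ ^ t * v) : Module.finrank (WittVector p κ) O ≤ t := by
  let N : Submodule (WittVector p κ) O := Submodule.span _ (Set.range fun i : Fin t => ϖ ^ (i : ℕ))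
  have h1 (m : ℕ) (hm : m ≤ t) (x : O) : ∃ y ∈ N, ϖ ^ m ∣ x - y := by
    induction m with
    | zero => exact ⟨0, zero_mem _, by simp⟩
    | succ m ih =>
      obtain ⟨y, hy, c, hc⟩ := ih (by omega)
      obtain ⟨w, d, hd⟩ := exists_dvd_sub_algebraMap p κ O hϖ c
      refine ⟨y + w • ϖ ^ m, add_mem hy (N.smul_mem _ (Submodule.subset_span ⟨⟨m, hm⟩, rfl⟩)), d, ?_⟩
      rw [Algebra.smul_def]
      linear_combination hc + ϖ ^ m * hd
  have h2 : N = ⊤ := by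
    have : (⊤ : Submodule (WittVector p κ) O) ≤ N ⊔ Ideal.span {(p : WittVector p κ)} • ⊤ := by
      intro x _
      obtain ⟨y, hy, c, hc⟩ := h1 t le_rfl x
      refine Submodule.mem_sup.2 ⟨y, hy, x - y, ?_, by ring⟩
      have : x - y = (p : WittVector p κ) • (v⁻¹.1 * c) := by
        rw [Algebra.smul_def, map_natCast, h, hc, mul_assoc, ← mul_assoc v.1, Units.mul_inv, one_mul]
      rw [this]
      exact Submodule.smul_mem_smul (Ideal.mem_span_singleton_self _) trivial
    refine top_le_iff.1 (Submodule.le_of_le_smul_of_le_jacobson_bot Module.Finite.fg_top ?_ this)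
    exact IsAdicComplete.le_jacobson_bot _
  have h3 := finrank_range_le_card (R := WittVector p κ) fun i : Fin t => ϖ ^ (i : ℕ)
  rw [Set.finrank] at h3
  have h4 : Module.finrank (WittVector p κ) N = Module.finrank (WittVector p κ) O := by
    rw [h2, finrank_top]
  rw [← h4, ← Fintype.card_fin t]
  exact h3

theorem coeff_pow_mul_unit {k : Type*} [Field k] [CharP k p] (e : ℕ) (v : (WittVector p k)ˣ) :
    (∀ j < e, ((p : WittVector p k) ^ e * v).coeff j = 0) ∧
      ((p : WittVector p k) ^ e * v).coeff e ≠ 0 := by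
  rw [mul_comm]
  refine ⟨fun j hj => WittVector.mul_pow_charP_coeff_zero _ hj, ?_⟩
  have := WittVector.mul_pow_charP_coeff_succ v.1 (m := 0) (n := e)
  rw [zero_add] at this
  rw [this]
  exact pow_ne_zero _ (v.isUnit.map WittVector.constantCoeff).ne_zero

/-- The norm of `ϖ` is `p` times a unit, so the norm turns `ϖ`-adic into `p`-adic valuation. This
translates the hypothesis on the Jacobian over `O` into one over the Witt vectors. -/
theorem coeff_norm_of_emultiplicity [IsDedekindDomain O]
    [Module.Free (WittVector p κ) O] [Module.Finite (WittVector p κ) O]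
    {ϖ : O} (hϖ : Irreducible ϖ) {δ : O} {e : ℕ}
    (hδ : emultiplicity ϖ δ = e) :
    (∀ j < e, (Algebra.norm (WittVector p κ) δ).coeff j = 0) ∧
      (Algebra.norm (WittVector p κ) δ).coeff e ≠ 0 := by
  obtain ⟨hdvr, t, v, ht, hpt⟩ := exists_natCast_eq_pow_mul p κ O hϖ
  have hr := finrank_le_of_natCast_eq p κ O hϖ hpt
  obtain ⟨⟨δ', hδ'⟩, hnd⟩ := emultiplicity_eq_coe.1 hδ
  have hu : IsUnit δ' := by
    by_contra hu
    have h1 : δ' ∈ IsLocalRing.maximalIdeal O := hu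
    rw [(IsDiscreteValuationRing.irreducible_iff_uniformizer ϖ).1 hϖ, Ideal.mem_span_singleton] at h1
    obtain ⟨c, rfl⟩ := h1
    exact hnd ⟨c, by rw [hδ']; ring⟩
  have hN := congrArg (Algebra.norm (WittVector p κ)) hpt
  rw [← map_natCast (algebraMap (WittVector p κ) O), Algebra.norm_algebraMap, map_mul, map_pow] at hN
  have hϖ0 : Algebra.norm (WittVector p κ) ϖ ≠ 0 := fun h => by
    rw [h, zero_pow ht.ne', zero_mul] at hN
    exact pow_ne_zero _ (WittVector.p_nonzero p κ) hN
  obtain ⟨a, ε, ha⟩ := WittVector.exists_eq_pow_p_mul' _ hϖ0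
  have hirr := WittVector.irreducible (p := p) (k := κ)
  have h2 : Associated ((p : WittVector p κ) ^ Module.finrank (WittVector p κ) O) (p ^ (a * t)) := by
    rw [hN, ha, mul_pow, ← pow_mul, mul_assoc]
    exact Associated.symm ⟨ε ^ t * (v.map (Algebra.norm (WittVector p κ))), by
      rw [Units.val_mul, Units.val_pow_eq_pow_val]; rfl⟩
  have h3 : Module.finrank (WittVector p κ) O = a * t :=
    le_antisymm ((pow_dvd_pow_iff hirr.ne_zero hirr.not_isUnit).1 h2.dvd)
      ((pow_dvd_pow_iff hirr.ne_zero hirr.not_isUnit).1 h2.dvd')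
  -- The norm of `p` shows that the rank is `a * t`, while the rank is positive and at most `t`.
  have ha1 : a = 1 := by
    have h4 : 0 < Module.finrank (WittVector p κ) O := Module.finrank_pos
    rw [h3] at hr h4
    have h5 : a ≤ 1 := Nat.le_of_mul_le_mul_right (by rwa [one_mul]) ht
    have h6 : a ≠ 0 := by rintro rfl; simp at h4
    omega
  have h7 : Algebra.norm (WittVector p κ) δ =
      p ^ e * (ε ^ e * hu.unit.map (Algebra.norm (WittVector p κ)) : (WittVector p κ)ˣ) := by
    rw [hδ', map_mul, map_pow, ha, ha1, pow_one, mul_pow, mul_assoc, Units.val_mul,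
      Units.val_pow_eq_pow_val]
    rfl
  rw [h7]
  exact coeff_pow_mul_unit p e _

end Ramification

/-! ### Arcs over the base field -/

section RamWitt

variable (p : ℕ) [Fact p.Prime] (κ : Type u) [Field κ] (O : Type v) [CommRing O]
  [Algebra (WittVector p κ) O]

theorem algebraMap_ramWitt_surjective : Function.Surjective (algebraMap O (RamWitt p κ O κ)) := by
  intro u
  induction u using TensorProduct.induction_on with
  | zero => exact ⟨0, map_zero _⟩
  | tmul o w =>
    obtain ⟨c, rfl⟩ : ∃ c : WittVector p κ, algebraMap (WittVector p κ) (WittAlg p κ κ) c = w :=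
      ⟨w, WittVector.ext fun k => WittVector.map_coeff _ _ _⟩
    refine ⟨c • o, ?_⟩
    change (c • o) ⊗ₜ[WittVector p κ] (1 : WittAlg p κ κ) = _
    rw [TensorProduct.smul_tmul, Algebra.smul_def, mul_one]
  | add a b ha hb =>
    obtain ⟨a, rfl⟩ := ha
    obtain ⟨b, rfl⟩ := hb
    exact ⟨a + b, map_add _ _ _⟩

end RamWitt

/-! ### Witt coordinates of arcs with respect to arbitrary bases -/

section ArcCoordinates

variable (p : ℕ) [Fact p.Prime] (κ : Type u) [Field κ]
  (O : Type v) [CommRing O] [Algebra (WittVector p κ) O]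
  [Module.Free (WittVector p κ) O] [Module.Finite (WittVector p κ) O]
  {Ω : Type w} [AddCommGroup Ω] [Module O Ω] {τ τ' : Type*}
  {R S : Type*} [CommRing R] [Algebra κ R] [CommRing S] [Algebra κ S]

variable {O} in
theorem aeval_equivMvPolynomial [Fintype τ] [DecidableEq τ] {A : Type*} [CommRing A] [Algebra O A] (b : Module.Basis τ O Ω)
    (a : CoordRing O Ω →ₐ[O] A) (g : CoordRing O Ω) :
    MvPolynomial.aeval (fun i => a (SymmetricAlgebra.ι O _ (b.coord i)))
      (SymmetricAlgebra.equivMvPolynomial b.dualBasis g) = a g := by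
  have : (MvPolynomial.aeval (fun i => a (SymmetricAlgebra.ι O _ (b.coord i)))).comp
      (SymmetricAlgebra.equivMvPolynomial b.dualBasis).toAlgHom = a := by
    refine SymmetricAlgebra.algHom_ext (b.dualBasis.ext fun i => ?_)
    change MvPolynomial.aeval _ (SymmetricAlgebra.equivMvPolynomial b.dualBasis
      (SymmetricAlgebra.ι O _ (b.dualBasis i))) = a (SymmetricAlgebra.ι O _ (b.dualBasis i))
    rw [SymmetricAlgebra.equivMvPolynomial_ι_apply, MvPolynomial.aeval_X, b.coe_dualBasis]
  exact congrArg (fun q => q g) this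

/-- The coordinates over `W(R)` of a `W_O(R)`-point of `Ω`, with respect to a basis of `Ω`. -/
def wittCoord (b : Module.Basis τ O Ω) (a : CoordRing O Ω →ₐ[O] RamWitt p κ O R)
    (t : τ × RamIndex p κ O) : WittAlg p κ R :=
  RamWitt.coord p κ O t.2 (a (SymmetricAlgebra.ι O _ (b.coord t.1)))

theorem ramPoint_wittCoord (b : Module.Basis τ O Ω) (a : CoordRing O Ω →ₐ[O] RamWitt p κ O R) :
    ramPoint p κ O (wittCoord p κ O b a) = fun i => a (SymmetricAlgebra.ι O _ (b.coord i)) :=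
  funext fun i => RamWitt.ofCoord_coord p κ O (a (SymmetricAlgebra.ι O _ (b.coord i)))

theorem wittCoord_comp {n : ℕ} {Ξ : Type w'} [AddCommGroup Ξ] [Module O Ξ]
    (bΩ : Module.Basis (Fin n) O Ω) (bΞ : Module.Basis (Fin n) O Ξ)
    (f : CoordRing O Ξ →ₐ[O] CoordRing O Ω) (a : CoordRing O Ω →ₐ[O] RamWitt p κ O R) :
    wittCoord p κ O bΞ (a.comp f) =
      ramEval p κ O (component bΩ bΞ f) (wittCoord p κ O bΩ a) := by
  funext t
  rw [ramEval, ramPoint_wittCoord, component, aeval_equivMvPolynomial]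
  rfl

theorem wittCoord_map (b : Module.Basis τ O Ω) (φ : R →ₐ[κ] S)
    (a : CoordRing O Ω →ₐ[O] RamWitt p κ O R) :
    wittCoord p κ O b ((RamWitt.map p κ O φ).comp a) =
      fun t => WittAlg.map p κ φ (wittCoord p κ O b a t) :=
  funext fun _ => RamWitt.coord_map p κ O φ _ _

section BaseField

variable {F : Type*} [Field F] [Algebra κ F]

/-- Multiplication by `o` acts on coordinates through a matrix over `W(κ)`, whose components lie in
every subfield containing `κ`. -/
theorem coord_smul_mem_wittRat {L : IntermediateField κ F} {m : ℕ} {u : RamWitt p κ O F}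
    (hu : ∀ j, RamWitt.coord p κ O j u ∈ wittRat p L m) (o : O) (j : RamIndex p κ O) :
    RamWitt.coord p κ O j (o • u) ∈ wittRat p L m := by
  have h1 : o • u = ∑ l, (o * Module.finBasis (WittVector p κ) O l) ⊗ₜ[WittVector p κ]
      RamWitt.coord p κ O l u := by
    conv_lhs => rw [← RamWitt.ofCoord_coord p κ O u, RamWitt.ofCoord, Finset.smul_sum]
    exact Finset.sum_congr rfl fun l _ => TensorProduct.smul_tmul' _ _ _
  rw [h1, map_sum]
  refine sum_mem fun l _ => ?_
  rw [RamWitt.coord_tmul, Algebra.smul_def]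
  refine mul_mem ?_ (hu l)
  refine mem_wittRat.2 fun k _ => ?_
  have : WittVector.coeff (p := p) (algebraMap (WittVector p κ) (WittAlg p κ F)
      ((Module.finBasis (WittVector p κ) O).repr (o * Module.finBasis (WittVector p κ) O l) j)) k =
      algebraMap κ F (((Module.finBasis (WittVector p κ) O).repr
        (o * Module.finBasis (WittVector p κ) O l) j).coeff k) := WittVector.map_coeff _ _ _
  exact this ▸ L.algebraMap_mem _

theorem wittCoord_mem_wittRat [Fintype τ] [DecidableEq τ] (b : Module.Basis τ O Ω) (b' : Module.Basis τ' O Ω)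
    (a : CoordRing O Ω →ₐ[O] RamWitt p κ O F) {L : IntermediateField κ F} {m : ℕ}
    (h : ∀ t, wittCoord p κ O b a t ∈ wittRat p L m) (t : τ' × RamIndex p κ O) :
    wittCoord p κ O b' a t ∈ wittRat p L m := by
  rw [wittCoord, ← b.dualBasis.sum_repr (b'.coord t.1)]
  simp only [map_sum, map_smul]
  refine sum_mem fun i _ => coord_smul_mem_wittRat p κ O (fun j => ?_) _ _
  rw [b.coe_dualBasis]
  exact h (i, j)

/-- The subfield generated by the components of a `W_O(F)`-point does not depend on the basis. -/
theorem wittDigits_wittCoord_subset_iff [Fintype τ] [DecidableEq τ]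
    [Fintype τ'] [DecidableEq τ'] (b : Module.Basis τ O Ω) (b' : Module.Basis τ' O Ω)
    (a : CoordRing O Ω →ₐ[O] RamWitt p κ O F) (m : ℕ) (s : Set F) :
    wittDigits (p := p) (wittCoord p κ O b a) m ⊆ algCl κ s ↔
      wittDigits (p := p) (wittCoord p κ O b' a) m ⊆ algCl κ s := by
  exact wittDigits_subset_iff.trans <| Iff.trans
    ⟨wittCoord_mem_wittRat p κ O b b' a, wittCoord_mem_wittRat p κ O b' b a⟩
    wittDigits_subset_iff.symm

variable [CharP κ p] [Nontrivial O] [Module.Free O Ω] [Module.Finite O Ω]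

theorem wittDigits_wittCoord_arcHom (φ : ArcRing p κ O Ω →ₐ[κ] F) (m : ℕ) :
    wittDigits (p := p) (wittCoord p κ O (Module.finBasis O Ω) (arcHom p κ O φ)) m =
      (fun t => φ (ArcRing.of p κ O Ω (MvPolynomial.X t))) '' {t | t.2.2 < m} := by
  have h (t : ArcIndex p κ O Ω) : WittVector.coeff (p := p)
      (wittCoord p κ O (Module.finBasis O Ω) (arcHom p κ O φ) (t.1, t.2.1)) t.2.2 = φ (ArcRing.of p κ O Ω (MvPolynomial.X t)) := by
    rw [← arcCoord_arcHom, arcCoord, wittCoord, (Module.finBasis O Ω).coe_dualBasis]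
    rfl
  ext c
  constructor
  · rintro ⟨⟨i, j⟩, k, hk, rfl⟩
    exact ⟨(i, j, k), hk, (h (i, j, k)).symm⟩
  · rintro ⟨t, ht, rfl⟩
    exact ⟨(t.1, t.2.1), t.2.2, ht, h t⟩

end BaseField

section ArcLift

theorem RamWitt.map_comp {T : Type*} [CommRing T] [Algebra κ T] (φ : R →ₐ[κ] S) (ψ : S →ₐ[κ] T)
    (u : RamWitt p κ O R) :
    RamWitt.map p κ O (ψ.comp φ) u = RamWitt.map p κ O ψ (RamWitt.map p κ O φ u) := by
  refine RamWitt.ext_coord p κ O fun j => ?_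
  rw [RamWitt.coord_map, RamWitt.coord_map, RamWitt.coord_map]
  exact WittVector.ext fun k => rfl

variable [CharP κ p] [Nontrivial O] [Module.Free O Ω] [Module.Finite O Ω]

theorem arcHom_comp (φ : ArcRing p κ O Ω →ₐ[κ] R) (ψ : R →ₐ[κ] S) :
    arcHom p κ O (ψ.comp φ) = (RamWitt.map p κ O ψ).comp (arcHom p κ O φ) :=
  AlgHom.ext fun _ => RamWitt.map_comp p κ O φ ψ _

theorem arcHom_arcLift [CharP R p] [PerfectRing R p] (a : CoordRing O Ω →ₐ[O] RamWitt p κ O R) :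
    arcHom p κ O (arcLift p κ O a) = a :=
  (Equiv.ofBijective _ (arcHom_bijective p κ O R)).apply_symm_apply a

theorem arcHom_comp_arcLift_comp {Ξ : Type*} [AddCommGroup Ξ] [Module O Ξ] [Module.Free O Ξ]
    [Module.Finite O Ξ] (f : CoordRing O Ξ →ₐ[O] CoordRing O Ω) (φ : ArcRing p κ O Ω →ₐ[κ] R) :
    arcHom p κ O (φ.comp (arcLift p κ O ((univArc p κ O Ω).comp f))) = (arcHom p κ O φ).comp f := by
  rw [arcHom_comp, arcHom_arcLift]
  rfl

/-- The components of the determinant of the Jacobian matrix at the universal arc. -/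
def univDet {n : ℕ} {Ξ : Type*} [AddCommGroup Ξ] [Module O Ξ] (bΩ : Module.Basis (Fin n) O Ω)
    (bΞ : Module.Basis (Fin n) O Ξ) (f : CoordRing O Ξ →ₐ[O] CoordRing O Ω) :
    WittAlg p κ (ArcRing p κ O Ω) :=
  (ramJacobian p κ O (component bΩ bΞ f) (wittCoord p κ O bΩ (univArc p κ O Ω))).det

theorem det_ramJacobian_arcHom {n : ℕ} {Ξ : Type*} [AddCommGroup Ξ] [Module O Ξ]
    (bΩ : Module.Basis (Fin n) O Ω) (bΞ : Module.Basis (Fin n) O Ξ)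
    (f : CoordRing O Ξ →ₐ[O] CoordRing O Ω) (φ : ArcRing p κ O Ω →ₐ[κ] R) (k : ℕ) :
    WittVector.coeff (p := p)
      (ramJacobian p κ O (component bΩ bΞ f) (wittCoord p κ O bΩ (arcHom p κ O φ))).det k =
      φ (WittVector.coeff (p := p) (univDet p κ O bΩ bΞ f) k) := by
  rw [arcHom, wittCoord_map, ramJacobian_map, ← AlgHom.mapMatrix_apply, ← AlgHom.map_det]
  exact WittVector.map_coeff _ _ _

end ArcLift

section RationalPoints

/-- At an `O`-rational point, the blocks of the matrix are multiplication matrices of the partial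
derivatives. They commute, so the determinant is the norm of the determinant over `O`. -/
theorem det_ramJacobian_algebraMap [Fintype τ] [DecidableEq τ]
    (P : τ → MvPolynomial τ O) (o : τ → O)
    (x : τ × RamIndex p κ O → WittAlg p κ R)
    (hx : ramPoint p κ O x = fun i => algebraMap O (RamWitt p κ O R) (o i)) :
    (ramJacobian p κ O P x).det = algebraMap (WittVector p κ) (WittAlg p κ R)
      (Algebra.norm (WittVector p κ)
        (Matrix.of fun i j => MvPolynomial.eval o (MvPolynomial.pderiv j (P i))).det) := by
  let b := Module.finBasis (WittVector p κ) O
  let M : Matrix τ τ O := Matrix.of fun i j => MvPolynomial.eval o (MvPolynomial.pderiv j (P i))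
  have h1 : ramJacobian p κ O P x = ((M.map (Algebra.leftMulMatrix b)).comp τ τ (RamIndex p κ O)
      (RamIndex p κ O) (WittVector p κ)).map (algebraMap (WittVector p κ) (WittAlg p κ R)) := by
    ext ⟨i, j⟩ ⟨k, l⟩
    rw [ramJacobian, Matrix.of_apply, hx, Matrix.map_apply, Matrix.comp_apply, Matrix.map_apply,
      Algebra.leftMulMatrix_eq_repr_mul]
    have h2 : MvPolynomial.aeval (fun i => algebraMap O (RamWitt p κ O R) (o i))
        (MvPolynomial.pderiv k (P i)) = M i k ⊗ₜ 1 := by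
      rw [show (fun i => algebraMap O (RamWitt p κ O R) (o i)) = algebraMap O (RamWitt p κ O R) ∘ o
        from rfl, MvPolynomial.aeval_algebraMap_apply]
      rfl
    rw [h2, Algebra.TensorProduct.tmul_mul_tmul, one_mul, RamWitt.coord_tmul, Algebra.smul_def,
      mul_one]
  rw [h1, ← RingHom.mapMatrix_apply, ← RingHom.map_det, Algebra.norm_eq_matrix_det b]
  congr 1
  exact (Matrix.det_det (f := (Algebra.leftMulMatrix b).toRingHom) (M := M)).symm

end RationalPoints

end ArcCoordinates

/-! ## Constructible subsets of arc spaces -/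

section Constructible

theorem IsHomeomorph.isConstructible_image {X Y : Type*} [TopologicalSpace X] [TopologicalSpace Y]
    {f : X → Y} (hf : IsHomeomorph f) {C : Set X} (hC : Topology.IsConstructible C) :
    Topology.IsConstructible (f '' C) :=
  hC.image_of_isOpenEmbedding hf.isOpenEmbedding (by
    rw [hf.surjective.range_eq]
    exact IsRetrocompact.univ)

/-- Chevalley's theorem; the perfection is surjective and does not change the image. -/
theorem IsPfp.isConstructible_range {p : ℕ} [Fact p.Prime] {X Y : Scheme.{u}} {f : X ⟶ Y}
    [CompactSpace Y] [QuasiSeparatedSpace Y] (h : IsPfp p f) :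
    Topology.IsConstructible (Set.range f) := by
  obtain ⟨X₀, π, f₀, hπ, _, _, _, rfl⟩ := h
  have h1 : Set.range (π ≫ f₀) = f₀ '' Set.univ := by
    rw [← hπ.isHomeomorph.surjective.range_eq]
    exact Set.range_comp f₀ π
  rw [h1]
  exact f₀.isConstructible_image .univ

theorem height_comap_of_isHomeomorph {A B : Type*} [CommRing A] [CommRing B] {i : A →+* B}
    (hi : IsHomeomorph (PrimeSpectrum.comap i)) (y : PrimeSpectrum B) :
    (PrimeSpectrum.comap i y).asIdeal.height = y.asIdeal.height := by
  refine ENat.forall_natCast_le_iff_le.1 (fun n hn => ?_) |>.antisymm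
    (ENat.forall_natCast_le_iff_le.1 fun n hn => ?_)
  · rw [← hasGenChain_iff_le_height] at hn ⊢
    exact hn.of_map hi.isOpenEmbedding.generalizingMap
  · rw [← hasGenChain_iff_le_height] at hn ⊢
    exact hn.map hi.continuous fun _ _ _ h => hi.injective h

end Constructible

/-! ### Rational and generic points of arc spaces -/

section ArcPoints

variable (p : ℕ) [Fact p.Prime] (κ : Type u) [Field κ] [CharP κ p]
  (O : Type v) [CommRing O] [Algebra (WittVector p κ) O]
  {Ω : Type w} [AddCommGroup Ω] [Module O Ω]

/-- The map from the polynomial ring in the Witt coordinates to its perfection. -/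
def ArcRing.ofAlgHom (Ω : Type w) [AddCommGroup Ω] [Module O Ω] :
    MvPolynomial (ArcIndex p κ O Ω) κ →ₐ[κ] ArcRing p κ O Ω :=
  { ArcRing.of p κ O Ω with commutes' := fun _ => rfl }

theorem ArcRing.isHomeomorph_comap (Ω : Type w) [AddCommGroup Ω] [Module O Ω] :
    IsHomeomorph (PrimeSpectrum.comap (ArcRing.of p κ O Ω)) :=
  IsPRadical.isHomeomorph_comap p _

theorem ArcRing.exists_comp_ofAlgHom_eq {R : Type*} [CommRing R] [Algebra κ R] [CharP R p]
    [PerfectRing R p] (ψ : MvPolynomial (ArcIndex p κ O Ω) κ →ₐ[κ] R) :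
    ∃ φ : ArcRing p κ O Ω →ₐ[κ] R, φ.comp (ArcRing.ofAlgHom p κ O Ω) = ψ := by
  let g : ArcRing p κ O Ω →+* R := PerfectClosure.lift (MvPolynomial (ArcIndex p κ O Ω) κ) p R ψ
  have hg : ∀ q, g (ArcRing.of p κ O Ω q) = ψ q := fun q =>
    congrArg (fun f : MvPolynomial (ArcIndex p κ O Ω) κ →+* R => f q)
      ((PerfectClosure.lift (MvPolynomial (ArcIndex p κ O Ω) κ) p R).symm_apply_apply _)
  exact ⟨{ g with commutes' := fun r => (hg (MvPolynomial.C r)).trans (ψ.commutes r) },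
    AlgHom.ext hg⟩

/-- A non-empty constructible subset of an arc space has a rational point. -/
theorem exists_kerPt_arcRing_mem_of_isConstructible [IsAlgClosed κ]
    {C : Set (PrimeSpectrum (ArcRing p κ O Ω))} (hC : Topology.IsConstructible C)
    (hne : C.Nonempty) : ∃ ψ : ArcRing p κ O Ω →ₐ[κ] κ, kerPt ψ ∈ C := by
  have hi := ArcRing.isHomeomorph_comap p κ O Ω
  obtain ⟨ψ, y, hy, h⟩ := exists_kerPt_mem_of_isConstructible (hi.isConstructible_image hC)
    (hne.image _)
  obtain ⟨φ, rfl⟩ := ArcRing.exists_comp_ofAlgHom_eq p κ O ψ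
  refine ⟨φ, ?_⟩
  have h1 : y = kerPt φ := hi.injective h
  rwa [h1] at hy

/-- The height of a point that is generic in a constructible subset of an arc space. -/
theorem exists_height_add_algRk_arcRing {F : Type*} [Field F] [Algebra κ F]
    (φ : ArcRing p κ O Ω →ₐ[κ] F) {C : Set (PrimeSpectrum (ArcRing p κ O Ω))}
    (hC : Topology.IsConstructible C) (hφ : kerPt φ ∈ C)
    (hgen : ∀ y ∈ C, y ⤳ kerPt φ → y = kerPt φ) :
    ∃ M₀ : ℕ, ∀ M ≥ M₀, (kerPt φ).asIdeal.height +
      algRk κ ((fun t => φ (ArcRing.of p κ O Ω (MvPolynomial.X t))) '' {t | t.2.2 < M}) =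
        (Module.finrank O Ω * Module.finrank (WittVector p κ) O * M : ℕ) := by
  classical
  have hi := ArcRing.isHomeomorph_comap p κ O Ω
  have hk : kerPt (φ.comp (ArcRing.ofAlgHom p κ O Ω)) =
    PrimeSpectrum.comap (ArcRing.of p κ O Ω) (kerPt φ) := rfl
  obtain ⟨s₀, hs₀⟩ := exists_finset_height_add_algRk (φ.comp (ArcRing.ofAlgHom p κ O Ω))
    (hi.isConstructible_image hC) ⟨_, hφ, rfl⟩ (by
      rintro _ ⟨y, hy, rfl⟩ h
      rw [hk] at h ⊢
      rw [hgen y hy (hi.isEmbedding.isInducing.specializes_iff.1 h)])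
  refine ⟨s₀.sup (fun t => t.2.2 + 1), fun M hM => ?_⟩
  have h := hs₀ (Finset.univ ×ˢ (Finset.univ ×ˢ Finset.range M)) fun t ht => by
    have := (Finset.le_sup (f := fun t : ArcIndex p κ O Ω => t.2.2 + 1) ht).trans hM
    simp only [Finset.mem_product, Finset.mem_univ, Finset.mem_range, true_and]
    exact this
  rw [hk, height_comap_of_isHomeomorph hi] at h
  have hs : {t : ArcIndex p κ O Ω | t.2.2 < M} = ((Finset.univ ×ˢ (Finset.univ ×ˢ Finset.range M) :
      Finset (ArcIndex p κ O Ω)) : Set (ArcIndex p κ O Ω)) := by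
    ext t
    simp
  rw [hs]
  refine h.trans ?_
  simp [mul_assoc]

section Rational

variable [Nontrivial O] [Module.Free (WittVector p κ) O] [Module.Finite (WittVector p κ) O]
  [Module.Free O Ω] [Module.Finite O Ω] [IsAlgClosed κ]

/-- The `κ`-point of the arc space attached to an element of `Ω`. -/
abbrev arcPointHom (x : Ω) : ArcRing p κ O Ω →ₐ[κ] κ :=
  arcLift p κ O ((Algebra.ofId O (RamWitt p κ O κ)).comp (evalAt x))

theorem exists_arcPointHom_eq (ψ : ArcRing p κ O Ω →ₐ[κ] κ) : ∃ x : Ω, arcPointHom p κ O x = ψ := by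
  let b := Module.finBasis O Ω
  choose c hc using fun i => algebraMap_ramWitt_surjective p κ O
    (arcHom p κ O ψ (SymmetricAlgebra.ι O _ (b.coord i)))
  refine ⟨b.equivFun.symm c, (arcHom_bijective p κ O κ).1 ?_⟩
  rw [arcHom_arcLift]
  refine SymmetricAlgebra.algHom_ext (b.dualBasis.ext fun i => ?_)
  change algebraMap O (RamWitt p κ O κ) (evalAt (b.equivFun.symm c)
    (SymmetricAlgebra.ι O _ (b.dualBasis i))) =
    arcHom p κ O ψ (SymmetricAlgebra.ι O _ (b.dualBasis i))
  rw [b.coe_dualBasis, ← hc, evalAt, SymmetricAlgebra.lift_ι_apply]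
  congr 1
  change b.coord i (b.equivFun.symm c) = _
  rw [Module.Basis.coord_apply, ← Module.Basis.equivFun_apply, LinearEquiv.apply_symm_apply]

theorem arcPointHom_univDet {n : ℕ} {Ξ : Type w'} [AddCommGroup Ξ] [Module O Ξ]
    (bΩ : Module.Basis (Fin n) O Ω) (bΞ : Module.Basis (Fin n) O Ξ)
    (f : CoordRing O Ξ →ₐ[O] CoordRing O Ω) (x : Ω) (k : ℕ) :
    arcPointHom p κ O x (WittVector.coeff (p := p) (univDet p κ O bΩ bΞ f) k) =
      (Algebra.norm (WittVector p κ) (jacobian bΩ bΞ f x).det).coeff k := by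
  rw [← det_ramJacobian_arcHom, arcHom_arcLift, det_ramJacobian_algebraMap p κ O _ (bΩ.repr x)]
  · exact WittVector.map_coeff _ _ _
  · rw [ramPoint_wittCoord]
    funext i
    change algebraMap O _ (evalAt x (SymmetricAlgebra.ι O _ (bΩ.coord i))) = _
    rw [evalAt, SymmetricAlgebra.lift_ι_apply]
    rfl

end Rational

end ArcPoints

/-! ### Lifting points along immersions -/

section Immersion

/-- Points of a reduced scheme with values in the range of an immersion. -/
theorem exists_lift_of_isImmersion {X Y T : Scheme.{u}} (i : X ⟶ Y) [IsImmersion i] [IsReduced T]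
    (t : T ⟶ Y) (ht : Set.range t ⊆ Set.range i) : ∃ s : T ⟶ X, s ≫ i = t := by
  have h1 : Surjective (pullback.snd i t) := ⟨fun z => by
    obtain ⟨x, hx⟩ := ht ⟨z, rfl⟩
    obtain ⟨w, -, hw⟩ := Scheme.Pullback.exists_preimage_pullback x z hx
    exact ⟨w, hw⟩⟩
  -- A surjective immersion is a closed immersion, and a surjective closed immersion into a reduced
  -- scheme is an isomorphism.
  have : IsClosedImmersion (pullback.snd i t) := .of_isPreimmersion _ (by
    rw [h1.surj.range_eq]
    exact isClosed_univ)
  have := isIso_of_isClosedImmersion_of_surjective (pullback.snd i t)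
  exact ⟨inv (pullback.snd i t) ≫ pullback.fst i t, by
    rw [Category.assoc, pullback.condition, IsIso.inv_hom_id_assoc]⟩

end Immersion

/-! ## The transcendence degrees of the coordinates of an arc and of its image -/

section Finitary

variable {κ : Type*} [Field κ] {F : Type*} [Field F] [Algebra κ F]

theorem exists_finset_mem_algCl {ι : Type*} {h : ι → F} {x : F} (hx : x ∈ algCl κ (Set.range h)) :
    ∃ s : Finset ι, x ∈ algCl κ (h '' s) := by
  obtain ⟨I, hI, hfin, -, hx⟩ := Matroid.exists_mem_finite_closure_of_mem_closure hx
  obtain ⟨t, -, ht, hx⟩ := Set.exists_subset_image_finite_and.1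
    (⟨I, by rwa [Set.image_univ], hfin, hx⟩ : ∃ t ⊆ h '' Set.univ, t.Finite ∧ x ∈ algCl κ t)
  exact ⟨ht.toFinset, by rwa [ht.coe_toFinset]⟩

theorem exists_nat_subset_algCl {ι : Type*} {h : ι → F} (d : ι → ℕ) {s : Set F} (hs : s.Finite)
    (hsub : s ⊆ algCl κ (Set.range h)) : ∃ m, s ⊆ algCl κ (h '' {t | d t < m}) := by
  have h1 : ∀ x ∈ s, ∃ m, x ∈ algCl κ (h '' {t | d t < m}) := fun x hx => by
    obtain ⟨u, hu⟩ := exists_finset_mem_algCl (hsub hx)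
    exact ⟨u.sup (fun t => d t + 1), algCl_mono (Set.image_mono fun t ht =>
      Finset.le_sup (f := fun t => d t + 1) ht) hu⟩
  choose! m hm using h1
  refine ⟨hs.toFinset.sup m, fun x hx => algCl_mono (Set.image_mono fun t (ht : d t < m x) =>
    ht.trans_le ?_) (hm x hx)⟩
  exact Finset.le_sup (f := m) (hs.mem_toFinset.2 hx)

end Finitary

section ArcRank

variable (p : ℕ) [Fact p.Prime] (κ : Type u) [Field κ] [CharP κ p]
  (O : Type v) [CommRing O] [Algebra (WittVector p κ) O]
  {Ω : Type w} [AddCommGroup Ω] [Module O Ω]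
  {F : Type*} [Field F] [Algebra κ F]

theorem range_arcRing_subset_algCl (φ : ArcRing p κ O Ω →ₐ[κ] F) :
    Set.range φ ⊆
      algCl κ (Set.range fun t => φ (ArcRing.of p κ O Ω (MvPolynomial.X t))) := by
  rintro _ ⟨a, rfl⟩
  obtain ⟨n, q, hq⟩ := IsPRadical.pow_mem (ArcRing.of p κ O Ω) p a
  refine mem_algCl_of_pow_mem (pow_pos (Fact.out : p.Prime).pos n) ?_
  rw [← map_pow, ← hq]
  have h : (φ.comp (ArcRing.ofAlgHom p κ O Ω)) q ∈
      Algebra.adjoin κ (Set.range fun t => φ (ArcRing.of p κ O Ω (MvPolynomial.X t))) := by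
    have h1 : q ∈ Algebra.adjoin κ (Set.range (MvPolynomial.X (R := κ) (σ := ArcIndex p κ O Ω))) := by
      rw [MvPolynomial.adjoin_range_X]
      trivial
    have h2 : (φ.comp (ArcRing.ofAlgHom p κ O Ω)) q ∈ (Algebra.adjoin κ (Set.range
        (MvPolynomial.X (R := κ)))).map (φ.comp (ArcRing.ofAlgHom p κ O Ω)) := ⟨q, h1, rfl⟩
    rw [AlgHom.map_adjoin, ← Set.range_comp] at h2
    exact h2
  exact algebra_adjoin_subset_algCl _ h

variable [Nontrivial O] [Module.Free (WittVector p κ) O] [Module.Finite (WittVector p κ) O]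
  [Module.Free O Ω] [Module.Finite O Ω]

theorem algCl_wittDigits_wittCoord {τ : Type*} [Fintype τ] [DecidableEq τ]
    (b : Module.Basis τ O Ω) (φ : ArcRing p κ O Ω →ₐ[κ] F) (m : ℕ) :
    algCl κ (wittDigits (p := p) (wittCoord p κ O b (arcHom p κ O φ)) m) = algCl κ
      ((fun t => φ (ArcRing.of p κ O Ω (MvPolynomial.X t))) '' {t | t.2.2 < m}) := by
  rw [← wittDigits_wittCoord_arcHom]
  exact (algCl_subset_algCl ((wittDigits_wittCoord_subset_iff p κ O b _ _ _ _).2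
    (subset_algCl _))).antisymm (algCl_subset_algCl
      ((wittDigits_wittCoord_subset_iff p κ O b _ _ _ _).1 (subset_algCl _)))

variable {Ξ : Type w'} [AddCommGroup Ξ] [Module O Ξ] [Module.Free O Ξ] [Module.Finite O Ξ]

/-- The height of a point of an arc space that is generic in a constructible subset, compared with
the height of its image when the Jacobian determinant has valuation `e` and the image is generic in
a constructible subset. -/
theorem height_kerPt_comp_arcLift [CharP F p] [PerfectRing F p] {n : ℕ}
    (bΩ : Module.Basis (Fin n) O Ω) (bΞ : Module.Basis (Fin n) O Ξ)
    (f : CoordRing O Ξ →ₐ[O] CoordRing O Ω) (φ : ArcRing p κ O Ω →ₐ[κ] F)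
    {φ' : ArcRing p κ O Ξ →ₐ[κ] F} (hφ' : φ' = φ.comp (arcLift p κ O ((univArc p κ O Ω).comp f)))
    {C : Set (PrimeSpectrum (ArcRing p κ O Ω))} (hC : Topology.IsConstructible C)
    (hφC : kerPt φ ∈ C) (hgenC : ∀ y ∈ C, y ⤳ kerPt φ → y = kerPt φ)
    {D : Set (PrimeSpectrum (ArcRing p κ O Ξ))} (hD : Topology.IsConstructible D)
    (hφD : kerPt φ' ∈ D) (hgenD : ∀ y ∈ D, y ⤳ kerPt φ' → y = kerPt φ')
    (hF : ∀ x : F, x ∈ algCl κ (Set.range φ')) {e : ℕ}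
    (h0 : ∀ k < e, φ (WittVector.coeff (p := p) (univDet p κ O bΩ bΞ f) k) = 0)
    (h1 : φ (WittVector.coeff (p := p) (univDet p κ O bΩ bΞ f) e) ≠ 0) {c c' : ℕ}
    (hc : (kerPt φ).asIdeal.height = c) (hc' : (kerPt φ').asIdeal.height = c') : c' = c + e := by
  have hnΩ : Module.finrank O Ω = n := by rw [Module.finrank_eq_card_basis bΩ, Fintype.card_fin]
  have hnΞ : Module.finrank O Ξ = n := by rw [Module.finrank_eq_card_basis bΞ, Fintype.card_fin]
  obtain ⟨M, hM⟩ := exists_height_add_algRk_arcRing p κ O φ hC hφC hgenC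
  obtain ⟨M', hM'⟩ := exists_height_add_algRk_arcRing p κ O φ' hD hφD hgenD
  let ξ := wittCoord p κ O bΩ (arcHom p κ O φ)
  let P := component bΩ bΞ f
  have hη : wittCoord p κ O bΞ (arcHom p κ O φ') = ramEval p κ O P ξ := by
    rw [hφ', arcHom_comp_arcLift_comp]
    exact wittCoord_comp p κ O bΩ bΞ f _
  have hrkξ (m) : algRk κ (wittDigits (p := p) ξ m) =
      algRk κ ((fun t => φ (ArcRing.of p κ O Ω (MvPolynomial.X t))) '' {t | t.2.2 < m}) := by
    rw [← algRk_algCl, algCl_wittDigits_wittCoord, algRk_algCl]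
  have hclη (m) : algCl κ (wittDigits (p := p) (ramEval p κ O P ξ) m) =
      algCl κ ((fun t => φ' (ArcRing.of p κ O Ξ (MvPolynomial.X t))) '' {t | t.2.2 < m}) := by
    rw [← hη]
    exact algCl_wittDigits_wittCoord p κ O bΞ φ' m
  have hrkη (m) : algRk κ (wittDigits (p := p) (ramEval p κ O P ξ) m) =
      algRk κ ((fun t => φ' (ArcRing.of p κ O Ξ (MvPolynomial.X t))) '' {t | t.2.2 < m}) := by
    rw [← algRk_algCl, hclη, algRk_algCl]
  have hfin : (wittDigits (p := p) ξ (e + 1)).Finite := by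
    refine (Set.finite_range fun t : (Fin n × RamIndex p κ O) × Fin (e + 1) =>
      WittVector.coeff (p := p) (ξ t.1) t.2).subset ?_
    rintro _ ⟨i, k, hk, rfl⟩
    exact ⟨(i, ⟨k, hk⟩), rfl⟩
  -- The first `e + 1` layers of `ξ` consist of finitely many elements, each algebraic over finitely
  -- many components of the image arc.
  obtain ⟨M₁, hM₁⟩ := exists_nat_subset_algCl (κ := κ) (fun t : ArcIndex p κ O Ξ => t.2.2) hfin
    fun x _ => algCl_subset_algCl (range_arcRing_subset_algCl p κ O φ') (hF x)
  rw [← hclη] at hM₁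
  let N := M + M' + e + M₁ + (2 * e + 1)
  have key := (hasWittJacobian_ramEval p κ O (F := F) P).algRk_wittDigits (x := ξ) (e := e)
    (fun k hk => (det_ramJacobian_arcHom p κ O bΩ bΞ f φ k).trans (h0 k hk))
    (fun h => h1 ((det_ramJacobian_arcHom p κ O bΩ bΞ f φ e).symm.trans h)) (c := c) (M₀ := M)
    (fun m hm => by
      rw [← hc, hrkξ, hM m hm, hnΩ]
      simp) hM₁ (M := N) (by omega) (by omega) (by omega)
  have h2 := hM N (by omega)
  have h3 := hM' N (by omega)
  rw [← hrkξ, hnΩ, hc] at h2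
  rw [← hrkη, hnΞ, hc', ← h2, ← key] at h3
  have h4 : algRk κ (wittDigits (p := p) (ramEval p κ O P ξ) N) ≠ ⊤ := by
    intro h
    rw [h] at key
    rw [← key, top_add, add_top] at h2
    exact ENat.natCast_ne_top _ h2.symm
  lift algRk κ (wittDigits (p := p) (ramEval p κ O P ξ) N) to ℕ using h4 with r hr
  have h5 : c' + r = c + (r + e) := by exact_mod_cast h3
  omega

end ArcRank

/-! ### Residue fields and rings of functions -/

section ResidueFields

theorem surjective_residueFieldMap {X Y : Scheme.{u}} (i : X ⟶ Y) [SurjectiveOnStalks i] (x : X) :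
    Function.Surjective (i.residueFieldMap x).hom := by
  intro c
  obtain ⟨c, rfl⟩ := X.residue_surjective x c
  obtain ⟨a, rfl⟩ := i.stalkMap_surjective x c
  exact ⟨(Y.residue (i x)).hom a, congrArg (fun q : Y.presheaf.stalk (i x) ⟶ X.residueField x => q.hom a) (Scheme.residue_residueFieldMap i x)⟩

/-- The residue field of a point of `Spec B` is generated by the image of `B`. -/
theorem mem_algCl_range_of_residueField {κ : Type*} [Field κ] {B F : Type u} [CommRing B] [Field F]
    [Algebra κ B] [Algebra κ F] (φ : B →ₐ[κ] F) {Y : Scheme.{u}} (i : Y ⟶ Spec (CommRingCat.of B))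
    [SurjectiveOnStalks i] {y : Y} (γ : Y.residueField y ⟶ CommRingCat.of F)
    (h : Spec.map γ ≫ Y.fromSpecResidueField y ≫ i = Spec.map (CommRingCat.ofHom φ.toRingHom))
    (c : Y.residueField y) : γ.hom c ∈ algCl κ (Set.range φ) := by
  obtain ⟨c, rfl⟩ := surjective_residueFieldMap i y c
  have hU := isAffineOpen_top (Spec (CommRingCat.of B))
  obtain ⟨a, b, rfl⟩ := exists_germ_residue_eq hU (y := i y) trivial c
  let ψ : Γ(Spec (CommRingCat.of B), ⊤) ⟶ CommRingCat.of F :=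
    (Spec (CommRingCat.of B)).presheaf.germ ⊤ (i y) trivial ≫
      (Spec (CommRingCat.of B)).residue (i y) ≫ i.residueFieldMap y ≫ γ
  have h1 : (Scheme.ΓSpecIso (CommRingCat.of B)).inv ≫ ψ = CommRingCat.ofHom φ.toRingHom := by
    apply Spec.map_injective
    rw [← h, ← Scheme.Hom.SpecMap_residueFieldMap_fromSpecResidueField,
      Scheme.fromSpecResidueField, ← hU.fromSpecStalk_eq_fromSpecStalk (x := i y) trivial]
    have h0 : hU.fromSpecStalk (x := i y) trivial =
      Spec.map ((Spec (CommRingCat.of B)).presheaf.germ ⊤ (i y) trivial) ≫ hU.fromSpec := rfl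
    rw [h0, IsAffineOpen.fromSpec_top, Scheme.isoSpec_Spec_inv]
    simp only [ψ, Spec.map_comp, Category.assoc]
  have h2 (a) : ψ.hom a ∈ Set.range φ :=
    ⟨(Scheme.ΓSpecIso (CommRingCat.of B)).hom.hom a, by
      refine (congrArg (fun q => q.hom ((Scheme.ΓSpecIso (CommRingCat.of B)).hom.hom a)) h1).symm.trans ?_
      change ψ.hom (((Scheme.ΓSpecIso (CommRingCat.of B)).hom ≫
        (Scheme.ΓSpecIso (CommRingCat.of B)).inv).hom a) = _
      rw [Iso.hom_inv_id]
      rfl⟩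
  rw [map_div₀, map_div₀, ← mem_algClField]
  exact div_mem (mem_algClField.2 (subset_algCl _ (h2 a))) (mem_algClField.2 (subset_algCl _ (h2 b)))

end ResidueFields

/-! ## Codimensions under étale maps of arc spaces -/

theorem IsGenericPt.eq_of_specializes_of_isInducing {X Y : Type*} [TopologicalSpace X]
    [TopologicalSpace Y] {i : X → Y} (hi : Topology.IsInducing i) {x : X} (hx : IsGenericPt x) :
    ∀ y ∈ Set.range i, y ⤳ i x → y = i x := by
  rintro _ ⟨y, rfl⟩ h
  rw [hx y (hi.specializes_iff.1 h)]

section Codim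

variable (p : ℕ) [Fact p.Prime] (κ : Type u) [Field κ] [CharP κ p]
  (O : Type v) [CommRing O] [Algebra (WittVector p κ) O]
  {Ω : Type w} [AddCommGroup Ω] [Module O Ω]

/-- The codimension of a pfp-locally closed subscheme of an arc space is the height of its generic
points. -/
theorem IsPfpLocallyClosedOfCodim.height_eq {X : Scheme.{u}} {i : X ⟶ ArcSpace p κ O Ω} {c : ℤ}
    (h : IsPfpLocallyClosedOfCodim p (arcStructure p κ O Ω) i c) {x : X} (hx : IsGenericPt x)
    {y : PrimeSpectrum (ArcRing p κ O Ω)} (hy : i x = y) :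
    ∃ k : ℕ, y.asIdeal.height = k ∧ c = k := by
  have := h.immersion
  have h1 (k : ℕ) : (k : ℕ∞) ≤ y.asIdeal.height ↔ (k : ℤ) ≤ c := by
    rw [← hasGenChain_iff_le_height, ← neg_neg c,
      ← h.relDim.hasGenChain_iff (hasPerfectCharts_arcSpace p κ O Ω)
      (hasNiceAffineSpaces_arcSpace p κ O Ω) hx k, hy]
    rfl
  have h0 : 0 ≤ c := (h1 0).1 (by simp)
  lift c to ℕ using h0
  refine ⟨c, ?_, rfl⟩
  refine ENat.forall_natCast_le_iff_le.1 (fun n hn => ?_) |>.antisymm ((h1 c).2 le_rfl)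
  exact_mod_cast (h1 n).1 hn

/-- Vanishing of functions on a constructible subset of an arc space can be tested on rational
points. -/
theorem ArcRing.forall_mem_of_isConstructible [IsAlgClosed κ]
    {C : Set (PrimeSpectrum (ArcRing p κ O Ω))} (hC : Topology.IsConstructible C)
    {a : ArcRing p κ O Ω} (h : ∀ ψ : ArcRing p κ O Ω →ₐ[κ] κ, kerPt ψ ∈ C → ψ a = 0)
    {y : PrimeSpectrum (ArcRing p κ O Ω)} (hy : y ∈ C) : a ∈ y.asIdeal := by
  by_contra ha
  obtain ⟨ψ, hψ, hψa⟩ := exists_kerPt_arcRing_mem_of_isConstructible p κ O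
    (hC.inter (PrimeSpectrum.isConstructible_basicOpen (f := a))) ⟨y, hy, ha⟩
  exact hψa (h ψ hψ)

theorem ArcRing.forall_notMem_of_isConstructible [IsAlgClosed κ]
    {C : Set (PrimeSpectrum (ArcRing p κ O Ω))} (hC : Topology.IsConstructible C)
    {a : ArcRing p κ O Ω} (h : ∀ ψ : ArcRing p κ O Ω →ₐ[κ] κ, kerPt ψ ∈ C → ψ a ≠ 0)
    {y : PrimeSpectrum (ArcRing p κ O Ω)} (hy : y ∈ C) : a ∉ y.asIdeal := by
  intro ha
  obtain ⟨ψ, hψ, hψa⟩ := exists_kerPt_arcRing_mem_of_isConstructible p κ O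
    (hC.inter (PrimeSpectrum.isConstructible_basicOpen (f := a)).compl) ⟨y, hy, fun h => h ha⟩
  exact h ψ hψ (not_not.1 hψa)

variable [Module.Free (WittVector p κ) O] [Module.Finite (WittVector p κ) O]
  [Module.Free O Ω] [Module.Finite O Ω]
  {Ξ : Type w'} [AddCommGroup Ξ] [Module O Ξ] [Module.Free O Ξ] [Module.Finite O Ξ]

/-- The geometric hypotheses are turned into field theory at a generic point of `X`: codimensions
become heights, étaleness makes the residue field extension algebraic, and the condition on rational
points fixes the valuation of the Jacobian there. -/
theorem codim_eq_add_of_etale [IsAlgClosed κ] [IsDedekindDomain O] {ϖ : O} (hϖ : Irreducible ϖ)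
    {n : ℕ} (bΩ : Module.Basis (Fin n) O Ω) (bΞ : Module.Basis (Fin n) O Ξ)
    (f : CoordRing O Ξ →ₐ[O] CoordRing O Ω) {X Y : Scheme.{u}} [Nonempty X]
    {iX : X ⟶ ArcSpace p κ O Ω} {iY : Y ⟶ ArcSpace p κ O Ξ} {cX cY : ℤ}
    (hX : IsPfpLocallyClosedOfCodim p (arcStructure p κ O Ω) iX cX)
    (hY : IsPfpLocallyClosedOfCodim p (arcStructure p κ O Ξ) iY cY) {g : X ⟶ Y} [Etale g]
    (hXY : iX ≫ arcMap p κ O f = g ≫ iY) {e : ℕ}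
    (he : ∀ x : Ω, (∃ t : Spec (CommRingCat.of κ) ⟶ X, t ≫ iX = arcPoint p κ O x) →
      emultiplicity ϖ (jacobian bΩ bΞ f x).det = e) : cY = cX + e := by
  obtain ⟨x₀⟩ := ‹Nonempty X›
  obtain ⟨x, hx, -⟩ := exists_isGenericPt_specializes x₀
  have := hX.immersion
  have := hY.immersion
  have hgx : IsGenericPt (g x) := hx.map (Flat.generalizingMap g)
  -- An algebraic closure is perfect, as the arithmetic of Witt components requires, and it does not
  -- change transcendence degrees.
  let F : Type u := AlgebraicClosure (X.residueField x)
  let α : X.residueField x ⟶ CommRingCat.of F := CommRingCat.ofHom (algebraMap (X.residueField x) F)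
  let φ₀ : CommRingCat.of (ArcRing p κ O Ω) ⟶ CommRingCat.of F :=
    Spec.preimage (Spec.map α ≫ X.fromSpecResidueField x ≫ iX)
  have hφ₀ : Spec.map φ₀ = Spec.map α ≫ X.fromSpecResidueField x ≫ iX := Spec.map_preimage _
  let _ : Algebra κ F := (φ₀.hom.comp (algebraMap κ (ArcRing p κ O Ω))).toAlgebra
  have : CharP F p := charP_of_injective_algebraMap (algebraMap κ F).injective p
  let φ : ArcRing p κ O Ω →ₐ[κ] F := { φ₀.hom with commutes' := fun _ => rfl }
  let a := arcLift p κ O ((univArc p κ O Ω).comp f)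
  let δ : Y.residueField (g x) ⟶ CommRingCat.of F := g.residueFieldMap x ≫ α
  have hδ : Spec.map δ ≫ Y.fromSpecResidueField (g x) ≫ iY =
      Spec.map (CommRingCat.ofHom (φ.comp a).toRingHom) := by
    have h1 : CommRingCat.ofHom (φ.comp a).toRingHom = CommRingCat.ofHom a.toRingHom ≫ φ₀ := rfl
    have h2 : Spec.map (CommRingCat.ofHom a.toRingHom) = arcMap p κ O f := rfl
    have h3 : Spec.map δ ≫ Y.fromSpecResidueField (g x) ≫ iY =
        (Spec.map α ≫ X.fromSpecResidueField x ≫ iX) ≫ arcMap p κ O f := by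
      rw [Spec.map_comp, Category.assoc, Category.assoc, Category.assoc, hXY,
        ← Category.assoc (Spec.map (g.residueFieldMap x)),
        Scheme.Hom.SpecMap_residueFieldMap_fromSpecResidueField, Category.assoc]
    exact (h3.trans (congrArg₂ (fun (q : Spec (CommRingCat.of F) ⟶ ArcSpace p κ O Ω) r => q ≫ r)
      hφ₀.symm h2.symm)).trans ((congrArg Spec.map h1).trans (Spec.map_comp _ _)).symm
  have hptX : iX x = kerPt φ := by
    have h1 : kerPt φ = Spec.map φ₀ (⊥ : PrimeSpectrum F) := by
      ext b
      rfl
    rw [h1, hφ₀]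
    exact (congrArg iX (X.fromSpecResidueField_apply x _)).symm
  have hptY : iY (g x) = kerPt (φ.comp a) := by
    have h1 : kerPt (φ.comp a) =
        Spec.map (CommRingCat.ofHom (φ.comp a).toRingHom) (⊥ : PrimeSpectrum F) := by
      ext b
      rfl
    rw [h1, ← hδ]
    exact (congrArg iY (Y.fromSpecResidueField_apply (g x) _)).symm
  have hC : Topology.IsConstructible (X := PrimeSpectrum (ArcRing p κ O Ω)) (Set.range iX) :=
    have : CompactSpace (ArcSpace p κ O Ω) :=
      inferInstanceAs (CompactSpace (Spec (CommRingCat.of (ArcRing p κ O Ω))))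
    have : QuasiSeparatedSpace (ArcSpace p κ O Ω) :=
      inferInstanceAs (QuasiSeparatedSpace (Spec (CommRingCat.of (ArcRing p κ O Ω))))
    hX.pfp.isConstructible_range
  have hD : Topology.IsConstructible (X := PrimeSpectrum (ArcRing p κ O Ξ)) (Set.range iY) :=
    have : CompactSpace (ArcSpace p κ O Ξ) :=
      inferInstanceAs (CompactSpace (Spec (CommRingCat.of (ArcRing p κ O Ξ))))
    have : QuasiSeparatedSpace (ArcSpace p κ O Ξ) :=
      inferInstanceAs (QuasiSeparatedSpace (Spec (CommRingCat.of (ArcRing p κ O Ξ))))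
    hY.pfp.isConstructible_range
  -- A rational point of the image of `X` comes from an element of `Ω` and lifts to `X`, so the
  -- hypothesis on `d(f; x)` gives its Jacobian valuation.
  have hrat (ψ : ArcRing p κ O Ω →ₐ[κ] κ) (hψ : kerPt ψ ∈ Set.range iX) :
      (∀ k < e, ψ (WittVector.coeff (p := p) (univDet p κ O bΩ bΞ f) k) = 0) ∧
        ψ (WittVector.coeff (p := p) (univDet p κ O bΩ bΞ f) e) ≠ 0 := by
    obtain ⟨z, rfl⟩ := exists_arcPointHom_eq p κ O ψ
    have ht := exists_lift_of_isImmersion iX (arcPoint p κ O z) (by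
      rintro _ ⟨b, rfl⟩
      have h1 : b = (⊥ : PrimeSpectrum κ) := Subsingleton.elim _ _
      have h2 : arcPoint p κ O z b = kerPt (arcPointHom p κ O z) := by
        rw [h1]
        exact PrimeSpectrum.ext (Ideal.ext fun _ => Iff.rfl)
      rw [h2]
      exact hψ)
    have h1 := coeff_norm_of_emultiplicity p κ O hϖ (he z ht)
    simp only [arcPointHom_univDet]
    exact h1
  have hmem : kerPt φ ∈ Set.range iX := ⟨x, hptX⟩
  obtain ⟨c, hc, rfl⟩ := hX.height_eq p κ O hx hptX
  obtain ⟨c', hc', rfl⟩ := hY.height_eq p κ O hgx hptY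
  have hst : SurjectiveOnStalks iY := inferInstance
  have : SurjectiveOnStalks (Y := Spec (CommRingCat.of (ArcRing p κ O Ξ))) iY := hst
  -- `F` is algebraic over the residue field at `g x`, which in turn is generated by the components
  -- of the image arc.
  have hF (z : F) : z ∈ algCl κ (Set.range (φ.comp a)) := by
    refine mem_algCl_of_isIntegralElem δ.hom
      (mem_algCl_range_of_residueField (φ.comp a) iY δ hδ) (?_ : δ.hom.IsIntegralElem z)
    have hg : (g.residueFieldMap x).hom.Finite :=
      finite_residueFieldMap_of_isPullback (IsPullback.of_id_fst (f := g)) x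
    have hα : α.hom.IsIntegral := fun z =>
      (Algebra.IsAlgebraic.isAlgebraic (R := X.residueField x) z).isIntegral
    exact RingHom.IsIntegral.trans _ _ hg.to_isIntegral hα z
  have key := height_kerPt_comp_arcLift p κ O bΩ bΞ f φ rfl hC hmem
    (hptX ▸ hx.eq_of_specializes_of_isInducing iX.isEmbedding.isInducing) hD ⟨g x, hptY⟩
    (hptY ▸ hgx.eq_of_specializes_of_isInducing iY.isEmbedding.isInducing) hF
    (fun k hk => ArcRing.forall_mem_of_isConstructible p κ O hC
      (fun ψ hψ => (hrat ψ hψ).1 k hk) hmem)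
    (ArcRing.forall_notMem_of_isConstructible p κ O hC (fun ψ hψ => (hrat ψ hψ).2) hmem) hc hc'
  exact_mod_cast key

end Codim

end

theorem mainTheorem8
    (p : ℕ) [Fact p.Prime] (κ : Type u) [Field κ] [IsAlgClosed κ] [CharP κ p]
    (K : Type v) [Field K] [Algebra (FractionRing (WittVector p κ)) K]
    [FiniteDimensional (FractionRing (WittVector p κ)) K]
    [Algebra (WittVector p κ) K]
    [IsScalarTower (WittVector p κ) (FractionRing (WittVector p κ)) K]
    (ϖ : integralClosure (WittVector p κ) K) (hϖ : Irreducible ϖ)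
    (n : ℕ)
    (Ω : Type w) [AddCommGroup Ω] [Module (integralClosure (WittVector p κ) K) Ω]
    [Module.Free (integralClosure (WittVector p κ) K) Ω]
    [Module.Finite (integralClosure (WittVector p κ) K) Ω]
    (Ξ : Type w') [AddCommGroup Ξ] [Module (integralClosure (WittVector p κ) K) Ξ]
    [Module.Free (integralClosure (WittVector p κ) K) Ξ]
    [Module.Finite (integralClosure (WittVector p κ) K) Ξ]
    (bΩ : Module.Basis (Fin n) (integralClosure (WittVector p κ) K) Ω)
    (bΞ : Module.Basis (Fin n) (integralClosure (WittVector p κ) K) Ξ)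
    (f : CoordRing (integralClosure (WittVector p κ) K) Ξ →ₐ[integralClosure (WittVector p κ) K]
      CoordRing (integralClosure (WittVector p κ) K) Ω)
    (X Y : Scheme.{u}) [Nonempty X]
    (iX : X ⟶ ArcSpace p κ (integralClosure (WittVector p κ) K) Ω)
    (iY : Y ⟶ ArcSpace p κ (integralClosure (WittVector p κ) K) Ξ)
    (cX cY : ℤ)
    (hX : IsPfpLocallyClosedOfCodim p
      (arcStructure p κ (integralClosure (WittVector p κ) K) Ω) iX cX)
    (hY : IsPfpLocallyClosedOfCodim p
      (arcStructure p κ (integralClosure (WittVector p κ) K) Ξ) iY cY)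
    (g : X ⟶ Y)
    (hXY : IsPullback iX g (arcMap p κ (integralClosure (WittVector p κ) K) f) iY)
    (hfin : IsFinite g) (het : Etale g)
    (e : ℕ)
    (he : ∀ x : Ω,
      (∃ t : Spec (CommRingCat.of κ) ⟶ X,
        t ≫ iX = arcPoint p κ (integralClosure (WittVector p κ) K) x) →
      emultiplicity ϖ (jacobian bΩ bΞ f x).det = e) :
    cY = cX + e := by
  have : IsDedekindDomain (integralClosure (WittVector p κ) K) :=
    integralClosure.isDedekindDomain (WittVector p κ) (FractionRing (WittVector p κ)) K
  exact codim_eq_add_of_etale p κ _ hϖ bΩ bΞ f hX hY hXY.w he
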